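/- Let $n\ge 2$, let $(\mathcal S_0,\sigma_{ij})$ be a connected, complete, smooth $n$-dimensional Riemannian manifold (without boundary), let $\mathcal G$ be a compact, connected, semi-simple Lie group with Lie algebra $\mathfrak g$ and Cartan-Killing metric $\gamma_{ab}$ (minus the Killing form), and let $E_0$ be an adjoint bundle over $\mathcal S_0$, i.e. a smooth vector bundle with fibre $\mathfrak g$ and structure group $\mathrm{Ad}(\mathcal G)$. Let $A=(A^a_i)$ be a smooth connection in $E_0$ (locally $D=d+[A,\cdot\,]$) with curvature $F_{ij}=\partial_iA_j-\partial_jA_i+[A_i,A_j]$, let $\varPhi$ be a smooth section of $E_0$ with covariant derivatives $\varPhi^a_i$, let $V$ be a smooth real function on $E_0$, and let $\alpha_1,\alpha_2,m,\varLambda\in\mathbb R$. On $Q=(0,\infty)\times\mathcal S_0$, with $t$ the coordinate of the first factor, consider the operator $$ \begin{aligned} Pu={}&\frac1{32}\frac{n^2}{n-1}\ddot u-(n-1)t^{2-\frac4n}\varDelta u-\frac n2t^{2-\frac4n}Ru+\alpha_1\frac n8t^{2-\frac4n}F_{ij}F^{ij}u\\ &+\alpha_2\frac n4t^{2-\frac4n}\gamma_{ab}\sigma^{ij}\varPhi^a_i\varPhi^b_ju+\alpha_2\frac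 n2m\,t^{2-\frac4n}V(\varPhi)u+nt^2\varLambda u , \end{aligned} $$ where the Laplacian $\varDelta$, the scalar curvature $R$ and the raising of indices refer to $\sigma_{ij}$, and time is oriented by $\partial_t$. A time oriented Lorentzian manifold is called globally hyperbolic if it has a Cauchy hypersurface, i.e. a subset met exactly once by each inextendible piecewise $C^1$ causal curve. 1. With the Lorentz metric $d\bar s^2=-32\frac{n-1}{n^2}dt^2+\frac1{n-1}\sigma_{ij}dx^idx^j$, $Q$ is globally hyperbolic, and $P$ is symmetric on $C_c^\infty(Q)$ with respect to the $L^2$ scalar product of the volume measure of this metric. 2. With the Lorentz metric $d\bar s^2=-32\frac{n-1}{n^2}dt^2+\frac1{n-1}t^{\frac4n-2}\sigma_{ij}dx^idx^j$, $Q$ is globally hyperbolic and $P$ is normally hyperbolic, i.e. in local coordinates $P=-\bar g^{\alpha\beta}\partial_\alpha\partial_\beta+a^\alpha\partial_\alpha+b$ with smooth $a^\alpha$, $b$. 3. If $n\ge3$, then $P$ is not symmetric on $C_c^\infty(Q)$ with respect to the $L^2$ scalar product of the volume measure of the metric in 2, and $Q$ with this metric has a big bang singularity in $t=0$ in the following sense.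 The slices $M(t)=\{t\}\times\mathcal S_0$ are Cauchy hypersurfaces. For each $t_0$ the proper time of the future directed $C^1$ causal curves that end in $\{t\le t_0\}$ is bounded. The $M(t)$ are totally umbilical, and their mean curvature $H$ with respect to the past directed unit normal satisfies $H^2\to\infty$ as $t\to0$, uniformly on $M(t)$. For each $x\in\mathcal S_0$ and each pair of linearly independent $v,w\in T_x\mathcal S_0$ the sectional curvature of $Q$ at $(t,x)$ in the plane spanned by $(0,v)$ and $(0,w)$ tends to $+\infty$ as $t\to0$. -/

import Mathlib

open Set Filter Topology MeasureTheory Manifold Bundle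
open scoped ContDiff

namespace QuantizedGravity

noncomputable section

/-! ### Fields of bilinear forms on a manifold, in charts -/

section Tensors

variable {E : Type*} [NormedAddCommGroup E] [NormedSpace ℝ E]
  {H : Type*} [TopologicalSpace H] (I : ModelWithCorners ℝ E H)
  {M : Type*} [TopologicalSpace M] [ChartedSpace H M]

/-- A field of bilinear forms on the tangent spaces of `M`. -/
abbrev TwoTensor (M : Type*) [TopologicalSpace M] [ChartedSpace H M] : Type _ :=
  ∀ p : M, TangentSpace I p →L[ℝ] TangentSpace I p →L[ℝ] ℝ

variable {I}

/-- The bilinear form `g_x` as a form on the model space, `T_x M` being `E` by definition. -/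
def formAt (g : TwoTensor I M) (x : M) : E →L[ℝ] E →L[ℝ] ℝ := g x

/-- The Gram form `g_{ij}(y)` of `g` in the coordinates of the preferred chart at `x`. -/
def localMetric (g : TwoTensor I M) (x : M) (y : E) : E →L[ℝ] E →L[ℝ] ℝ :=
  let D : E →L[ℝ] E := mfderiv 𝓘(ℝ, E) I (extChartAt I x).symm y
  (formAt g ((extChartAt I x).symm y)).bilinearComp D D

/-- The Christoffel symbols `Γ(v, w)` at the coordinate point `y`:
`g(Γ(v, w), z) = (∂_v g(w, z) + ∂_w g(v, z) - ∂_z g(v, w)) / 2`. -/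
def christoffel (g : TwoTensor I M) (x : M) (y v w : E) : E :=
  let D := fderiv ℝ (localMetric g x) y
  (localMetric g x y).inverse ((1 / 2 : ℝ) • (D v w + D w v - (D.flip v).flip w))

/-- The curvature tensor `R(u, v) w = ∇_u ∇_v w - ∇_v ∇_u w - ∇_{[u, v]} w` at the point `x`,
computed in the preferred chart at `x`, which identifies `T_x M` with `E`. -/
def curvature (g : TwoTensor I M) (x : M) (u v w : E) : E :=
  let y := extChartAt I x x
  fderiv ℝ (fun z ↦ christoffel g x z v w) y u - fderiv ℝ (fun z ↦ christoffel g x z u w) y v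
    + christoffel g x y u (christoffel g x y v w) - christoffel g x y v (christoffel g x y u w)

/-- The sectional curvature of the plane spanned by `v, w` in `T_x M`. -/
def sectionalCurvature (g : TwoTensor I M) (x : M) (v w : TangentSpace I x) : ℝ :=
  formAt g x (curvature g x v w w) v / (g x v v * g x w w - g x v w ^ 2)

variable [FiniteDimensional ℝ E]

/-- The `i`-th member of the basis of `E` reciprocal, with respect to `B`, to the standard finite
basis `b` of `E`, that is `B^{ij} b_j`. -/
def reciprocal (B : E →L[ℝ] E →L[ℝ] ℝ) (i : Fin (Module.finrank ℝ E)) : E :=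
  B.inverse (LinearMap.toContinuousLinearMap ((Module.finBasis ℝ E).coord i))

/-- The trace `B^{ij} T_{ij}` of a bilinear `T` with respect to the nondegenerate form `B`. -/
def metricTrace (B : E →L[ℝ] E →L[ℝ] ℝ) (T : E → E → ℝ) : ℝ :=
  ∑ i, T (Module.finBasis ℝ E i) (reciprocal B i)

/-- The Ricci tensor. -/
def ricci (g : TwoTensor I M) (x : M) (v w : E) : ℝ :=
  ∑ i, (Module.finBasis ℝ E).coord i (curvature g x (Module.finBasis ℝ E i) v w)

/-- The scalar curvature. -/
def scalarCurvature (g : TwoTensor I M) (x : M) : ℝ :=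
  metricTrace (formAt g x) (ricci g x)

/-- The Laplace-Beltrami operator `Δ u = g^{ij} (∂_i ∂_j u - Γ^k_{ij} ∂_k u)`. -/
def laplacian (g : TwoTensor I M) (u : M → ℝ) (x : M) : ℝ :=
  let y := extChartAt I x x
  let f : E → ℝ := fun z ↦ u ((extChartAt I x).symm z)
  metricTrace (formAt g x) fun v w ↦ fderiv ℝ (fderiv ℝ f) y v w - fderiv ℝ f y (christoffel g x y v w)

/-- The volume measure of `g` on the domain of the preferred chart at `x`, of density
`|det g_{ij}|^{1/2}` with respect to Lebesgue measure in the coordinates. -/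
def chartVolume [MeasurableSpace M] [MeasurableSpace E] [BorelSpace E]
    (g : TwoTensor I M) (x : M) : Measure M :=
  let b := Module.finBasis ℝ E
  Measure.map (extChartAt I x).symm
    ((b.addHaar.restrict (extChartAt I x).target).withDensity fun y ↦
      ENNReal.ofReal √|(Matrix.of fun i j ↦ localMetric g x y (b i) (b j)).det|)

/-- The volume measure `|det g_{ij}|^{1/2} dx` of `g`. The measures of the chart domains agree on
overlaps, and the volume measure is the smallest measure that dominates all of them. -/
def volumeMeasure [MeasurableSpace M] [MeasurableSpace E] [BorelSpace E]
    (g : TwoTensor I M) : Measure M :=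
  ⨆ x : M, chartVolume g x

/-- `P` is symmetric on `C_c^∞(M)` with respect to the `L²` product of `μ`. -/
def IsSymmetricOperator [MeasurableSpace M] (I : ModelWithCorners ℝ E H) (μ : Measure M)
    (P : (M → ℝ) → (M → ℝ)) : Prop :=
  ∀ u v : M → ℝ, ContMDiff I 𝓘(ℝ, ℝ) ∞ u → ContMDiff I 𝓘(ℝ, ℝ) ∞ v →
    HasCompactSupport u → HasCompactSupport v →
    ∫ p, P u p * v p ∂μ = ∫ p, u p * P v p ∂μ

/-- `P` is a linear differential operator of second order with smooth coefficients and principal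
part `-g^{ij} ∂_i ∂_j`: locally `P u = -g^{ij} ∂_i ∂_j u + a^i ∂_i u + b u`. -/
def IsNormallyHyperbolic (g : TwoTensor I M) (P : (M → ℝ) → (M → ℝ)) : Prop :=
  ∀ x : M, ∃ (a : E → E) (b : E → ℝ),
    ContDiffOn ℝ ∞ a (extChartAt I x).target ∧ ContDiffOn ℝ ∞ b (extChartAt I x).target ∧
    ∀ u : M → ℝ, ContMDiff I 𝓘(ℝ, ℝ) ∞ u → ∀ y ∈ (extChartAt I x).target,
      let f : E → ℝ := fun z ↦ u ((extChartAt I x).symm z)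
      P u ((extChartAt I x).symm y) =
        -metricTrace (localMetric g x y) (fun v w ↦ fderiv ℝ (fderiv ℝ f) y v w)
          + fderiv ℝ f y (a y) + b y * f y

end Tensors

/-! ### Lorentzian causality -/

section Lorentz

variable {E : Type*} [NormedAddCommGroup E] [NormedSpace ℝ E]
  {H : Type*} [TopologicalSpace H] {I : ModelWithCorners ℝ E H}
  {M : Type*} [TopologicalSpace M] [ChartedSpace H M]

/-- A smooth symmetric tensor of signature `(-, +, …, +)`. -/
structure IsLorentzMetric (g : TwoTensor I M) : Prop where
  smooth : ∀ x : M, ContDiffOn ℝ ∞ (localMetric g x) (extChartAt I x).target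
  symm : ∀ (x : M) (v w : TangentSpace I x), g x v w = g x w v
  signature : ∀ x : M, ∃ e : TangentSpace I x, g x e e < 0 ∧
    ∀ v : TangentSpace I x, v ≠ 0 → g x e v = 0 → 0 < g x v v

/-- A continuous timelike vector field, which is declared to be future directed. -/
structure IsTimeOrientation [IsManifold I 1 M] (g : TwoTensor I M)
    (T : ∀ p : M, TangentSpace I p) : Prop where
  continuous : Continuous fun p ↦ (⟨p, T p⟩ : TangentBundle I M)
  timelike : ∀ p : M, g p (T p) (T p) < 0

/-- `v` is causal and future directed. -/
def IsFutureCausal (g : TwoTensor I M) (T : ∀ p : M, TangentSpace I p) (p : M)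
    (v : TangentSpace I p) : Prop :=
  g p v v ≤ 0 ∧ g p (T p) v < 0

/-- The velocity at time `s` of the curve `γ` on `[a, b]` (one-sided at the end points). -/
def velocity (I : ModelWithCorners ℝ E H) (γ : ℝ → M) (a b s : ℝ) : TangentSpace I (γ s) :=
  let L : ℝ →L[ℝ] TangentSpace I (γ s) := mfderivWithin 𝓘(ℝ, ℝ) I γ (Icc a b) s
  L 1

/-- `γ` restricted to `[a, b]` is a `C¹` future directed causal curve. -/
def IsCausalArc (g : TwoTensor I M) (T : ∀ p : M, TangentSpace I p) (γ : ℝ → M) (a b : ℝ) : Prop :=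
  ContMDiffOn 𝓘(ℝ, ℝ) I 1 γ (Icc a b) ∧
    ∀ s ∈ Icc a b, IsFutureCausal g T (γ s) (velocity I γ a b s)

/-- The Lorentzian length (proper time) of the arc `γ` on `[a, b]`. -/
def properTime (g : TwoTensor I M) (γ : ℝ → M) (a b : ℝ) : ℝ :=
  ∫ s in a..b, √(-g (γ s) (velocity I γ a b s) (velocity I γ a b s))

/-- `γ` is a piecewise `C¹` future directed causal curve without past or future end point; it is
parametrized by `ℝ`, and `D` is the locally finite set of its break points. -/
structure IsInextendibleCausalCurve (g : TwoTensor I M) (T : ∀ p : M, TangentSpace I p)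
    (γ : ℝ → M) : Prop where
  continuous : Continuous γ
  causal : ∃ D : Set ℝ, (∀ a b, (D ∩ Icc a b).Finite) ∧
    ∀ a b, a < b → Disjoint D (Ioo a b) → IsCausalArc g T γ a b
  no_future_end : ¬ ∃ p, Tendsto γ atTop (𝓝 p)
  no_past_end : ¬ ∃ p, Tendsto γ atBot (𝓝 p)

/-- A Cauchy hypersurface is met exactly once by every inextendible causal curve. -/
def IsCauchyHypersurface (g : TwoTensor I M) (T : ∀ p : M, TangentSpace I p) (S : Set M) : Prop :=
  ∀ γ : ℝ → M, IsInextendibleCausalCurve g T γ → ∃! s, γ s ∈ S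

/-- A time oriented Lorentzian manifold is globally hyperbolic if it has a Cauchy hypersurface. -/
structure IsGloballyHyperbolic [IsManifold I 1 M] (g : TwoTensor I M)
    (T : ∀ p : M, TangentSpace I p) : Prop where
  lorentz : IsLorentzMetric g
  timeOrientation : IsTimeOrientation g T
  cauchy : ∃ S : Set M, IsCauchyHypersurface g T S

/-! ### Spacelike hypersurfaces -/

variable {F : Type*} [NormedAddCommGroup F] [NormedSpace ℝ F]
  {K : Type*} [TopologicalSpace K] {J : ModelWithCorners ℝ F K}
  {S : Type*} [TopologicalSpace S] [ChartedSpace K S]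

/-- The metric induced by `g` on `S` through the immersion `ι : S → M`. -/
def inducedMetric (J : ModelWithCorners ℝ F K) (g : TwoTensor I M) (ι : S → M) : TwoTensor J S :=
  fun x ↦
    let D : F →L[ℝ] E := mfderiv J I ι x
    ((formAt g (ι x)).bilinearComp D D : F →L[ℝ] F →L[ℝ] ℝ)

/-- `ν` is the past directed unit normal field of the spacelike hypersurface `ι : S → M`. -/
def IsPastUnitNormal (J : ModelWithCorners ℝ F K) (g : TwoTensor I M)
    (T : ∀ p : M, TangentSpace I p) (ι : S → M) (ν : ∀ x : S, TangentSpace I (ι x)) : Prop :=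
  ∀ x : S, g (ι x) (ν x) (ν x) = -1 ∧ 0 < g (ι x) (T (ι x)) (ν x) ∧
    ∀ v : TangentSpace J x, g (ι x) (ν x) (mfderiv J I ι x v) = 0

/-- The second covariant derivative of the immersion `ι : S → M`,
`x^α_{ij} = ∂_i ∂_j x^α - Γ^k_{ij} x^α_k + Γ^α_{βγ} x^β_i x^γ_j`. -/
def secondCovariantDerivative (J : ModelWithCorners ℝ F K) (g : TwoTensor I M) (ι : S → M) (x : S)
    (v w : F) : E :=
  let y := extChartAt J x x
  let f : F → E := fun z ↦ extChartAt I (ι x) (ι ((extChartAt J x).symm z))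
  fderiv ℝ (fderiv ℝ f) y v w - fderiv ℝ f y (christoffel (inducedMetric J g ι) x y v w)
    + christoffel g (ι x) (f y) (fderiv ℝ f y v) (fderiv ℝ f y w)

/-- The second fundamental form with respect to the unit normal `ν`, defined by the Gauss formula
`x^α_{ij} = h_{ij} ν^α`, where `g(ν, ν) = -1`. -/
def secondFundamentalForm (J : ModelWithCorners ℝ F K) (g : TwoTensor I M) (ι : S → M)
    (ν : ∀ x : S, TangentSpace I (ι x)) (x : S) (v w : F) : ℝ :=
  -formAt g (ι x) (secondCovariantDerivative J g ι x v w) (ν x)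

variable [FiniteDimensional ℝ F]

/-- The mean curvature `H = g^{ij} h_{ij}`. -/
def meanCurvature (J : ModelWithCorners ℝ F K) (g : TwoTensor I M) (ι : S → M)
    (ν : ∀ x : S, TangentSpace I (ι x)) (x : S) : ℝ :=
  metricTrace (formAt (inducedMetric J g ι) x) (secondFundamentalForm J g ι ν x)

/-- The hypersurface is totally umbilical: `h_{ij} = (H / n) g_{ij}`, where `n = dim S`. -/
def IsUmbilical (J : ModelWithCorners ℝ F K) (g : TwoTensor I M) (ι : S → M)
    (ν : ∀ x : S, TangentSpace I (ι x)) : Prop :=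
  ∀ (x : S) (v w : TangentSpace J x), secondFundamentalForm J g ι ν x v w =
    meanCurvature J g ι ν x / Module.finrank ℝ F * inducedMetric J g ι x v w

end Lorentz

/-! ### The adjoint bundle, Yang-Mills and Higgs fields -/

section Gauge

variable {E : Type*} [NormedAddCommGroup E] [NormedSpace ℝ E]
  {H : Type*} [TopologicalSpace H] {I : ModelWithCorners ℝ E H}
  {M : Type*} [TopologicalSpace M] [ChartedSpace H M]
  {𝔤 : Type*} [NormedAddCommGroup 𝔤] [NormedSpace ℝ 𝔤]
  {G : Type*} [TopologicalSpace G] [ChartedSpace 𝔤 G] [Group G]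

instance instLieGroupMinSmoothness [LieGroup 𝓘(ℝ, 𝔤) ∞ G] :
    LieGroup 𝓘(ℝ, 𝔤) (minSmoothness ℝ 3) G :=
  LieGroup.of_le (n := ∞) <| by
    rw [minSmoothness_of_isRCLikeNormedField]
    exact ENat.LEInfty.out

/-- The Lie algebra of `G` is `T_1 G`, the model space `𝔤` of `G` as a vector space. This is its
Lie bracket. -/
def lieBracket (G : Type*) [TopologicalSpace G] [ChartedSpace 𝔤 G] [Group G] (a b : 𝔤) : 𝔤 :=
  let a' : GroupLieAlgebra 𝓘(ℝ, 𝔤) G := a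
  let b' : GroupLieAlgebra 𝓘(ℝ, 𝔤) G := b
  (⁅a', b'⁆ : GroupLieAlgebra 𝓘(ℝ, 𝔤) G)

/-- The adjoint action of `g` on the Lie algebra, the derivative at `1` of `h ↦ g h g⁻¹`. -/
def Ad (g : G) : 𝔤 →L[ℝ] 𝔤 :=
  mfderiv 𝓘(ℝ, 𝔤) 𝓘(ℝ, 𝔤) (fun h : G ↦ g * h * g⁻¹) 1

/-- The Cartan-Killing metric `γ_{ab}` of the Lie algebra: minus the Killing form, which is positive
definite if `G` is compact and semi-simple. -/
def cartanKilling (G : Type*) [TopologicalSpace G] [ChartedSpace 𝔤 G] [Group G]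
    [CompleteSpace 𝔤] [LieGroup 𝓘(ℝ, 𝔤) ∞ G] (a b : 𝔤) : ℝ :=
  -killingForm ℝ (GroupLieAlgebra 𝓘(ℝ, 𝔤) G) a b

variable {E₀ : M → Type*} [TopologicalSpace (TotalSpace 𝔤 E₀)]
  [∀ x, AddCommGroup (E₀ x)] [∀ x, Module ℝ (E₀ x)] [∀ x, TopologicalSpace (E₀ x)]
  [FiberBundle 𝔤 E₀]

/-- The fibre coordinate of `e` in the local trivialization centred at `i`. -/
def fiberCoord (𝔤 : Type*) [NormedAddCommGroup 𝔤] [NormedSpace ℝ 𝔤]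
    [TopologicalSpace (TotalSpace 𝔤 E₀)] [FiberBundle 𝔤 E₀] (i x : M) (e : E₀ x) : 𝔤 :=
  (trivializationAt 𝔤 E₀ i ⟨x, e⟩).2

/-- `E₀` is an adjoint bundle: its transition functions take values in `Ad(G)`. -/
def IsAdjointBundle (𝔤 : Type*) [NormedAddCommGroup 𝔤] [NormedSpace ℝ 𝔤]
    (G : Type*) [TopologicalSpace G] [ChartedSpace 𝔤 G] [Group G]
    (E₀ : M → Type*) [TopologicalSpace (TotalSpace 𝔤 E₀)]
    [∀ x, TopologicalSpace (E₀ x)] [FiberBundle 𝔤 E₀] : Prop :=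
  ∀ i j x : M, x ∈ (trivializationAt 𝔤 E₀ i).baseSet → x ∈ (trivializationAt 𝔤 E₀ j).baseSet →
    ∃ g : G, ∀ e : E₀ x, fiberCoord 𝔤 j x e = Ad g (fiberCoord 𝔤 i x e)

/-- The coordinate expression, in the preferred chart of `M` at `x`, of a `𝔤`-valued one-form. -/
def localOneForm (A : ∀ x : M, TangentSpace I x →L[ℝ] 𝔤) (x : M) (y : E) : E →L[ℝ] 𝔤 :=
  let D : E →L[ℝ] E := mfderiv 𝓘(ℝ, E) I (extChartAt I x).symm y
  let B : E →L[ℝ] 𝔤 := A ((extChartAt I x).symm y)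
  B.comp D

variable [∀ x, IsTopologicalAddGroup (E₀ x)] [∀ x, ContinuousSMul ℝ (E₀ x)]

/-- A smooth connection in the adjoint bundle `E₀`: a covariant derivative which in each local
trivialization has the form `d + [A, ·]` with a smooth `𝔤`-valued one-form `A = (A^a_i)`. -/
structure GaugeConnection (I : ModelWithCorners ℝ E H) (𝔤 : Type*) [NormedAddCommGroup 𝔤]
    [NormedSpace ℝ 𝔤] (G : Type*) [TopologicalSpace G] [ChartedSpace 𝔤 G] [Group G]
    (E₀ : M → Type*) [TopologicalSpace (TotalSpace 𝔤 E₀)]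
    [∀ x, AddCommGroup (E₀ x)] [∀ x, Module ℝ (E₀ x)] [∀ x, TopologicalSpace (E₀ x)]
    [∀ x, IsTopologicalAddGroup (E₀ x)] [∀ x, ContinuousSMul ℝ (E₀ x)] [FiberBundle 𝔤 E₀] where
  /-- The covariant derivative. -/
  cov : CovariantDerivative I 𝔤 E₀
  /-- The connection form in the local trivialization centred at `i`. -/
  form : M → ∀ x : M, TangentSpace I x →L[ℝ] 𝔤
  smooth_form : ∀ i x : M, ContDiffOn ℝ ∞ (localOneForm (form i) x)
    ((extChartAt I x).target ∩ (extChartAt I x).symm ⁻¹' (trivializationAt 𝔤 E₀ i).baseSet)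
  cov_eq : ∀ i x : M, x ∈ (trivializationAt 𝔤 E₀ i).baseSet → ∀ s : ∀ y : M, E₀ y,
    MDifferentiableAt I (I.prod 𝓘(ℝ, 𝔤)) (fun y ↦ TotalSpace.mk' 𝔤 y (s y)) x →
    let d : TangentSpace I x →L[ℝ] 𝔤 := mfderiv I 𝓘(ℝ, 𝔤) (fun y ↦ fiberCoord 𝔤 i y (s y)) x
    ∀ v : TangentSpace I x, fiberCoord 𝔤 i x (cov s x v) =
      d v + lieBracket G (form i x v) (fiberCoord 𝔤 i x (s x))

/-- The curvature `F_{ij} = ∂_i A_j - ∂_j A_i + [A_i, A_j]` at `x`, in the local trivialization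
centred at `x`. -/
def gaugeCurvature (A : GaugeConnection I 𝔤 G E₀) (x : M) (v w : E) : 𝔤 :=
  let y := extChartAt I x x
  let a := localOneForm (A.form x) x
  fderiv ℝ a y v w - fderiv ℝ a y w v + lieBracket G (a y v) (a y w)

variable [FiniteDimensional ℝ E] [CompleteSpace 𝔤] [LieGroup 𝓘(ℝ, 𝔤) ∞ G]

/-- `F_{ij} F^{ij} = γ_{ab} σ^{ik} σ^{jl} F^a_{ij} F^b_{kl}`. -/
def yangMillsDensity (σ : TwoTensor I M) (A : GaugeConnection I 𝔤 G E₀) (x : M) : ℝ :=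
  let b := Module.finBasis ℝ E
  ∑ i, ∑ j, cartanKilling G (gaugeCurvature A x (b i) (b j))
    (gaugeCurvature A x (reciprocal (formAt σ x) i) (reciprocal (formAt σ x) j))

/-- `γ_{ab} σ^{ij} Φ^a_i Φ^b_j`, where `Φ_i` is the covariant derivative of `Φ`. -/
def higgsDensity (σ : TwoTensor I M) (A : GaugeConnection I 𝔤 G E₀) (Φ : ∀ x : M, E₀ x)
    (x : M) : ℝ :=
  metricTrace (formAt σ x) fun v w ↦
    cartanKilling G (fiberCoord 𝔤 x x (A.cov Φ x v)) (fiberCoord 𝔤 x x (A.cov Φ x w))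

end Gauge

/-! ### The spacetime `Q` -/

section Q

/-- The half line of positive reals, as an open submanifold of `ℝ`. -/
abbrev PosReal : TopologicalSpace.Opens ℝ := ⟨Ioi 0, isOpen_Ioi⟩

variable {n : ℕ} {S₀ : Type*} [TopologicalSpace S₀]
  [ChartedSpace (EuclideanSpace ℝ (Fin n)) S₀]

/-- The model of `n`-dimensional manifolds. -/
abbrev IS (n : ℕ) : ModelWithCorners ℝ (EuclideanSpace ℝ (Fin n)) (EuclideanSpace ℝ (Fin n)) :=
  𝓘(ℝ, EuclideanSpace ℝ (Fin n))

/-- The model of `ℝ₊ × S₀`. -/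
abbrev IQ (n : ℕ) : ModelWithCorners ℝ (ℝ × EuclideanSpace ℝ (Fin n))
    (ModelProd ℝ (EuclideanSpace ℝ (Fin n))) :=
  𝓘(ℝ, ℝ).prod (IS n)

/-- A smooth Riemannian metric on `S₀`. -/
abbrev RiemannMetric (n : ℕ) (S₀ : Type*) [TopologicalSpace S₀]
    [ChartedSpace (EuclideanSpace ℝ (Fin n)) S₀] [IsManifold (IS n) ∞ S₀] : Type _ :=
  ContMDiffRiemannianMetric (IS n) ∞ (EuclideanSpace ℝ (Fin n)) (fun x : S₀ ↦ TangentSpace (IS n) x)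

/-- `σ` is complete: every Cauchy sequence for the Riemannian distance of `σ` converges. -/
def IsCompleteMetric [IsManifold (IS n) ∞ S₀] (σ : RiemannMetric n S₀) : Prop :=
  letI : RiemannianBundle (fun x : S₀ ↦ TangentSpace (IS n) x) := ⟨σ.toRiemannianMetric⟩
  ∀ u : ℕ → S₀,
    (∀ ε > 0, ∃ N, ∀ k ≥ N, ∀ l ≥ N, riemannianEDist (IS n) (u k) (u l) < ε) →
    ∃ x, Tendsto u atTop (𝓝 x)

/-- The metric `-32 (n-1)/n² dt² + f(t)/(n-1) σ_{ij} dx^i dx^j` on `Q = ℝ₊ × S₀`. -/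
def warpedMetric (σ : TwoTensor (IS n) S₀) (f : ℝ → ℝ) : TwoTensor (IQ n) (PosReal × S₀) :=
  fun p ↦
    let dt : ℝ × EuclideanSpace ℝ (Fin n) →L[ℝ] ℝ := ContinuousLinearMap.fst ℝ ℝ _
    let dx : ℝ × EuclideanSpace ℝ (Fin n) →L[ℝ] EuclideanSpace ℝ (Fin n) :=
      ContinuousLinearMap.snd ℝ ℝ _
    ((-(32 * ((n : ℝ) - 1) / (n : ℝ) ^ 2)) • (ContinuousLinearMap.mul ℝ ℝ).bilinearComp dt dt
      + (f p.1 / ((n : ℝ) - 1)) • (formAt σ p.2).bilinearComp dx dx :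
        (ℝ × EuclideanSpace ℝ (Fin n)) →L[ℝ] (ℝ × EuclideanSpace ℝ (Fin n)) →L[ℝ] ℝ)

/-- The vector field `∂/∂t` on `Q`, which orients time. -/
def timeField (p : PosReal × S₀) : TangentSpace (IQ n) p :=
  ((1, 0) : ℝ × EuclideanSpace ℝ (Fin n))

/-- A vector tangent to `S₀` as a vector tangent to the slice `{t} × S₀`. -/
def spatial (p : PosReal × S₀) (v : TangentSpace (IS n) p.2) : TangentSpace (IQ n) p :=
  ((0, v) : ℝ × EuclideanSpace ℝ (Fin n))

/-- The coordinate slice `M(t) = {t} × S₀` as an embedded hypersurface. -/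
def slice (t : PosReal) (x : S₀) : PosReal × S₀ := (t, x)

/-- `(Q, g)` has a big bang singularity in `t = 0`. The slices `M(t)` are Cauchy hypersurfaces, the
boundary `t = 0` is at a finite proper time in the past, the `M(t)` are totally umbilical, the
square of their mean curvature tends to infinity, uniformly on `M(t)`, as `t → 0`, and the
sectional curvatures of `(Q, g)` in the planes tangent to the slices become unbounded along each
line `{x = const}` as `t → 0`. -/
structure HasBigBang (g : TwoTensor (IQ n) (PosReal × S₀)) : Prop where
  cauchy : ∀ t : PosReal, IsCauchyHypersurface g timeField (range (slice (S₀ := S₀) t))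
  finite_past : ∀ t₀ : ℝ, ∃ L : ℝ, ∀ (γ : ℝ → PosReal × S₀) (a b : ℝ), a < b →
    IsCausalArc g timeField γ a b → ((γ b).1 : ℝ) ≤ t₀ → properTime g γ a b ≤ L
  crushing : ∃ ν : ∀ (t : PosReal) (x : S₀), TangentSpace (IQ n) (slice t x),
    (∀ t, IsPastUnitNormal (IS n) g timeField (slice t) (ν t)) ∧
    (∀ t, IsUmbilical (IS n) g (slice t) (ν t)) ∧
    ∀ C : ℝ, ∃ ε > 0, ∀ t : PosReal, (t : ℝ) < ε → ∀ x : S₀,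
      C < meanCurvature (IS n) g (slice t) (ν t) x ^ 2
  curvature_blowup : ∀ (x : S₀) (v w : TangentSpace (IS n) x), LinearIndependent ℝ ![v, w] →
    Tendsto (fun t : PosReal ↦ sectionalCurvature g (t, x) (spatial (t, x) v) (spatial (t, x) w))
      (comap Subtype.val (𝓝 0)) atTop

variable {𝔤 : Type*} [NormedAddCommGroup 𝔤] [NormedSpace ℝ 𝔤] [CompleteSpace 𝔤]
  {G : Type*} [TopologicalSpace G] [ChartedSpace 𝔤 G] [Group G] [LieGroup 𝓘(ℝ, 𝔤) ∞ G]
  {E₀ : S₀ → Type*} [TopologicalSpace (TotalSpace 𝔤 E₀)]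
  [∀ x, AddCommGroup (E₀ x)] [∀ x, Module ℝ (E₀ x)] [∀ x, TopologicalSpace (E₀ x)]
  [∀ x, IsTopologicalAddGroup (E₀ x)] [∀ x, ContinuousSMul ℝ (E₀ x)] [FiberBundle 𝔤 E₀]

/-- The second derivative of `u` with respect to `t` at `(t, x)`. -/
def timeDeriv2 (u : PosReal × S₀ → ℝ) (p : PosReal × S₀) : ℝ :=
  iteratedDeriv 2 (fun s : ℝ ↦ if h : 0 < s then u (⟨s, h⟩, p.2) else 0) p.1

/-- The wave operator of the quantized equation,
`1/32 n²/(n-1) ü - (n-1) t^{2-4/n} Δ u - n/2 t^{2-4/n} R u + α₁ n/8 t^{2-4/n} F_{ij} F^{ij} u`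
`+ α₂ n/4 t^{2-4/n} γ_{ab} σ^{ij} Φ^a_i Φ^b_j u + α₂ n/2 m t^{2-4/n} V(Φ) u + n t² Λ u`,
where `Δ`, `R` and the contractions refer to the metric `σ` on `S₀`. -/
def waveOperator (σ : TwoTensor (IS n) S₀) (A : GaugeConnection (IS n) 𝔤 G E₀)
    (Φ : ∀ x : S₀, E₀ x) (V : TotalSpace 𝔤 E₀ → ℝ) (α₁ α₂ m Λ : ℝ)
    (u : PosReal × S₀ → ℝ) (p : PosReal × S₀) : ℝ :=
  let t : ℝ := p.1
  let x : S₀ := p.2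
  let τ : ℝ := t ^ (2 - 4 / (n : ℝ))
  1 / 32 * ((n : ℝ) ^ 2 / ((n : ℝ) - 1)) * timeDeriv2 u p
    - ((n : ℝ) - 1) * τ * laplacian σ (fun y ↦ u (p.1, y)) x
    - (n : ℝ) / 2 * τ * scalarCurvature σ x * u p
    + α₁ * ((n : ℝ) / 8) * τ * yangMillsDensity σ A x * u p
    + α₂ * ((n : ℝ) / 4) * τ * higgsDensity σ A Φ x * u p
    + α₂ * ((n : ℝ) / 2) * m * τ * V ⟨x, Φ x⟩ * u p
    + (n : ℝ) * t ^ 2 * Λ * u p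

end Q

end

end QuantizedGravity

open QuantizedGravity

/-! Both metrics are warped products $-c\,dt^2+\frac{f(t)}{n-1}\sigma$ with $c=32(n-1)/n^2$
(`timeCoeff`), where $f=1$ in part 1 and $f=t^{4/n-2}$ in parts 2 and 3. The operator is
$Pu=c^{-1}\ddot u-(n-1)t^{2-4/n}\Delta_\sigma u+bu$ (`modelWave`); scalar curvature, Yang-Mills and
Higgs terms matter only through the smoothness of $b$.

Global hyperbolicity: along a future directed causal curve $t$ increases strictly, and the
$\sigma$-speed is at most $\sqrt{c(n-1)/f(t)}\,\dot t$. If $t$ converged to some $l\in(0,\infty)$ at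
an end of the curve, the projection to $\mathcal S_0$ would be Cauchy, hence convergent by
completeness, and the curve would have an end point (`IsInextendibleCausalCurve.exists_tendsto`). So
$t$ sweeps out all of $(0,\infty)$ and every slice is met exactly once
(`isCauchyHypersurface_slice`).

Symmetry: the volume density is a constant times $\rho(t)\sqrt{\det\sigma}$ with
$\rho=(f/(n-1))^{n/2}$. Multiplied by $\rho\sqrt{\det\sigma}$, $Pu\,v-u\,Pv$ is a divergence minus
$c^{-1}\rho'\sqrt{\det\sigma}\,(\dot u v-u\dot v)$ (`setIntegral_wronskian`). For $f=1$ the last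
term vanishes. For $f=t^{4/n-2}$ the factor $\rho$ is a multiple of $t^{2-n}$, so $\rho'<0$ if
$n\ge3$, and the pair $u=t\varphi$, $v=\varphi$, for which $\dot uv-u\dot v=\varphi^2$, violates
symmetry.

Normal hyperbolicity: the spatial part of the inverse of the second metric is
$(n-1)t^{2-4/n}\sigma^{ij}$, so that the principal parts agree.

Big bang: with $f'/f=(4/n-2)/t$ the slices have mean curvature $H=-nf'/(2\sqrt c f)$, and spatial
planes have sectional curvature $(n-1)K_\sigma/f+(f'/f)^2/(4c)$. As $t\to0$ the first term tends to
zero and the second grows like $t^{-2}$. Proper time up to $t$ is at most $\sqrt c\,t$.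

Much of the work is coordinate invariance. The definitions evaluate each quantity in the preferred
chart and trivialization of the point in question, which need not vary continuously with it. The
transformation laws of Christoffel symbols, curvature, Hessian, volume density and gauge curvature
(`IsPullback`, `formCurvature_gauge`) move everything to one fixed chart, where smoothness and
integration by parts make sense. -/

namespace QuantizedGravity

noncomputable section

set_option linter.unusedSectionVars false
set_option maxSynthPendingDepth 3

/-! ### Bilinear forms and traces -/

section LinearAlgebra

variable {E : Type*} [NormedAddCommGroup E] [NormedSpace ℝ E]

/-- A symmetric nondegenerate bilinear form. -/
structure IsNondegForm (B : E →L[ℝ] E →L[ℝ] ℝ) : Prop where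
  symm : ∀ v w, B v w = B w v
  inv : B.IsInvertible

theorem IsNondegForm.apply_inverse {B : E →L[ℝ] E →L[ℝ] ℝ} (hB : IsNondegForm B)
    (ξ : E →L[ℝ] ℝ) (v : E) : B (B.inverse ξ) v = ξ v := by
  rw [hB.inv.self_apply_inverse]

theorem IsNondegForm.apply_inverse' {B : E →L[ℝ] E →L[ℝ] ℝ} (hB : IsNondegForm B)
    (ξ : E →L[ℝ] ℝ) (v : E) : B v (B.inverse ξ) = ξ v := by
  rw [hB.symm, hB.apply_inverse]

theorem IsNondegForm.dual_symm {B : E →L[ℝ] E →L[ℝ] ℝ} (hB : IsNondegForm B)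
    (ξ η : E →L[ℝ] ℝ) : ξ (B.inverse η) = η (B.inverse ξ) := by
  rw [← hB.apply_inverse ξ, ← hB.apply_inverse η, hB.symm]

theorem IsNondegForm.ext {B : E →L[ℝ] E →L[ℝ] ℝ} (hB : IsNondegForm B) {v w : E}
    (h : ∀ z, B v z = B w z) : v = w := by
  have : B v = B w := ContinuousLinearMap.ext h
  rw [← hB.inv.inverse_apply_self v, this, hB.inv.inverse_apply_self]

theorem isInvertible_of_bijective [FiniteDimensional ℝ E] {F : Type*} [NormedAddCommGroup F]
    [NormedSpace ℝ F] {f : E →L[ℝ] F} (h : Function.Bijective f) : f.IsInvertible :=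
  ⟨(LinearEquiv.ofBijective f.toLinearMap h).toContinuousLinearEquiv, by ext; rfl⟩

/-- Injectivity into the dual space is enough because the dimensions agree. -/
theorem isNondegForm_of_injective [FiniteDimensional ℝ E] {B : E →L[ℝ] E →L[ℝ] ℝ}
    (hs : ∀ v w, B v w = B w v) (h : ∀ v, (∀ w, B v w = 0) → v = 0) : IsNondegForm B := by
  refine ⟨hs, isInvertible_of_bijective ?_⟩
  have hi : Function.Injective B.toLinearMap := by
    rw [injective_iff_map_eq_zero]
    intro v hv
    exact h v fun w ↦ by
      have : B v = 0 := hv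
      rw [this]; rfl
  have hd : Module.finrank ℝ E = Module.finrank ℝ (E →L[ℝ] ℝ) := by
    rw [← (LinearMap.toContinuousLinearMap : (E →ₗ[ℝ] ℝ) ≃ₗ[ℝ] _).finrank_eq]
    exact (Subspace.dual_finrank_eq).symm
  exact ⟨hi, (LinearMap.injective_iff_surjective_of_finrank_eq_finrank hd).1 hi⟩

theorem IsNondegForm.pullback {F : Type*} [NormedAddCommGroup F] [NormedSpace ℝ F]
    [FiniteDimensional ℝ E] {B : F →L[ℝ] F →L[ℝ] ℝ} (hB : IsNondegForm B)
    {L : E →L[ℝ] F} (hL : L.IsInvertible) : IsNondegForm (B.bilinearComp L L) := by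
  refine isNondegForm_of_injective (fun v w ↦ hB.symm _ _) fun v hv ↦ ?_
  have h0 : L v = 0 := hB.ext fun z ↦ by
    have := hv (L.inverse z)
    simpa [hL.self_apply_inverse] using this
  rw [← hL.inverse_apply_self v, h0, map_zero]

/-- Raising an index commutes with pull back; testing against `B` reduces this to the defining
property of both inverses. -/
theorem IsNondegForm.inverse_pullback {F : Type*} [NormedAddCommGroup F] [NormedSpace ℝ F]
    [FiniteDimensional ℝ E] {B : F →L[ℝ] F →L[ℝ] ℝ} (hB : IsNondegForm B)
    {L : E →L[ℝ] F} (hL : L.IsInvertible) (ξ : F →L[ℝ] ℝ) :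
    L ((B.bilinearComp L L).inverse (ξ.comp L)) = B.inverse ξ := by
  refine hB.ext fun z ↦ ?_
  rw [hB.apply_inverse]
  have := (hB.pullback hL).apply_inverse (ξ.comp L) (L.inverse z)
  simpa [hL.self_apply_inverse] using this

variable [FiniteDimensional ℝ E]

/-- A coordinate function of a basis, as a continuous functional. -/
def coordL {ι : Type*} (b : Module.Basis ι ℝ E) (i : ι) : E →L[ℝ] ℝ :=
  LinearMap.toContinuousLinearMap (b.coord i)

@[simp] theorem coordL_apply {ι : Type*} (b : Module.Basis ι ℝ E) (i : ι) (v : E) :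
    coordL b i v = b.repr v i := rfl

theorem sum_coordL_smul {ι : Type*} [Fintype ι] (b : Module.Basis ι ℝ E) (v : E) :
    ∑ i, coordL b i v • b i = v := b.sum_repr v

/-- The endomorphism obtained from a bilinear form by raising an index. -/
def raise (B : E →L[ℝ] E →L[ℝ] ℝ) (T : E →ₗ[ℝ] E →ₗ[ℝ] ℝ) : E →ₗ[ℝ] E :=
  B.inverse.toLinearMap ∘ₗ (LinearMap.toContinuousLinearMap : (E →ₗ[ℝ] ℝ) ≃ₗ[ℝ] _).toLinearMap ∘ₗ T

theorem sum_eq_trace {ι : Type*} [Fintype ι] (b : Module.Basis ι ℝ E) (f : E →ₗ[ℝ] E) :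
    ∑ i, b.coord i (f (b i)) = LinearMap.trace ℝ E f := by
  classical
  rw [LinearMap.trace_eq_matrix_trace ℝ b, Matrix.trace]
  simp [LinearMap.toMatrix_apply]

/-- Basis independence of contractions: by symmetry of the inverse form the sum is the trace of an
endomorphism. -/
theorem sum_eq_trace_raise {ι : Type*} [Fintype ι] {B : E →L[ℝ] E →L[ℝ] ℝ} (hB : IsNondegForm B)
    (b : Module.Basis ι ℝ E) (T : E →ₗ[ℝ] E →ₗ[ℝ] ℝ) :
    ∑ i, T (b i) (B.inverse (coordL b i)) = LinearMap.trace ℝ E (raise B T) := by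
  rw [← sum_eq_trace b]
  refine Finset.sum_congr rfl fun i _ ↦ ?_
  exact (hB.dual_symm (coordL b i) (LinearMap.toContinuousLinearMap (T (b i)))).symm

theorem metricTrace_eq_sum {ι : Type*} [Fintype ι] {B : E →L[ℝ] E →L[ℝ] ℝ} (hB : IsNondegForm B)
    (b : Module.Basis ι ℝ E) (T : E →ₗ[ℝ] E →ₗ[ℝ] ℝ) :
    metricTrace B (fun v w ↦ T v w) = ∑ i, T (b i) (B.inverse (coordL b i)) := by
  rw [sum_eq_trace_raise hB, ← sum_eq_trace_raise hB (Module.finBasis ℝ E)]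
  rfl

/-- In the image under `L` of the standard basis of `E` the two sums agree term by term. -/
theorem metricTrace_pullback {F : Type*} [NormedAddCommGroup F] [NormedSpace ℝ F]
    [FiniteDimensional ℝ F] {B : F →L[ℝ] F →L[ℝ] ℝ} (hB : IsNondegForm B)
    {L : E →L[ℝ] F} (hL : L.IsInvertible) (T : F →ₗ[ℝ] F →ₗ[ℝ] ℝ) :
    metricTrace (B.bilinearComp L L) (fun v w ↦ T (L v) (L w)) = metricTrace B (fun v w ↦ T v w) := by
  obtain ⟨e, rfl⟩ := hL
  rw [metricTrace_eq_sum hB ((Module.finBasis ℝ E).map e.toLinearEquiv)]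
  refine Finset.sum_congr rfl fun i _ ↦ ?_
  have h : (e : E →L[ℝ] F) (reciprocal (B.bilinearComp (e : E →L[ℝ] F) (e : E →L[ℝ] F)) i) =
      B.inverse (coordL ((Module.finBasis ℝ E).map e.toLinearEquiv) i) := by
    have h2 : coordL (Module.finBasis ℝ E) i =
        (coordL ((Module.finBasis ℝ E).map e.toLinearEquiv) i).comp (e : E →L[ℝ] F) := by
      ext v
      simp [coordL]
    rw [← hB.inverse_pullback ⟨e, rfl⟩, ← h2]
    rfl
  exact congrArg (T _) h

/-- The Gram matrix of a bilinear form. -/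
def gram {ι : Type*} (b : Module.Basis ι ℝ E) (B : E →L[ℝ] E →L[ℝ] ℝ) : Matrix ι ι ℝ :=
  Matrix.of fun i j ↦ B (b i) (b j)

theorem det_gram_pullback {ι : Type*} [Fintype ι] [DecidableEq ι] (b : Module.Basis ι ℝ E)
    (B : E →L[ℝ] E →L[ℝ] ℝ) (L : E →L[ℝ] E) :
    (gram b (B.bilinearComp L L)).det = L.det ^ 2 * (gram b B).det := by
  have h : gram b (B.bilinearComp L L) =
      (LinearMap.toMatrix b b L.toLinearMap).transpose * gram b B *
        LinearMap.toMatrix b b L.toLinearMap := by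
    ext i j
    simp only [gram, Matrix.of_apply, Matrix.mul_apply, Matrix.transpose_apply,
      LinearMap.toMatrix_apply, ContinuousLinearMap.bilinearComp_apply, ContinuousLinearMap.coe_coe]
    conv_lhs => rw [← b.sum_repr (L (b i)), ← b.sum_repr (L (b j))]
    simp only [map_sum, sum_apply, map_smul, smul_apply,
      smul_eq_mul, Finset.sum_mul, Finset.mul_sum]
    refine Finset.sum_congr rfl fun k _ ↦ Finset.sum_congr rfl fun l _ ↦ ?_
    ring
  rw [h, Matrix.det_mul, Matrix.det_mul, Matrix.det_transpose, LinearMap.det_toMatrix]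
  change L.det * _ * L.det = _
  ring

/-- The Gram matrix of the dual form in the dual basis is the inverse matrix. -/
theorem det_gram_ne_zero {ι : Type*} [Fintype ι] [DecidableEq ι] (b : Module.Basis ι ℝ E)
    {B : E →L[ℝ] E →L[ℝ] ℝ} (hB : IsNondegForm B) : (gram b B).det ≠ 0 := by
  rw [← isUnit_iff_ne_zero, ← Matrix.isUnit_iff_isUnit_det]
  refine IsUnit.of_mul_eq_one (Matrix.of fun i j ↦ coordL b i (B.inverse (coordL b j))) ?_
  ext i j
  simp only [Matrix.mul_apply, gram, Matrix.of_apply]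
  have := hB.apply_inverse' (coordL b j) (b i)
  conv_lhs at this => rw [← sum_coordL_smul b (B.inverse (coordL b j))]
  simp only [map_sum, map_smul, smul_eq_mul] at this
  rw [← Finset.sum_congr rfl fun k _ ↦ mul_comm _ _, this, coordL_apply, b.repr_self,
    Matrix.one_apply, Finsupp.single_apply]

/-- The standard basis of `ℝ × E` is unrelated to the product basis, so determinants in different
bases are compared only up to a constant. What matters is that it is positive and the same for all
forms. -/
theorem exists_det_gram_eq {ι κ : Type*} [Fintype ι] [DecidableEq ι] [Fintype κ] [DecidableEq κ]
    (b : Module.Basis ι ℝ E) (b' : Module.Basis κ ℝ E) :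
    ∃ C : ℝ, 0 < C ∧ ∀ B : E →L[ℝ] E →L[ℝ] ℝ, (gram b B).det = C * (gram b' B).det := by
  let e := b'.indexEquiv b
  let c := b'.reindex e
  let L : E →L[ℝ] E := LinearMap.toContinuousLinearMap (c.equiv b (Equiv.refl _)).toLinearMap
  have hL : ∀ i, L (c i) = b i := fun i ↦ by
    change (c.equiv b (Equiv.refl _)) (c i) = _
    simp
  refine ⟨L.det ^ 2, ?_, fun B ↦ ?_⟩
  · have : L.det ≠ 0 := by
      have h := LinearEquiv.isUnit_det' (c.equiv b (Equiv.refl _))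
      exact h.ne_zero
    positivity
  · have h1 : gram b B = gram c (B.bilinearComp L L) := by
      ext i j; simp [gram, hL]
    have h2 : gram c B = (gram b' B).submatrix e.symm e.symm := by
      ext i j; simp [gram, c]
    rw [h1, det_gram_pullback, h2, Matrix.det_submatrix_equiv_self]

end LinearAlgebra

end

end QuantizedGravity

namespace QuantizedGravity

noncomputable section

set_option linter.unusedSectionVars false
set_option maxSynthPendingDepth 3

/-! ### Metrics on open subsets of a vector space -/

section FlatGeometry

variable {E : Type*} [NormedAddCommGroup E] [NormedSpace ℝ E]

/-- The Christoffel symbols of a field of bilinear forms. -/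
def christoffelSymbol (G : E → E →L[ℝ] E →L[ℝ] ℝ) (y v w : E) : E :=
  let D := fderiv ℝ G y
  (G y).inverse ((1 / 2 : ℝ) • (D v w + D w v - (D.flip v).flip w))

/-- The curvature tensor of a field of bilinear forms. -/
def curvatureTensor (G : E → E →L[ℝ] E →L[ℝ] ℝ) (y u v w : E) : E :=
  fderiv ℝ (fun z ↦ christoffelSymbol G z v w) y u - fderiv ℝ (fun z ↦ christoffelSymbol G z u w) y v
    + christoffelSymbol G y u (christoffelSymbol G y v w)
    - christoffelSymbol G y v (christoffelSymbol G y u w)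

/-- The Koszul expression as a continuous linear map of the derivative of the metric. -/
def koszul : (E →L[ℝ] E →L[ℝ] E →L[ℝ] ℝ) →L[ℝ] (E →L[ℝ] E →L[ℝ] E →L[ℝ] ℝ) :=
  let fl := (ContinuousLinearMap.flipₗᵢ ℝ E E (E →L[ℝ] ℝ)).toContinuousLinearEquiv.toContinuousLinearMap
  let fl' := ContinuousLinearMap.compL ℝ E _ _
    (ContinuousLinearMap.flipₗᵢ ℝ E E ℝ).toContinuousLinearEquiv.toContinuousLinearMap
  (1 / 2 : ℝ) • (ContinuousLinearMap.id ℝ _ + fl - fl'.comp fl)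

theorem koszul_apply (D : E →L[ℝ] E →L[ℝ] E →L[ℝ] ℝ) (v w : E) :
    koszul D v w = (1 / 2 : ℝ) • (D v w + D w v - (D.flip v).flip w) := by
  ext z
  simp [koszul]

/-- The Christoffel symbols as a continuous bilinear map. -/
def christoffelL (G : E → E →L[ℝ] E →L[ℝ] ℝ) (y : E) : E →L[ℝ] E →L[ℝ] E :=
  (ContinuousLinearMap.compL ℝ E (E →L[ℝ] ℝ) E (G y).inverse).comp (koszul (fderiv ℝ G y))

theorem christoffelL_apply (G : E → E →L[ℝ] E →L[ℝ] ℝ) (y v w : E) :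
    christoffelL G y v w = christoffelSymbol G y v w := by
  simp [christoffelL, christoffelSymbol, koszul_apply]

/-- A smooth pseudo-Riemannian metric on an open set. -/
structure IsMetricOn (G : E → E →L[ℝ] E →L[ℝ] ℝ) (V : Set E) : Prop where
  isOpen : IsOpen V
  smooth : ContDiffOn ℝ ∞ G V
  nondeg : ∀ y ∈ V, IsNondegForm (G y)

variable {G G' : E → E →L[ℝ] E →L[ℝ] ℝ} {U V : Set E} {y : E}

theorem IsMetricOn.contDiffAt (hG : IsMetricOn G V) (hy : y ∈ V) : ContDiffAt ℝ ∞ G y :=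
  hG.smooth.contDiffAt (hG.isOpen.mem_nhds hy)

theorem IsMetricOn.differentiableAt (hG : IsMetricOn G V) (hy : y ∈ V) :
    DifferentiableAt ℝ G y :=
  (hG.contDiffAt hy).differentiableAt (by simp)

theorem IsMetricOn.apply_christoffel (hG : IsMetricOn G V) (hy : y ∈ V) (v w z : E) :
    G y (christoffelSymbol G y v w) z =
      1 / 2 * (fderiv ℝ G y v w z + fderiv ℝ G y w v z - fderiv ℝ G y z v w) := by
  rw [christoffelSymbol, (hG.nondeg y hy).apply_inverse]
  simp

theorem IsMetricOn.contDiffOn_inverse [CompleteSpace E] (hG : IsMetricOn G V) :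
    ContDiffOn ℝ ∞ (fun y ↦ (G y).inverse) V := fun y hy ↦
  (((hG.nondeg y hy).inv.contDiffAt_map_inverse (n := ∞)).comp y
    (hG.contDiffAt hy)).contDiffWithinAt

theorem IsMetricOn.contDiffOn_fderiv (hG : IsMetricOn G V) : ContDiffOn ℝ ∞ (fderiv ℝ G) V :=
  hG.smooth.fderiv_of_isOpen hG.isOpen (by simp)

theorem IsMetricOn.contDiffOn_christoffelL [CompleteSpace E] (hG : IsMetricOn G V) :
    ContDiffOn ℝ ∞ (christoffelL G) V :=
  ContDiffOn.clm_comp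
    ((ContinuousLinearMap.compL ℝ E (E →L[ℝ] ℝ) E).contDiff.comp_contDiffOn hG.contDiffOn_inverse)
    ((koszul (E := E)).contDiff.comp_contDiffOn hG.contDiffOn_fderiv)

theorem IsMetricOn.hasFDerivAt_christoffel [CompleteSpace E] (hG : IsMetricOn G V) (hy : y ∈ V)
    (v w : E) : HasFDerivAt (fun z ↦ christoffelSymbol G z v w)
      (((fderiv ℝ (christoffelL G) y).flip v).flip w) y := by
  have h : DifferentiableAt ℝ (christoffelL G) y :=
    (hG.contDiffOn_christoffelL.contDiffAt (hG.isOpen.mem_nhds hy)).differentiableAt (by simp)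
  simp_rw [← christoffelL_apply]
  have := ((h.hasFDerivAt.clm_apply (hasFDerivAt_const v y)).clm_apply (hasFDerivAt_const w y))
  refine this.congr_fderiv ?_
  ext u
  simp

/-- Letting the derivative fall on the bilinear map `christoffelL` makes the expression visibly
linear in all three vectors, as the traces require. -/
theorem IsMetricOn.curvatureTensor_eq [CompleteSpace E] (hG : IsMetricOn G V) (hy : y ∈ V)
    (u v w : E) : curvatureTensor G y u v w =
      fderiv ℝ (christoffelL G) y u v w - fderiv ℝ (christoffelL G) y v u w
      + christoffelL G y u (christoffelL G y v w) - christoffelL G y v (christoffelL G y u w) := by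
  simp only [curvatureTensor, (hG.hasFDerivAt_christoffel hy _ _).fderiv, christoffelL_apply]
  rfl

/-- `G'` is the pull back of the metric `G` by the local diffeomorphism `φ`. -/
structure IsPullback (G' G : E → E →L[ℝ] E →L[ℝ] ℝ) (φ : E → E) (U V : Set E) : Prop where
  isOpen : IsOpen U
  maps : MapsTo φ U V
  smooth : ContDiffOn ℝ ∞ φ U
  inv : ∀ y ∈ U, (fderiv ℝ φ y).IsInvertible
  metric : IsMetricOn G V
  eq : ∀ y ∈ U, G' y = (G (φ y)).bilinearComp (fderiv ℝ φ y) (fderiv ℝ φ y)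

variable {φ : E → E}

/-! ### Transformation laws under a local diffeomorphism -/

namespace IsPullback

variable (h : IsPullback G' G φ U V)
include h

theorem contDiffAt (hy : y ∈ U) : ContDiffAt ℝ ∞ φ y :=
  h.smooth.contDiffAt (h.isOpen.mem_nhds hy)

theorem contDiffOn_fderiv : ContDiffOn ℝ ∞ (fderiv ℝ φ) U :=
  h.smooth.fderiv_of_isOpen h.isOpen (by simp)

theorem hasFDerivAt (hy : y ∈ U) : HasFDerivAt φ (fderiv ℝ φ y) y :=
  ((h.contDiffAt hy).differentiableAt (by simp)).hasFDerivAt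

theorem hasFDerivAt_fderiv (hy : y ∈ U) :
    HasFDerivAt (fderiv ℝ φ) (fderiv ℝ (fderiv ℝ φ) y) y :=
  ((h.contDiffOn_fderiv.contDiffAt (h.isOpen.mem_nhds hy)).differentiableAt (by simp)).hasFDerivAt

theorem hasFDerivAt_fderiv2 (hy : y ∈ U) :
    HasFDerivAt (fderiv ℝ (fderiv ℝ φ)) (fderiv ℝ (fderiv ℝ (fderiv ℝ φ)) y) y :=
  (((h.contDiffOn_fderiv.fderiv_of_isOpen h.isOpen (m := ∞) (by simp)).contDiffAt
    (h.isOpen.mem_nhds hy)).differentiableAt (by simp)).hasFDerivAt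

theorem snd_symm (hy : y ∈ U) (v w : E) :
    fderiv ℝ (fderiv ℝ φ) y v w = fderiv ℝ (fderiv ℝ φ) y w v :=
  (h.contDiffAt hy).isSymmSndFDerivAt (by simp; exact ENat.LEInfty.out) v w

theorem third_symm (hy : y ∈ U) (u v w : E) :
    fderiv ℝ (fderiv ℝ (fderiv ℝ φ)) y u v w = fderiv ℝ (fderiv ℝ (fderiv ℝ φ)) y v u w := by
  have := (h.contDiffOn_fderiv.contDiffAt (h.isOpen.mem_nhds hy)).isSymmSndFDerivAt (by simp; exact ENat.LEInfty.out) u v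
  exact congrArg (fun L ↦ L w) this

theorem fderiv_metric (hy : y ∈ U) (u v w : E) :
    fderiv ℝ G' y u v w =
      fderiv ℝ G (φ y) (fderiv ℝ φ y u) (fderiv ℝ φ y v) (fderiv ℝ φ y w)
        + G (φ y) (fderiv ℝ (fderiv ℝ φ) y u v) (fderiv ℝ φ y w)
        + G (φ y) (fderiv ℝ φ y v) (fderiv ℝ (fderiv ℝ φ) y u w) := by
  have hGφ : HasFDerivAt (fun z ↦ G (φ z)) ((fderiv ℝ G (φ y)).comp (fderiv ℝ φ y)) y :=
    (h.metric.differentiableAt (h.maps hy)).hasFDerivAt.comp y (h.hasFDerivAt hy)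
  have hφ : ∀ v, HasFDerivAt (fun z ↦ fderiv ℝ φ z v) ((fderiv ℝ (fderiv ℝ φ) y).flip v) y := by
    intro v
    refine ((h.hasFDerivAt_fderiv hy).clm_apply (hasFDerivAt_const v y)).congr_fderiv ?_
    ext; simp
  have hd : DifferentiableAt ℝ G' y := by
    have hc : ContDiffAt ℝ ∞ (fun z ↦ (G (φ z)).bilinearComp (fderiv ℝ φ z) (fderiv ℝ φ z)) y := by
      have h1 := (h.metric.contDiffAt (h.maps hy)).comp y (h.contDiffAt hy)
      have h2 := h.contDiffOn_fderiv.contDiffAt (h.isOpen.mem_nhds hy)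
      -- `bilinearComp` is compose, flip, compose, flip; flipping is a linear isometry, hence
      -- smooth.
      have h3 := (h1.clm_comp h2)
      have h4 := ((ContinuousLinearMap.flipₗᵢ ℝ E E ℝ).contDiff.contDiffAt.comp y h3)
      have h5 := (ContinuousLinearMap.flipₗᵢ ℝ E E ℝ).contDiff.contDiffAt.comp y (h4.clm_comp h2)
      exact h5
    refine (hc.differentiableAt (by simp)).congr_of_eventuallyEq ?_
    filter_upwards [h.isOpen.mem_nhds hy] with z hz using h.eq z hz
  have h1 : HasFDerivAt (fun z ↦ G' z v w) (((fderiv ℝ G' y).flip v).flip w) y := by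
    refine ((hd.hasFDerivAt.clm_apply (hasFDerivAt_const v y)).clm_apply
      (hasFDerivAt_const w y)).congr_fderiv ?_
    ext; simp
  have h2 := (hGφ.clm_apply (hφ v)).clm_apply (hφ w)
  have h3 : (fun z ↦ G' z v w) =ᶠ[𝓝 y] fun z ↦ G (φ z) (fderiv ℝ φ z v) (fderiv ℝ φ z w) := by
    filter_upwards [h.isOpen.mem_nhds hy] with z hz
    rw [h.eq z hz]; rfl
  have := congrArg (fun L ↦ L u) (h1.unique (h2.congr_of_eventuallyEq h3))
  simp at this
  rw [this]
  ring

/-- Koszul formula, tested against vectors `fderiv ℝ φ y z`. The derivatives of `G'` bring six terms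
with second derivatives of `φ`; by symmetry four of them cancel, and the other two give the
inhomogeneous term. -/
theorem map_christoffel [FiniteDimensional ℝ E] (hy : y ∈ U) (v w : E) :
    fderiv ℝ φ y (christoffelSymbol G' y v w) =
      christoffelSymbol G (φ y) (fderiv ℝ φ y v) (fderiv ℝ φ y w)
        + fderiv ℝ (fderiv ℝ φ) y v w := by
  have hn := h.metric.nondeg _ (h.maps hy)
  refine hn.ext fun z ↦ ?_
  obtain ⟨z, rfl⟩ : ∃ z', fderiv ℝ φ y z' = z :=
    ⟨_, (h.inv y hy).self_apply_inverse z⟩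
  have h1 : G (φ y) (fderiv ℝ φ y (christoffelSymbol G' y v w)) (fderiv ℝ φ y z) =
      G' y (christoffelSymbol G' y v w) z := by rw [h.eq y hy]; rfl
  have h2 : G' y (christoffelSymbol G' y v w) z =
      1 / 2 * (fderiv ℝ G' y v w z + fderiv ℝ G' y w v z - fderiv ℝ G' y z v w) := by
    have : IsNondegForm (G' y) := by rw [h.eq y hy]; exact hn.pullback (h.inv y hy)
    rw [christoffelSymbol, this.apply_inverse]
    simp
  rw [h1, h2, h.fderiv_metric hy, h.fderiv_metric hy, h.fderiv_metric hy, map_add,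
    add_apply, h.metric.apply_christoffel (h.maps hy), h.snd_symm hy w v,
    h.snd_symm hy z v, h.snd_symm hy z w,
    hn.symm (fderiv ℝ φ y w) (fderiv ℝ (fderiv ℝ φ) y v z)]
  ring

theorem isMetricOn [FiniteDimensional ℝ E] : IsMetricOn G' U where
  isOpen := h.isOpen
  smooth := by
    have h1 := h.metric.smooth.comp h.smooth h.maps
    have h3 := h1.clm_comp h.contDiffOn_fderiv
    have h4 := (ContinuousLinearMap.flipₗᵢ ℝ E E ℝ).contDiff.comp_contDiffOn h3
    have h5 := (ContinuousLinearMap.flipₗᵢ ℝ E E ℝ).contDiff.comp_contDiffOn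
      (h4.clm_comp h.contDiffOn_fderiv)
    exact h5.congr fun y hy ↦ h.eq y hy
  nondeg y hy := by
    rw [h.eq y hy]
    exact (h.metric.nondeg _ (h.maps hy)).pullback (h.inv y hy)

/-- Differentiate the law for the Christoffel symbols and antisymmetrize in `u` and `v`: the third
derivative of `φ` drops out by symmetry, and the second derivatives cancel against those from the
quadratic part. -/
theorem map_curvature [FiniteDimensional ℝ E] (hy : y ∈ U) (u v w : E) :
    fderiv ℝ φ y (curvatureTensor G' y u v w) =
      curvatureTensor G (φ y) (fderiv ℝ φ y u) (fderiv ℝ φ y v) (fderiv ℝ φ y w) := by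
  have : CompleteSpace E := FiniteDimensional.complete ℝ E
  have hφ : ∀ v, HasFDerivAt (fun z ↦ fderiv ℝ φ z v) ((fderiv ℝ (fderiv ℝ φ) y).flip v) y := by
    intro v
    refine ((h.hasFDerivAt_fderiv hy).clm_apply (hasFDerivAt_const v y)).congr_fderiv ?_
    ext; simp
  have hΓ' : HasFDerivAt (christoffelL G') (fderiv ℝ (christoffelL G') y) y :=
    ((h.isMetricOn.contDiffOn_christoffelL.contDiffAt
      (h.isOpen.mem_nhds hy)).differentiableAt (by simp)).hasFDerivAt
  have hΓ : HasFDerivAt (fun z ↦ christoffelL G (φ z))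
      ((fderiv ℝ (christoffelL G) (φ y)).comp (fderiv ℝ φ y)) y :=
    ((h.metric.contDiffOn_christoffelL.contDiffAt
      (h.metric.isOpen.mem_nhds (h.maps hy))).differentiableAt (by simp)).hasFDerivAt.comp y
      (h.hasFDerivAt hy)
  have key : ∀ u v w, fderiv ℝ (fderiv ℝ φ) y u (christoffelL G' y v w)
      + fderiv ℝ φ y (fderiv ℝ (christoffelL G') y u v w) =
      fderiv ℝ (christoffelL G) (φ y) (fderiv ℝ φ y u) (fderiv ℝ φ y v) (fderiv ℝ φ y w)
      + christoffelL G (φ y) (fderiv ℝ (fderiv ℝ φ) y u v) (fderiv ℝ φ y w)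
      + christoffelL G (φ y) (fderiv ℝ φ y v) (fderiv ℝ (fderiv ℝ φ) y u w)
      + fderiv ℝ (fderiv ℝ (fderiv ℝ φ)) y u v w := by
    intro u v w
    have h1 := (h.hasFDerivAt_fderiv hy).clm_apply
      ((hΓ'.clm_apply (hasFDerivAt_const v y)).clm_apply (hasFDerivAt_const w y))
    have h2 := ((hΓ.clm_apply (hφ v)).clm_apply (hφ w)).add
      (((h.hasFDerivAt_fderiv2 hy).clm_apply (hasFDerivAt_const v y)).clm_apply
        (hasFDerivAt_const w y))
    have h3 : (fun z ↦ fderiv ℝ φ z (christoffelL G' z v w)) =ᶠ[𝓝 y]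
        fun z ↦ christoffelL G (φ z) (fderiv ℝ φ z v) (fderiv ℝ φ z w)
          + fderiv ℝ (fderiv ℝ φ) z v w := by
      filter_upwards [h.isOpen.mem_nhds hy] with z hz
      simp only [christoffelL_apply]
      exact h.map_christoffel hz v w
    have := congrArg (fun L ↦ L u) (h1.unique (h2.congr_of_eventuallyEq h3))
    simp at this
    rw [add_comm, this]
    abel
  have hmap : ∀ v w, fderiv ℝ φ y (christoffelL G' y v w) =
      christoffelL G (φ y) (fderiv ℝ φ y v) (fderiv ℝ φ y w)
        + fderiv ℝ (fderiv ℝ φ) y v w := fun v w ↦ by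
    simp only [christoffelL_apply]; exact h.map_christoffel hy v w
  rw [h.isMetricOn.curvatureTensor_eq hy, h.metric.curvatureTensor_eq (h.maps hy)]
  have k1 := eq_sub_of_add_eq' (key u v w)
  have k2 := eq_sub_of_add_eq' (key v u w)
  simp only [map_add, map_sub, hmap, k1, k2]
  rw [h.third_symm hy v u w, h.snd_symm hy v u]
  abel

/-- The second derivative of `φ` in the chain rule is cancelled by the inhomogeneous term of the
Christoffel symbols. -/
theorem hessian [FiniteDimensional ℝ E] {f : E → ℝ} (hf : ContDiffOn ℝ ∞ f V) (hy : y ∈ U)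
    (v w : E) :
    fderiv ℝ (fderiv ℝ (f ∘ φ)) y v w - fderiv ℝ (f ∘ φ) y (christoffelSymbol G' y v w) =
      fderiv ℝ (fderiv ℝ f) (φ y) (fderiv ℝ φ y v) (fderiv ℝ φ y w)
        - fderiv ℝ f (φ y) (christoffelSymbol G (φ y) (fderiv ℝ φ y v) (fderiv ℝ φ y w)) := by
  have hfd : ∀ z ∈ V, HasFDerivAt f (fderiv ℝ f z) z := fun z hz ↦
    ((hf.contDiffAt (h.metric.isOpen.mem_nhds hz)).differentiableAt (by simp)).hasFDerivAt
  have hff : HasFDerivAt (fderiv ℝ f) (fderiv ℝ (fderiv ℝ f) (φ y)) (φ y) :=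
    (((hf.fderiv_of_isOpen h.metric.isOpen (m := ∞) (by simp)).contDiffAt
      (h.metric.isOpen.mem_nhds (h.maps hy))).differentiableAt (by simp)).hasFDerivAt
  have h1 : ∀ z ∈ U, fderiv ℝ (f ∘ φ) z = (fderiv ℝ f (φ z)).comp (fderiv ℝ φ z) := fun z hz ↦
    ((hfd _ (h.maps hz)).comp z (h.hasFDerivAt hz)).fderiv
  have h2 : fderiv ℝ (f ∘ φ) =ᶠ[𝓝 y] fun z ↦ (fderiv ℝ f (φ z)).comp (fderiv ℝ φ z) := by
    filter_upwards [h.isOpen.mem_nhds hy] with z hz using h1 z hz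
  have h3 := ((hff.comp y (h.hasFDerivAt hy)).clm_comp (h.hasFDerivAt_fderiv hy))
  have h4 := congrArg (fun L ↦ L v w) (h3.congr_of_eventuallyEq h2).fderiv
  simp at h4
  rw [h4, h1 y hy, ContinuousLinearMap.comp_apply, h.map_christoffel hy, map_add]
  ring

end IsPullback

/-! ### Contractions: Laplacian, Ricci tensor and scalar curvature -/

section Traces

variable [FiniteDimensional ℝ E]

/-- The Hessian of `f` with respect to the metric `G`. -/
def hessianL (G : E → E →L[ℝ] E →L[ℝ] ℝ) (f : E → ℝ) (y : E) : E →L[ℝ] E →L[ℝ] ℝ :=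
  fderiv ℝ (fderiv ℝ f) y - ((ContinuousLinearMap.compL ℝ E E ℝ (fderiv ℝ f y)).comp
    (christoffelL G y))

theorem hessianL_apply (G : E → E →L[ℝ] E →L[ℝ] ℝ) (f : E → ℝ) (y v w : E) :
    hessianL G f y v w =
      fderiv ℝ (fderiv ℝ f) y v w - fderiv ℝ f y (christoffelSymbol G y v w) := by
  simp [hessianL, christoffelL_apply]

/-- The bilinear form underlying a continuous bilinear form. -/
def toBilin (B : E →L[ℝ] E →L[ℝ] ℝ) : E →ₗ[ℝ] E →ₗ[ℝ] ℝ :=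
  LinearMap.mk₂ ℝ (fun v w ↦ B v w) (by simp) (by simp) (by simp) (by simp)

@[simp] theorem toBilin_apply (B : E →L[ℝ] E →L[ℝ] ℝ) (v w : E) : toBilin B v w = B v w := rfl

/-- The Laplacian of `f` with respect to the metric `G`. -/
def flatLaplacian (G : E → E →L[ℝ] E →L[ℝ] ℝ) (f : E → ℝ) (y : E) : ℝ :=
  metricTrace (G y) fun v w ↦
    fderiv ℝ (fderiv ℝ f) y v w - fderiv ℝ f y (christoffelSymbol G y v w)

/-- The scalar curvature of the metric `G`. -/
def flatScalarCurvature (G : E → E →L[ℝ] E →L[ℝ] ℝ) (y : E) : ℝ :=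
  metricTrace (G y) fun v w ↦
    ∑ i, (Module.finBasis ℝ E).coord i (curvatureTensor G y (Module.finBasis ℝ E i) v w)

theorem IsPullback.flatLaplacian_comp (h : IsPullback G' G φ U V) {f : E → ℝ}
    (hf : ContDiffOn ℝ ∞ f V) (hy : y ∈ U) :
    flatLaplacian G' (f ∘ φ) y = flatLaplacian G f (φ y) := by
  simp only [flatLaplacian, h.hessian hf hy, h.eq y hy]
  simp only [← hessianL_apply]
  exact metricTrace_pullback (h.metric.nondeg _ (h.maps hy)) (h.inv y hy)
    (toBilin (hessianL G f (φ y)))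

/-- The curvature tensor as a trilinear map. -/
def curvatureL (G : E → E →L[ℝ] E →L[ℝ] ℝ) (y v w : E) : E →L[ℝ] E :=
  ((fderiv ℝ (christoffelL G) y).flip v).flip w - (fderiv ℝ (christoffelL G) y v).flip w
    + (christoffelL G y).flip (christoffelL G y v w)
    - (christoffelL G y v).comp ((christoffelL G y).flip w)

theorem IsMetricOn.curvatureL_apply (hG : IsMetricOn G V) (hy : y ∈ V) (u v w : E) :
    curvatureL G y v w u = curvatureTensor G y u v w := by
  have : CompleteSpace E := FiniteDimensional.complete ℝ E
  rw [hG.curvatureTensor_eq hy]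
  simp [curvatureL]

/-- The Ricci tensor as a bilinear map. -/
def ricciL (G : E → E →L[ℝ] E →L[ℝ] ℝ) (y : E) : E →ₗ[ℝ] E →ₗ[ℝ] ℝ :=
  LinearMap.mk₂ ℝ (fun v w ↦ LinearMap.trace ℝ E (curvatureL G y v w).toLinearMap)
    (fun v v' w ↦ by
      rw [← map_add]; congr 1; ext u; simp [curvatureL]; abel)
    (fun c v w ↦ by
      rw [← map_smul]; congr 1; ext u; simp [curvatureL]; module)
    (fun v w w' ↦ by
      rw [← map_add]; congr 1; ext u; simp [curvatureL]; abel)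
    (fun c v w ↦ by
      rw [← map_smul]; congr 1; ext u; simp [curvatureL]; module)

theorem IsMetricOn.ricciL_apply (hG : IsMetricOn G V) (hy : y ∈ V) (v w : E) :
    ricciL G y v w =
      ∑ i, (Module.finBasis ℝ E).coord i (curvatureTensor G y (Module.finBasis ℝ E i) v w) := by
  simp_rw [← hG.curvatureL_apply hy]
  exact (sum_eq_trace (Module.finBasis ℝ E) (curvatureL G y v w).toLinearMap).symm

theorem IsMetricOn.flatScalarCurvature_eq (hG : IsMetricOn G V) (hy : y ∈ V) :
    flatScalarCurvature G y = metricTrace (G y) fun v w ↦ ricciL G y v w := by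
  simp only [flatScalarCurvature, hG.ricciL_apply hy]

/-- The endomorphisms `u ↦ R(u, v) w` are conjugate by the derivative of `φ`, so their traces agree.
-/
theorem IsPullback.ricciL (h : IsPullback G' G φ U V) (hy : y ∈ U) (v w : E) :
    ricciL G' y v w = ricciL G (φ y) (fderiv ℝ φ y v) (fderiv ℝ φ y w) := by
  obtain ⟨e, he⟩ := h.inv y hy
  have : (curvatureL G (φ y) (fderiv ℝ φ y v) (fderiv ℝ φ y w)).toLinearMap =
      e.toLinearEquiv.conj (curvatureL G' y v w).toLinearMap := by
    ext u
    have := h.map_curvature hy (e.symm u) v w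
    rw [← h.isMetricOn.curvatureL_apply hy, ← h.metric.curvatureL_apply (h.maps hy)] at this
    have h2 : (fderiv ℝ φ y) (e.symm u) = u := by rw [← he]; simp
    rw [h2] at this
    rw [ContinuousLinearMap.coe_coe, ← this, ← he]
    rfl
  change LinearMap.trace ℝ E _ = LinearMap.trace ℝ E _
  rw [this, LinearMap.trace_conj']

theorem IsPullback.flatScalarCurvature (h : IsPullback G' G φ U V) (hy : y ∈ U) :
    flatScalarCurvature G' y = flatScalarCurvature G (φ y) := by
  rw [h.isMetricOn.flatScalarCurvature_eq hy, h.metric.flatScalarCurvature_eq (h.maps hy)]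
  simp only [h.eq y hy, h.ricciL hy]
  exact metricTrace_pullback (h.metric.nondeg _ (h.maps hy)) (h.inv y hy) (QuantizedGravity.ricciL G (φ y))

theorem IsMetricOn.contDiffOn_reciprocal (hG : IsMetricOn G V) (i : Fin (Module.finrank ℝ E)) :
    ContDiffOn ℝ ∞ (fun y ↦ reciprocal (G y) i) V :=
  have : CompleteSpace E := FiniteDimensional.complete ℝ E
  hG.contDiffOn_inverse.clm_apply contDiffOn_const

theorem IsMetricOn.contDiffOn_metricTrace (hG : IsMetricOn G V)
    {T : E → E →L[ℝ] E →L[ℝ] ℝ} (hT : ContDiffOn ℝ ∞ T V) :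
    ContDiffOn ℝ ∞ (fun y ↦ metricTrace (G y) fun v w ↦ T y v w) V := by
  unfold metricTrace
  exact ContDiffOn.sum fun i _ ↦ (hT.clm_apply contDiffOn_const).clm_apply
    (hG.contDiffOn_reciprocal i)

theorem IsMetricOn.contDiffOn_curvatureTensor (hG : IsMetricOn G V) {u v w : E → E}
    (hu : ContDiffOn ℝ ∞ u V) (hv : ContDiffOn ℝ ∞ v V) (hw : ContDiffOn ℝ ∞ w V) :
    ContDiffOn ℝ ∞ (fun y ↦ curvatureTensor G y (u y) (v y) (w y)) V := by
  have : CompleteSpace E := FiniteDimensional.complete ℝ E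
  have h1 := hG.contDiffOn_christoffelL
  have h2 : ContDiffOn ℝ ∞ (fderiv ℝ (christoffelL G)) V :=
    h1.fderiv_of_isOpen hG.isOpen (by simp)
  have h3 : ContDiffOn ℝ ∞ (fun y ↦ fderiv ℝ (christoffelL G) y (u y) (v y) (w y)
      - fderiv ℝ (christoffelL G) y (v y) (u y) (w y)
      + christoffelL G y (u y) (christoffelL G y (v y) (w y))
      - christoffelL G y (v y) (christoffelL G y (u y) (w y))) V :=
    (((((h2.clm_apply hu).clm_apply hv).clm_apply hw).sub
      (((h2.clm_apply hv).clm_apply hu).clm_apply hw)).add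
      ((h1.clm_apply hu).clm_apply ((h1.clm_apply hv).clm_apply hw))).sub
      ((h1.clm_apply hv).clm_apply ((h1.clm_apply hu).clm_apply hw))
  exact h3.congr fun y hy ↦ hG.curvatureTensor_eq hy _ _ _

theorem IsMetricOn.contDiffOn_flatScalarCurvature (hG : IsMetricOn G V) :
    ContDiffOn ℝ ∞ (flatScalarCurvature G) V := by
  unfold flatScalarCurvature metricTrace
  exact ContDiffOn.sum fun i _ ↦ ContDiffOn.sum fun j _ ↦
    (coordL (Module.finBasis ℝ E) j).contDiff.comp_contDiffOn
      (hG.contDiffOn_curvatureTensor contDiffOn_const contDiffOn_const (hG.contDiffOn_reciprocal i))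

end Traces

end FlatGeometry

end

end QuantizedGravity

namespace QuantizedGravity

noncomputable section

set_option linter.unusedSectionVars false
set_option maxSynthPendingDepth 3

/-! ### Charts -/

section Charts

variable {E : Type*} [NormedAddCommGroup E] [NormedSpace ℝ E]
  {H : Type*} [TopologicalSpace H] {I : ModelWithCorners ℝ E H} [I.Boundaryless]
  {M : Type*} [TopologicalSpace M] [ChartedSpace H M] [IsManifold I ∞ M]

/-- The change of coordinates from the preferred chart at `x'` to the one at `x`. -/
def transition (I : ModelWithCorners ℝ E H) (x' x : M) (y : E) : E :=
  extChartAt I x ((extChartAt I x').symm y)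

/-- The domain of the change of coordinates from the chart at `x'` to the chart at `x`. -/
def overlap (I : ModelWithCorners ℝ E H) (x' x : M) : Set E :=
  (extChartAt I x').target ∩ (extChartAt I x').symm ⁻¹' (extChartAt I x).source

variable {x x' : M} {y : E}

theorem isOpen_overlap : IsOpen (overlap I x' x) :=
  (continuousOn_extChartAt_symm x').isOpen_inter_preimage (isOpen_extChartAt_target x')
    (isOpen_extChartAt_source x)

theorem mapsTo_transition : MapsTo (transition I x' x) (overlap I x' x) (extChartAt I x).target :=
  fun _ hy ↦ (extChartAt I x).map_source hy.2

theorem mapsTo_transition' : MapsTo (transition I x' x) (overlap I x' x) (overlap I x x') :=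
  fun y hy ↦ ⟨mapsTo_transition hy, by
    simp only [transition, mem_preimage]
    rw [(extChartAt I x).left_inv hy.2]
    exact (extChartAt I x').map_target hy.1⟩

theorem symm_transition (hy : y ∈ overlap I x' x) :
    (extChartAt I x).symm (transition I x' x y) = (extChartAt I x').symm y :=
  (extChartAt I x).left_inv hy.2

theorem transition_transition (hy : y ∈ overlap I x' x) :
    transition I x x' (transition I x' x y) = y := by
  change extChartAt I x' ((extChartAt I x).symm (transition I x' x y)) = y
  rw [symm_transition hy]
  exact (extChartAt I x').right_inv hy.1

theorem contMDiffAt_chart_symm (hy : y ∈ (extChartAt I x).target) :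
    ContMDiffAt 𝓘(ℝ, E) I ∞ (extChartAt I x).symm y :=
  (contMDiffOn_extChartAt_symm x).contMDiffAt ((isOpen_extChartAt_target x).mem_nhds hy)

theorem contMDiffAt_chart {p : M} (hp : p ∈ (extChartAt I x).source) :
    ContMDiffAt I 𝓘(ℝ, E) ∞ (extChartAt I x) p :=
  contMDiffAt_extChartAt' (by simpa using hp)

theorem contDiffOn_transition : ContDiffOn ℝ ∞ (transition I x' x) (overlap I x' x) := fun y hy ↦ by
  refine ContDiffAt.contDiffWithinAt ?_
  rw [← contMDiffAt_iff_contDiffAt]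
  exact (contMDiffAt_chart hy.2).comp y (contMDiffAt_chart_symm hy.1)

theorem isInvertible_fderiv_transition (hy : y ∈ overlap I x' x) :
    (fderiv ℝ (transition I x' x) y).IsInvertible := by
  have key : ∀ {a b : M} {z : E}, z ∈ overlap I a b →
      (fderiv ℝ (transition I b a) (transition I a b z)).comp (fderiv ℝ (transition I a b) z) =
        ContinuousLinearMap.id ℝ E := by
    intro a b z hz
    have h1 := ((contDiffOn_transition.contDiffAt (isOpen_overlap.mem_nhds hz)).differentiableAt
      (by simp)).hasFDerivAt
    have h2 := ((contDiffOn_transition.contDiffAt (isOpen_overlap.mem_nhds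
      (mapsTo_transition' hz))).differentiableAt (by simp)).hasFDerivAt
    refine (h2.comp z h1).unique ((hasFDerivAt_id z).congr_of_eventuallyEq ?_)
    filter_upwards [isOpen_overlap.mem_nhds hz] with w hw using transition_transition hw
  have h := key (mapsTo_transition' hy)
  rw [transition_transition hy] at h
  exact ContinuousLinearMap.IsInvertible.of_inverse h (key hy)

/-- The derivative of the inverse of the preferred chart at `x`. -/
def chartDeriv (I : ModelWithCorners ℝ E H) (x : M) (y : E) : E →L[ℝ] E :=
  mfderiv 𝓘(ℝ, E) I (extChartAt I x).symm y

/-- Chain rule for the two inverse charts; the transformation laws of metrics and connection forms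
rest on it. -/
theorem chartDeriv_comp_transition (hy : y ∈ overlap I x' x) :
    (chartDeriv I x (transition I x' x y)).comp (fderiv ℝ (transition I x' x) y) =
      chartDeriv I x' y := by
  have h1 : MDifferentiableAt 𝓘(ℝ, E) 𝓘(ℝ, E) (transition I x' x) y :=
    ((contDiffOn_transition.contDiffAt (isOpen_overlap.mem_nhds hy)).differentiableAt
      (by simp)).mdifferentiableAt
  have h2 : MDifferentiableAt 𝓘(ℝ, E) I (extChartAt I x).symm (transition I x' x y) :=
    (contMDiffAt_chart_symm (mapsTo_transition hy)).mdifferentiableAt (by simp)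
  have h3 := mfderiv_comp y h2 h1
  rw [mfderiv_eq_fderiv] at h3
  refine Eq.trans h3.symm ?_
  refine Filter.EventuallyEq.mfderiv_eq ?_
  filter_upwards [isOpen_overlap.mem_nhds hy] with w hw using symm_transition hw

theorem localMetric_eq (g : TwoTensor I M) (x : M) (y : E) :
    localMetric g x y = (formAt g ((extChartAt I x).symm y)).bilinearComp (chartDeriv I x y)
      (chartDeriv I x y) := rfl

theorem localMetric_eq_pullback (g : TwoTensor I M) (hy : y ∈ overlap I x' x) :
    localMetric g x' y = (localMetric g x (transition I x' x y)).bilinearComp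
      (fderiv ℝ (transition I x' x) y) (fderiv ℝ (transition I x' x) y) := by
  simp only [localMetric_eq]
  rw [symm_transition hy, ← chartDeriv_comp_transition hy]
  rfl

theorem isInvertible_chartDeriv (hy : y ∈ (extChartAt I x).target) :
    (chartDeriv I x y).IsInvertible := by
  have := isInvertible_mfderivWithin_extChartAt_symm (I := I) (x := x) hy
  rw [I.range_eq_univ, mfderivWithin_univ] at this
  exact this

/-- By definition a tangent vector at `x` is its own coordinate vector in the preferred chart at
`x`. Hence `g x` is the Gram form at the base point. -/
theorem chartDeriv_self : chartDeriv I x (extChartAt I x x) = ContinuousLinearMap.id ℝ E := by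
  have := mfderivWithin_range_extChartAt_symm (I := I) (x := x)
  rw [I.range_eq_univ, mfderivWithin_univ] at this
  exact this

theorem localMetric_self (g : TwoTensor I M) : localMetric g x (extChartAt I x x) = formAt g x := by
  rw [localMetric_eq, chartDeriv_self, extChartAt_to_inv]
  rfl

/-- A smooth field of nondegenerate symmetric bilinear forms. -/
def IsPseudoRiemannian (g : TwoTensor I M) : Prop :=
  ∀ x : M, IsMetricOn (localMetric g x) (extChartAt I x).target

theorem IsPseudoRiemannian.isPullback {g : TwoTensor I M} (hg : IsPseudoRiemannian g) (x' x : M) :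
    IsPullback (localMetric g x') (localMetric g x) (transition I x' x) (overlap I x' x)
      (extChartAt I x).target where
  isOpen := isOpen_overlap
  maps := mapsTo_transition
  smooth := contDiffOn_transition
  inv _ hy := isInvertible_fderiv_transition hy
  metric := hg x
  eq _ hy := localMetric_eq_pullback g hy

theorem christoffel_eq (g : TwoTensor I M) (x : M) (y v w : E) :
    christoffel g x y v w = christoffelSymbol (localMetric g x) y v w := rfl

theorem curvature_eq (g : TwoTensor I M) (x : M) (u v w : E) :
    curvature g x u v w = curvatureTensor (localMetric g x) (extChartAt I x x) u v w := rfl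

/-- Set-up for comparing the preferred chart of a moving point, in which the definitions are
evaluated, with the fixed chart at `x`. -/
theorem mem_overlap_self (hy : y ∈ (extChartAt I x).target) :
    extChartAt I ((extChartAt I x).symm y) ((extChartAt I x).symm y) ∈
      overlap I ((extChartAt I x).symm y) x :=
  ⟨mem_extChartAt_target _, by
    rw [mem_preimage, extChartAt_to_inv]; exact (extChartAt I x).map_target hy⟩

theorem transition_self (hy : y ∈ (extChartAt I x).target) :
    transition I ((extChartAt I x).symm y) x
      (extChartAt I ((extChartAt I x).symm y) ((extChartAt I x).symm y)) = y := by
  rw [transition, extChartAt_to_inv, (extChartAt I x).right_inv hy]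

theorem contDiffOn_comp_chart_symm {u : M → ℝ} (hu : ContMDiff I 𝓘(ℝ, ℝ) ∞ u) :
    ContDiffOn ℝ ∞ (fun z ↦ u ((extChartAt I x).symm z)) (extChartAt I x).target := fun y hy ↦ by
  refine ContDiffAt.contDiffWithinAt ?_
  rw [← contMDiffAt_iff_contDiffAt]
  exact hu.contMDiffAt.comp y (contMDiffAt_chart_symm hy)

variable [FiniteDimensional ℝ E]

theorem flatLaplacian_congr (G : E → E →L[ℝ] E →L[ℝ] ℝ) {f f' : E → ℝ} (h : f =ᶠ[𝓝 y] f') :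
    flatLaplacian G f y = flatLaplacian G f' y := by
  simp only [flatLaplacian]
  rw [h.fderiv.fderiv_eq, h.fderiv_eq]

/-- The definition uses another chart at every point. Invariance under the transition map brings all
of them to the chart at `x`, where the result can be differentiated and integrated. -/
theorem laplacian_chart {g : TwoTensor I M} (hg : IsPseudoRiemannian g) {u : M → ℝ}
    (hu : ContMDiff I 𝓘(ℝ, ℝ) ∞ u) (hy : y ∈ (extChartAt I x).target) :
    laplacian g u ((extChartAt I x).symm y) =
      flatLaplacian (localMetric g x) (fun z ↦ u ((extChartAt I x).symm z)) y := by
  have h := mem_overlap_self hy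
  have h1 : laplacian g u ((extChartAt I x).symm y) =
      flatLaplacian (localMetric g ((extChartAt I x).symm y))
        (fun z ↦ u ((extChartAt I ((extChartAt I x).symm y)).symm z))
        (extChartAt I ((extChartAt I x).symm y) ((extChartAt I x).symm y)) := by
    rw [flatLaplacian, localMetric_self]; rfl
  rw [h1]
  conv_rhs => rw [← transition_self hy]
  rw [← (hg.isPullback _ x).flatLaplacian_comp (contDiffOn_comp_chart_symm hu) h]
  refine flatLaplacian_congr _ ?_
  filter_upwards [isOpen_overlap.mem_nhds h] with w hw
  simp only [Function.comp_apply]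
  rw [symm_transition hw]

theorem scalarCurvature_chart {g : TwoTensor I M} (hg : IsPseudoRiemannian g)
    (hy : y ∈ (extChartAt I x).target) :
    scalarCurvature g ((extChartAt I x).symm y) = flatScalarCurvature (localMetric g x) y := by
  have h := mem_overlap_self hy
  conv_rhs => rw [← transition_self hy]
  rw [← (hg.isPullback _ x).flatScalarCurvature h, flatScalarCurvature, localMetric_self]
  rfl

end Charts

/-! ### Riemannian metrics as smooth fields of Gram forms -/

section Riemannian

variable {E : Type*} [NormedAddCommGroup E] [NormedSpace ℝ E] [FiniteDimensional ℝ E]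
  {H : Type*} [TopologicalSpace H] {I : ModelWithCorners ℝ E H} [I.Boundaryless]
  {M : Type*} [TopologicalSpace M] [ChartedSpace H M] [IsManifold I ∞ M]

/-- Links the bundle language, in which the smoothness of `σ` is stated, with Gram forms: the
inverse trivialization sends constants to coordinate fields. -/
theorem symmL_eq_chartDeriv {x : M} {p : M} (hp : p ∈ (extChartAt I x).source) :
    ((trivializationAt E (TangentSpace I) x).symmL ℝ p : E →L[ℝ] E) =
      chartDeriv I x (extChartAt I x p) := by
  have := TangentBundle.symmL_trivializationAt (I := I) (x₀ := x) (x := p) (by simpa using hp)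
  rw [I.range_eq_univ, mfderivWithin_univ] at this
  exact this

theorem contMDiffOn_coordinate_field (x : M) (v : E) :
    ContMDiffOn I (I.prod 𝓘(ℝ, E)) ∞
      (fun p ↦ TotalSpace.mk' E p ((trivializationAt E (TangentSpace I) x).symmL ℝ p v))
      (extChartAt I x).source := by
  have h := Bundle.Trivialization.contMDiffOn_symm (IB := I) (n := ∞)
    (trivializationAt E (TangentSpace I : M → Type _) x)
  have h2 : ContMDiffOn I (I.prod 𝓘(ℝ, E)) ∞ (fun p : M ↦ (p, v)) (extChartAt I x).source :=
    contMDiffOn_id.prodMk contMDiffOn_const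
  refine (h.comp h2 fun p hp ↦ ?_).congr fun p hp ↦ ?_
  · rw [mem_preimage, Trivialization.mem_target]
    simpa using hp
  · have hp' : p ∈ (trivializationAt E (TangentSpace I : M → Type _) x).baseSet := by simpa using hp
    simp only [Function.comp_apply]
    rw [← Trivialization.mk_symm _ hp', Trivialization.symmL_apply _ hp']

/-- The entries of the Gram form are the values of `σ` on coordinate fields, which are smooth
sections; positivity gives nondegeneracy. -/
theorem isPseudoRiemannian_inner (σ : ContMDiffRiemannianMetric I ∞ E (fun x : M ↦ TangentSpace I x)) :
    IsPseudoRiemannian (I := I) σ.inner := fun x ↦ by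
  refine ⟨isOpen_extChartAt_target x, ?_, fun y hy ↦ ?_⟩
  · rw [contDiffOn_clm_apply]
    intro v
    rw [contDiffOn_clm_apply]
    intro w y hy
    refine ContDiffAt.contDiffWithinAt ?_
    rw [← contMDiffAt_iff_contDiffAt]
    let e := trivializationAt E (TangentSpace I : M → Type _) x
    have h1 : ContMDiffOn I 𝓘(ℝ, ℝ) ∞ (fun p : M ↦ σ.inner p (e.symmL ℝ p v) (e.symmL ℝ p w))
        (extChartAt I x).source := by
      have hh := ContMDiffOn.clm_bundle_apply₂ (F₃ := ℝ) (E₃ := fun _ : M ↦ ℝ)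
        (ψ := σ.inner) (b := id) (n := ∞)
        (σ.contMDiff.contMDiffOn (s := (extChartAt I x).source))
        (contMDiffOn_coordinate_field x v) (contMDiffOn_coordinate_field x w)
      intro p hp
      have := hh p hp
      rw [contMDiffWithinAt_totalSpace] at this
      exact this.2
    have h2 : ContMDiffAt I 𝓘(ℝ, ℝ) ∞ (fun p : M ↦ σ.inner p (e.symmL ℝ p v) (e.symmL ℝ p w))
        ((extChartAt I x).symm y) :=
      h1.contMDiffAt ((isOpen_extChartAt_source x).mem_nhds ((extChartAt I x).map_target hy))
    refine (h2.comp y (contMDiffAt_chart_symm hy)).congr_of_eventuallyEq ?_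
    filter_upwards [(isOpen_extChartAt_target x).mem_nhds hy] with z hz
    have h3 := symmL_eq_chartDeriv ((extChartAt I x).map_target hz)
    rw [(extChartAt I x).right_inv hz] at h3
    simp only [localMetric_eq, Function.comp_apply, e]
    rw [← h3]
    rfl
  · have hD := isInvertible_chartDeriv hy
    refine IsNondegForm.pullback ?_ hD
    refine isNondegForm_of_injective (σ.symm _) fun v hv ↦ ?_
    by_contra h0
    exact (σ.pos ((extChartAt I x).symm y) v h0).ne' (hv v)

end Riemannian

end

end QuantizedGravity

namespace QuantizedGravity

noncomputable section

set_option linter.unusedSectionVars false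
set_option maxSynthPendingDepth 3

/-! ### The volume measure -/

section FlatVolume

variable {E : Type*} [NormedAddCommGroup E] [NormedSpace ℝ E] [FiniteDimensional ℝ E]

theorem contDiffOn_gram {G : E → E →L[ℝ] E →L[ℝ] ℝ} {V : Set E} (hG : ContDiffOn ℝ ∞ G V)
    {ι : Type*} [Fintype ι] [DecidableEq ι] (b : Module.Basis ι ℝ E) :
    ContDiffOn ℝ ∞ (fun y ↦ (gram b (G y)).det) V := by
  simp only [Matrix.det_apply, gram, Matrix.of_apply]
  refine ContDiffOn.sum fun s _ ↦ ContDiffOn.const_smul _ (contDiffOn_prod fun i _ ↦ ?_)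
  exact (hG.clm_apply contDiffOn_const).clm_apply contDiffOn_const

/-- The density of the volume measure of the metric `B`. -/
def flatVolume (B : E → E →L[ℝ] E →L[ℝ] ℝ) (y : E) : ℝ :=
  √|(gram (Module.finBasis ℝ E) (B y)).det|

variable {B : E → E →L[ℝ] E →L[ℝ] ℝ} {V : Set E} {y : E}

theorem IsMetricOn.contDiffOn_flatVolume (hB : IsMetricOn B V) :
    ContDiffOn ℝ ∞ (flatVolume B) V := by
  have h0 : ∀ y ∈ V, (gram (Module.finBasis ℝ E) (B y)).det ≠ 0 := fun y hy ↦
    det_gram_ne_zero _ (hB.nondeg y hy)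
  exact (ContDiffOn.abs (contDiffOn_gram hB.smooth _) h0).sqrt fun y hy ↦
    (abs_pos.2 (h0 y hy)).ne'

theorem IsMetricOn.flatVolume_pos (hB : IsMetricOn B V) (hy : y ∈ V) : 0 < flatVolume B y :=
  Real.sqrt_pos.2 (abs_pos.2 (det_gram_ne_zero _ (hB.nondeg y hy)))

end FlatVolume

/-! ### The volume measure on the manifold -/

section Volume

variable {E : Type*} [NormedAddCommGroup E] [NormedSpace ℝ E] [FiniteDimensional ℝ E]
  [MeasurableSpace E] [BorelSpace E]
  {H : Type*} [TopologicalSpace H] {I : ModelWithCorners ℝ E H} [I.Boundaryless]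
  {M : Type*} [TopologicalSpace M] [ChartedSpace H M] [IsManifold I ∞ M]
  [MeasurableSpace M] [BorelSpace M]

/-- The density of the volume measure in the chart at `x`. -/
def volumeDensity (g : TwoTensor I M) (x : M) (y : E) : ℝ :=
  flatVolume (localMetric g x) y

variable {g : TwoTensor I M} {x z : M} {y : E}

theorem volumeDensity_nonneg : 0 ≤ volumeDensity g x y := Real.sqrt_nonneg _

theorem IsPseudoRiemannian.contDiffOn_volumeDensity (hg : IsPseudoRiemannian g) :
    ContDiffOn ℝ ∞ (volumeDensity g x) (extChartAt I x).target :=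
  (hg x).contDiffOn_flatVolume

theorem aemeasurable_chart_symm (μ : Measure E) :
    AEMeasurable (extChartAt I x).symm (μ.restrict (extChartAt I x).target) :=
  (continuousOn_extChartAt_symm x).aemeasurable (isOpen_extChartAt_target x).measurableSet

theorem chartVolume_eq (g : TwoTensor I M) (x : M) : chartVolume g x =
    Measure.map (extChartAt I x).symm
      (((Module.finBasis ℝ E).addHaar.restrict (extChartAt I x).target).withDensity fun y ↦
        ENNReal.ofReal (volumeDensity g x y)) := rfl

theorem chartVolume_apply {A : Set M} (hA : MeasurableSet A) :
    chartVolume g x A = ∫⁻ y in (extChartAt I x).target ∩ (extChartAt I x).symm ⁻¹' A,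
      ENNReal.ofReal (volumeDensity g x y) ∂(Module.finBasis ℝ E).addHaar := by
  rw [chartVolume_eq, Measure.map_apply_of_aemeasurable _ hA, withDensity_apply',
    Measure.restrict_restrict' (isOpen_extChartAt_target x).measurableSet, inter_comm]
  exact (aemeasurable_chart_symm _).mono_ac (withDensity_absolutelyContinuous _ _)

/-- The inverse chart is continuous only on its target, so measurability is obtained for the
restricted map. -/
theorem measurableSet_chart_preimage {A : Set M} (hA : MeasurableSet A) :
    MeasurableSet ((extChartAt I x).target ∩ (extChartAt I x).symm ⁻¹' A) := by
  have h := (continuousOn_extChartAt_symm (I := I) x).domRestrict.measurable hA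
  have := (isOpen_extChartAt_target (I := I) x).measurableSet.subtype_image h
  rwa [show (extChartAt I x).target.domRestrict (extChartAt I x).symm ⁻¹' A =
    Subtype.val ⁻¹' ((extChartAt I x).symm ⁻¹' A) from rfl, Subtype.image_preimage_coe] at this

theorem volumeDensity_transition (hy : y ∈ overlap I z x) :
    volumeDensity g z y =
      |(fderiv ℝ (transition I z x) y).det| * volumeDensity g x (transition I z x y) := by
  rw [volumeDensity, flatVolume, localMetric_eq_pullback g hy, det_gram_pullback, abs_mul, Real.sqrt_mul
    (abs_nonneg _), abs_of_nonneg (sq_nonneg _), Real.sqrt_sq_eq_abs]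
  rfl

/-- Change of variables: the Jacobian of the transition map is the quotient of the densities. -/
theorem chartVolume_apply_eq {A : Set M} (hA : MeasurableSet A)
    (hx : A ⊆ (extChartAt I x).source) (hz : A ⊆ (extChartAt I z).source) :
    chartVolume g z A = chartVolume g x A := by
  rw [chartVolume_apply hA, chartVolume_apply hA]
  set B := (extChartAt I z).target ∩ (extChartAt I z).symm ⁻¹' A with hB
  have hBo : B ⊆ overlap I z x := fun y hy ↦ ⟨hy.1, hx hy.2⟩
  have himg : (extChartAt I x).target ∩ (extChartAt I x).symm ⁻¹' A = transition I z x '' B := by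
    ext y
    constructor
    · rintro ⟨h1, h2⟩
      have ho : y ∈ overlap I x z := ⟨h1, hz h2⟩
      refine ⟨transition I x z y, ⟨mapsTo_transition ho, ?_⟩, transition_transition ho⟩
      rw [mem_preimage, symm_transition ho]
      exact h2
    · rintro ⟨y, hy, rfl⟩
      refine ⟨mapsTo_transition (hBo hy), ?_⟩
      rw [mem_preimage, symm_transition (hBo hy)]
      exact hy.2
  rw [himg, lintegral_image_eq_lintegral_abs_det_fderiv_mul _ (measurableSet_chart_preimage hA)
    (f' := fderiv ℝ (transition I z x))]
  · refine setLIntegral_congr_fun (measurableSet_chart_preimage hA) fun y hy ↦ ?_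
    rw [volumeDensity_transition (hBo hy), ENNReal.ofReal_mul (abs_nonneg _)]
  · intro y hy
    exact (((contDiffOn_transition.contDiffAt (isOpen_overlap.mem_nhds (hBo hy))).differentiableAt
      (by simp)).hasFDerivAt).hasFDerivWithinAt
  · intro y hy y' hy' h
    rw [← transition_transition (hBo hy), h, transition_transition (hBo hy')]

/-- Chart measures agree on overlaps and vanish off their own domains. So on the domain of the chart
at `x` none of them exceeds the measure of this chart. -/
theorem volumeMeasure_restrict (g : TwoTensor I M) (x : M) :
    (volumeMeasure g).restrict (extChartAt I x).source = chartVolume g x := by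
  have hs : MeasurableSet (extChartAt I x).source := (isOpen_extChartAt_source x).measurableSet
  have hc : ∀ z : M, chartVolume g z (extChartAt I z).sourceᶜ = 0 := fun z ↦ by
    rw [chartVolume_apply (isOpen_extChartAt_source z).measurableSet.compl]
    have : (extChartAt I z).target ∩ (extChartAt I z).symm ⁻¹' (extChartAt I z).sourceᶜ = ∅ := by
      ext y
      simp only [mem_inter_iff, mem_preimage, mem_compl_iff, mem_empty_iff_false, iff_false, not_and,
        not_not]
      exact fun hy ↦ (extChartAt I z).map_target hy
    rw [this]; simp
  have hx : (chartVolume g x).restrict (extChartAt I x).source = chartVolume g x :=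
    Measure.restrict_eq_self_of_ae_mem (by rw [ae_iff]; exact hc x)
  apply le_antisymm
  -- A supremum is bounded by one measure above all chart measures; the second summand disappears
  -- after restriction to the domain.
  · have hle : volumeMeasure g ≤
        chartVolume g x + (volumeMeasure g).restrict (extChartAt I x).sourceᶜ := by
      refine iSup_le fun z ↦ ?_
      rw [← Measure.restrict_add_restrict_compl (μ := chartVolume g z) hs]
      refine add_le_add ?_ (Measure.restrict_mono le_rfl (le_iSup (chartVolume g) z))
      refine Measure.le_iff.2 fun A hA ↦ ?_
      rw [Measure.restrict_apply hA]
      have hz : MeasurableSet (extChartAt I z).source := (isOpen_extChartAt_source z).measurableSet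
      calc chartVolume g z (A ∩ (extChartAt I x).source)
          ≤ chartVolume g z (A ∩ (extChartAt I x).source ∩ (extChartAt I z).source)
              + chartVolume g z (extChartAt I z).sourceᶜ := by
            refine (measure_mono ?_).trans (measure_union_le _ _)
            intro p hp
            by_cases h : p ∈ (extChartAt I z).source
            · exact Or.inl ⟨hp, h⟩
            · exact Or.inr h
        _ = chartVolume g x (A ∩ (extChartAt I x).source ∩ (extChartAt I z).source) := by
            rw [hc, add_zero, chartVolume_apply_eq ((hA.inter hs).inter hz)
              (fun p hp ↦ hp.1.2) (fun p hp ↦ hp.2)]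
        _ ≤ chartVolume g x A := measure_mono fun p hp ↦ hp.1.1
    refine (Measure.restrict_mono_measure hle _).trans ?_
    rw [Measure.restrict_add, Measure.restrict_restrict hs, hx]
    simp
  · rw [← hx]
    exact Measure.restrict_mono le_rfl (le_iSup (chartVolume g) x)

theorem integral_volumeMeasure {f : M → ℝ} (hf : Continuous f)
    (hs : Function.support f ⊆ (extChartAt I x).source) (hg : IsPseudoRiemannian g) :
    ∫ p, f p ∂volumeMeasure g = ∫ y in (extChartAt I x).target,
      f ((extChartAt I x).symm y) * volumeDensity g x y ∂(Module.finBasis ℝ E).addHaar := by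
  have hm : AEMeasurable (fun y ↦ (volumeDensity g x y).toNNReal)
      ((Module.finBasis ℝ E).addHaar.restrict (extChartAt I x).target) :=
    ((hg.contDiffOn_volumeDensity (x := x)).continuousOn.aemeasurable
      (isOpen_extChartAt_target x).measurableSet).real_toNNReal
  rw [← setIntegral_eq_integral_of_forall_compl_eq_zero (s := (extChartAt I x).source)
    fun p hp ↦ by_contra fun h ↦ hp (hs h), volumeMeasure_restrict, chartVolume_eq, integral_map
    ((aemeasurable_chart_symm _).mono_ac (withDensity_absolutelyContinuous _ _))
    hf.aestronglyMeasurable]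
  change ∫ y, f ((extChartAt I x).symm y) ∂((Module.finBasis ℝ E).addHaar.restrict
    (extChartAt I x).target).withDensity (fun y ↦ ((volumeDensity g x y).toNNReal : ENNReal)) = _
  rw [integral_withDensity_eq_integral_smul₀ hm]
  refine integral_congr_ae (Eventually.of_forall fun y ↦ ?_)
  simp only [NNReal.smul_def, smul_eq_mul, Real.coe_toNNReal _ volumeDensity_nonneg]
  exact mul_comm _ _

/-- Near a point the measure has a continuous density, integrated over part of a compact set of
coordinates. -/
theorem IsPseudoRiemannian.isLocallyFiniteMeasure (hg : IsPseudoRiemannian g) :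
    IsLocallyFiniteMeasure (volumeMeasure g) := ⟨fun p ↦ by
  obtain ⟨K, hK, hKt, hKc⟩ := LocallyCompactSpace.local_compact_nhds (extChartAt I p p)
    (extChartAt I p).target ((isOpen_extChartAt_target p).mem_nhds (mem_extChartAt_target p))
  have hn : (extChartAt I p).source ∩ extChartAt I p ⁻¹' interior K ∈ 𝓝 p := by
    refine ((continuousOn_extChartAt p).isOpen_inter_preimage (isOpen_extChartAt_source p)
      isOpen_interior).mem_nhds ⟨mem_extChartAt_source p, mem_interior_iff_mem_nhds.2 hK⟩
  refine ⟨_, hn, ?_⟩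
  have hm : MeasurableSet ((extChartAt I p).source ∩ extChartAt I p ⁻¹' interior K) :=
    ((continuousOn_extChartAt p).isOpen_inter_preimage (isOpen_extChartAt_source p)
      isOpen_interior).measurableSet
  have : volumeMeasure g ((extChartAt I p).source ∩ extChartAt I p ⁻¹' interior K) =
      chartVolume g p ((extChartAt I p).source ∩ extChartAt I p ⁻¹' interior K) := by
    rw [← volumeMeasure_restrict, Measure.restrict_apply hm, inter_eq_left.2 inter_subset_left]
  rw [this, chartVolume_apply hm]
  have hi : IntegrableOn (volumeDensity g p) K (Module.finBasis ℝ E).addHaar :=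
    ((hg.contDiffOn_volumeDensity (x := p)).continuousOn.mono hKt).integrableOn_compact hKc
  refine lt_of_le_of_lt (lintegral_mono_set ?_) (lt_of_le_of_lt (lintegral_mono fun y ↦ ?_) hi.2)
  · rintro y ⟨h1, h2⟩
    have := h2.2
    rw [mem_preimage, (extChartAt I p).right_inv h1] at this
    exact interior_subset this
  · rw [← ofReal_norm]
    exact ENNReal.ofReal_le_ofReal (le_abs_self _)⟩

end Volume

end

end QuantizedGravity

namespace QuantizedGravity

noncomputable section

set_option linter.unusedSectionVars false
set_option maxSynthPendingDepth 3

/-! ### The Lie algebra of the gauge group -/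

section LieAlgebra

variable {𝔤 : Type*} [NormedAddCommGroup 𝔤] [NormedSpace ℝ 𝔤] [FiniteDimensional ℝ 𝔤]
  [CompleteSpace 𝔤]
  (G : Type*) [TopologicalSpace G] [ChartedSpace 𝔤 G] [Group G] [LieGroup 𝓘(ℝ, 𝔤) ∞ G]

/-- The Lie bracket as a continuous bilinear map. -/
def lieL : 𝔤 →L[ℝ] 𝔤 →L[ℝ] 𝔤 :=
  LinearMap.toContinuousLinearMap
    ((LinearMap.toContinuousLinearMap : (𝔤 →ₗ[ℝ] 𝔤) ≃ₗ[ℝ] _).toLinearMap ∘ₗ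
      LinearMap.mk₂ ℝ (lieBracket G)
        (fun a b c ↦ add_lie (L := GroupLieAlgebra 𝓘(ℝ, 𝔤) G) (M := GroupLieAlgebra 𝓘(ℝ, 𝔤) G) a b c)
        (fun r a b ↦ smul_lie (R := ℝ) (L := GroupLieAlgebra 𝓘(ℝ, 𝔤) G)
          (M := GroupLieAlgebra 𝓘(ℝ, 𝔤) G) r a b)
        (fun a b c ↦ lie_add (L := GroupLieAlgebra 𝓘(ℝ, 𝔤) G) (M := GroupLieAlgebra 𝓘(ℝ, 𝔤) G) a b c)
        (fun r a b ↦ lie_smul (R := ℝ) (L := GroupLieAlgebra 𝓘(ℝ, 𝔤) G)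
          (M := GroupLieAlgebra 𝓘(ℝ, 𝔤) G) r a b))

theorem lieL_apply (a b : 𝔤) : lieL G a b = lieBracket G a b := rfl

/-- The Jacobi identity: `ad` is a representation. -/
theorem lieL_lieL (a b : 𝔤) :
    lieL G (lieL G a b) = (lieL G a).comp (lieL G b) - (lieL G b).comp (lieL G a) := by
  ext c
  exact lie_lie (L := GroupLieAlgebra 𝓘(ℝ, 𝔤) G) (M := GroupLieAlgebra 𝓘(ℝ, 𝔤) G) a b c

theorem cartanKilling_eq (a b : 𝔤) : cartanKilling G a b =
    -LinearMap.trace ℝ 𝔤 ((lieL G a).comp (lieL G b)).toLinearMap :=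
  congrArg Neg.neg (LieModule.traceForm_apply_apply ℝ (GroupLieAlgebra 𝓘(ℝ, 𝔤) G)
    (GroupLieAlgebra 𝓘(ℝ, 𝔤) G) a b)

/-- The Cartan-Killing metric as a continuous bilinear form. -/
def killingL : 𝔤 →L[ℝ] 𝔤 →L[ℝ] ℝ :=
  -((ContinuousLinearMap.compL ℝ (𝔤 →L[ℝ] 𝔤) (𝔤 →L[ℝ] 𝔤) ℝ
      (LinearMap.toContinuousLinearMap
        (LinearMap.trace ℝ 𝔤 ∘ₗ ContinuousLinearMap.coeLM ℝ))).comp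
    (ContinuousLinearMap.compL ℝ 𝔤 𝔤 𝔤)).bilinearComp (lieL G) (lieL G)

theorem killingL_apply (a b : 𝔤) : killingL G a b = cartanKilling G a b := by
  rw [cartanKilling_eq]
  rfl

/-- The Killing form is the trace of `ad a ∘ ad b`, so it only sees the conjugacy classes of such
products. `T` need not respect brackets, which makes the lemma applicable to any transition function
of the bundle. -/
theorem cartanKilling_conj {T : 𝔤 →L[ℝ] 𝔤} (hT : T.IsInvertible) {a b a' b' : 𝔤}
    (ha : T.comp (lieL G a) = (lieL G a').comp T) (hb : T.comp (lieL G b) = (lieL G b').comp T) :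
    cartanKilling G a b = cartanKilling G a' b' := by
  obtain ⟨e, rfl⟩ := hT
  rw [cartanKilling_eq, cartanKilling_eq, neg_inj,
    ← LinearMap.trace_conj' _ e.toLinearEquiv]
  congr 1
  ext v
  have h1 := congrArg (fun L ↦ L (lieL G b (e.symm v))) ha
  have h2 := congrArg (fun L ↦ L (e.symm v)) hb
  simp only [ContinuousLinearMap.comp_apply, ContinuousLinearEquiv.coe_coe,
    ContinuousLinearEquiv.apply_symm_apply] at h1 h2
  rw [h2] at h1
  exact h1

variable {G}

theorem contMDiff_conj (g : G) : ContMDiff 𝓘(ℝ, 𝔤) 𝓘(ℝ, 𝔤) ∞ (fun h : G ↦ g * h * g⁻¹) :=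
  (contMDiff_const.mul contMDiff_id).mul contMDiff_const

/-- The form with `a * b = 1` applies to `(g, g⁻¹)` and to `(g⁻¹, g)` without a double inverse. -/
theorem mfderiv_conj_comp {a b : G} (hab : a * b = 1) {k l : G} (hl : a * k * b = l) :
    ((mfderiv 𝓘(ℝ, 𝔤) 𝓘(ℝ, 𝔤) (fun h : G ↦ b * h * a) l : 𝔤 →L[ℝ] 𝔤)).comp
      (mfderiv 𝓘(ℝ, 𝔤) 𝓘(ℝ, 𝔤) (fun h : G ↦ a * h * b) k : 𝔤 →L[ℝ] 𝔤) =
      ContinuousLinearMap.id ℝ 𝔤 := by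
  obtain rfl : b = a⁻¹ := eq_inv_of_mul_eq_one_right hab
  subst hl
  have h1 := mfderiv_comp k
    (show MDifferentiableAt 𝓘(ℝ, 𝔤) 𝓘(ℝ, 𝔤) (fun h : G ↦ a⁻¹ * h * a) (a * k * a⁻¹) from
      ((contMDiff_conj (𝔤 := 𝔤) a⁻¹).mdifferentiable (by simp) _).congr_of_eventuallyEq
        (Eventually.of_forall fun h ↦ by simp))
    ((contMDiff_conj (𝔤 := 𝔤) a).mdifferentiable (by simp) k)
  have h2 : (fun h : G ↦ a⁻¹ * h * a) ∘ (fun h : G ↦ a * h * a⁻¹) = id := by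
    ext x; simp [mul_assoc]
  rw [h2, mfderiv_id] at h1
  exact h1.symm

theorem isInvertible_mfderiv_conj (g h : G) :
    (mfderiv 𝓘(ℝ, 𝔤) 𝓘(ℝ, 𝔤) (fun h : G ↦ g * h * g⁻¹) h : 𝔤 →L[ℝ] 𝔤).IsInvertible :=
  ContinuousLinearMap.IsInvertible.of_inverse
    (mfderiv_conj_comp (inv_mul_cancel g) (by simp [mul_assoc]))
    (mfderiv_conj_comp (mul_inv_cancel g) rfl)

theorem isInvertible_Ad (g : G) : (Ad g : 𝔤 →L[ℝ] 𝔤).IsInvertible := isInvertible_mfderiv_conj g 1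

/-- Conjugation by `g` intertwines left translation by `h` with left translation by `g * h * g⁻¹`,
up to conjugation at the identity, whose derivative is `Ad g`. -/
theorem mfderiv_conj_mulInvariantVectorField (g h : G) (w : GroupLieAlgebra 𝓘(ℝ, 𝔤) G) :
    mfderiv 𝓘(ℝ, 𝔤) 𝓘(ℝ, 𝔤) (fun h : G ↦ g * h * g⁻¹) h (mulInvariantVectorField w h) =
      mulInvariantVectorField (I := 𝓘(ℝ, 𝔤)) ((Ad g : 𝔤 →L[ℝ] 𝔤) w : 𝔤) (g * h * g⁻¹) := by
  have hl : ∀ a : G, MDifferentiable 𝓘(ℝ, 𝔤) 𝓘(ℝ, 𝔤) (fun b : G ↦ a * b) := fun a ↦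
    (contMDiff_mul_left (n := ∞)).mdifferentiable (by simp)
  have hc := fun a : G ↦ (contMDiff_conj (𝔤 := 𝔤) a).mdifferentiable (by simp)
  have e1 : (fun h : G ↦ g * h * g⁻¹) ∘ (fun b ↦ h * b) =
      (fun b ↦ g * h * g⁻¹ * b) ∘ (fun h : G ↦ g * h * g⁻¹) := by
    ext b; simp [mul_assoc]
  have h1 := mfderiv_comp_apply_of_eq (x := (1 : G)) (y := h) (hc g h) (hl h 1) (mul_one h) w
  have h2 := mfderiv_comp_apply_of_eq (x := (1 : G)) (y := (1 : G)) (hl (g * h * g⁻¹) 1) (hc g 1)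
    (by simp) w
  rw [e1] at h1
  exact h1.symm.trans h2

/-- Conjugation pulls the left invariant field of `Ad g w` back to the one of `w`, and pull back
commutes with the bracket of vector fields. -/
theorem Ad_lieBracket (g : G) (a b : 𝔤) :
    Ad g (lieBracket G a b) = lieBracket G (Ad g a) (Ad g b) := by
  let f : G → G := fun h ↦ g * h * g⁻¹
  have hp : ∀ w : 𝔤, VectorField.mpullback 𝓘(ℝ, 𝔤) 𝓘(ℝ, 𝔤) f
      (mulInvariantVectorField (I := 𝓘(ℝ, 𝔤)) ((Ad g : 𝔤 →L[ℝ] 𝔤) w : 𝔤)) =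
      mulInvariantVectorField (I := 𝓘(ℝ, 𝔤)) (G := G) w := by
    intro w
    ext h
    exact (congrArg (mfderiv 𝓘(ℝ, 𝔤) 𝓘(ℝ, 𝔤) f h).inverse
      (mfderiv_conj_mulInvariantVectorField g h w).symm).trans
      ((isInvertible_mfderiv_conj g h).inverse_apply_self _)
  have hs : minSmoothness ℝ 2 ≤ (∞ : WithTop ℕ∞) := by
    rw [minSmoothness_of_isRCLikeNormedField]; exact ENat.LEInfty.out
  have h := VectorField.mpullback_mlieBracket (f := f) (x₀ := (1 : G))
    (mdifferentiableAt_mulInvariantVectorField (I := 𝓘(ℝ, 𝔤)) ((Ad g : 𝔤 →L[ℝ] 𝔤) a : 𝔤))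
    (mdifferentiableAt_mulInvariantVectorField (I := 𝓘(ℝ, 𝔤)) ((Ad g : 𝔤 →L[ℝ] 𝔤) b : 𝔤))
    (contMDiff_conj g).contMDiffAt hs
  rw [hp, hp] at h
  have h1 : f 1 = 1 := by simp [f]
  have h2 := congrArg (fun v ↦ (Ad g : 𝔤 →L[ℝ] 𝔤) v) h
  simp only [VectorField.mpullback] at h2
  have h3 := (isInvertible_mfderiv_conj (𝔤 := 𝔤) g 1).self_apply_inverse
    (VectorField.mlieBracket 𝓘(ℝ, 𝔤)
      (mulInvariantVectorField (I := 𝓘(ℝ, 𝔤)) ((Ad g : 𝔤 →L[ℝ] 𝔤) a : 𝔤))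
      (mulInvariantVectorField (I := 𝓘(ℝ, 𝔤)) ((Ad g : 𝔤 →L[ℝ] 𝔤) b : 𝔤)) (f 1))
  have h4 := h2.symm.trans h3
  have h5 : ∀ p : G, p = 1 → (VectorField.mlieBracket 𝓘(ℝ, 𝔤)
      (mulInvariantVectorField (I := 𝓘(ℝ, 𝔤)) ((Ad g : 𝔤 →L[ℝ] 𝔤) a : 𝔤))
      (mulInvariantVectorField (I := 𝓘(ℝ, 𝔤)) ((Ad g : 𝔤 →L[ℝ] 𝔤) b : 𝔤)) p : 𝔤) =
      lieBracket G (Ad g a) (Ad g b) := by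
    rintro p rfl
    rfl
  exact h4.trans (h5 _ h1)

theorem cartanKilling_Ad (g : G) (a b : 𝔤) :
    cartanKilling G (Ad g a) (Ad g b) = cartanKilling G a b := by
  have h : ∀ c : 𝔤, (Ad g).comp (lieL G c) = (lieL G (Ad g c)).comp (Ad g) := fun c ↦ by
    ext v
    exact Ad_lieBracket g c v
  exact (cartanKilling_conj G (isInvertible_Ad g) (h a) (h b)).symm

end LieAlgebra

/-! ### Connection forms on open subsets of a vector space -/

section FlatGauge

variable {E : Type*} [NormedAddCommGroup E] [NormedSpace ℝ E]
  {𝔤 : Type*} [NormedAddCommGroup 𝔤] [NormedSpace ℝ 𝔤] [FiniteDimensional ℝ 𝔤]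
  [CompleteSpace 𝔤]
  (G : Type*) [TopologicalSpace G] [ChartedSpace 𝔤 G] [Group G] [LieGroup 𝓘(ℝ, 𝔤) ∞ G]

/-- The curvature of a connection form. -/
def formCurvature (a : E → E →L[ℝ] 𝔤) (y : E) : E →L[ℝ] E →L[ℝ] 𝔤 :=
  fderiv ℝ a y - (fderiv ℝ a y).flip + (lieL G).bilinearComp (a y) (a y)

theorem formCurvature_apply (a : E → E →L[ℝ] 𝔤) (y v w : E) : formCurvature G a y v w =
    fderiv ℝ a y v w - fderiv ℝ a y w v + lieBracket G (a y v) (a y w) := rfl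

theorem contDiffOn_formCurvature {a : E → E →L[ℝ] 𝔤} {V : Set E} (hV : IsOpen V)
    (ha : ContDiffOn ℝ ∞ a V) {v w : E → E} (hv : ContDiffOn ℝ ∞ v V) (hw : ContDiffOn ℝ ∞ w V) :
    ContDiffOn ℝ ∞ (fun y ↦ formCurvature G a y (v y) (w y)) V := by
  have h1 : ContDiffOn ℝ ∞ (fderiv ℝ a) V := ha.fderiv_of_isOpen hV (by simp)
  have h2 : ContDiffOn ℝ ∞ (fun y ↦ lieL G (a y (v y)) (a y (w y))) V :=
    ContDiffOn.clm_apply (f := fun y ↦ lieL G (a y (v y)))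
      ((lieL (𝔤 := 𝔤) G).contDiff.comp_contDiffOn (ha.clm_apply hv)) (ha.clm_apply hw)
  exact (((h1.clm_apply hv).clm_apply hw).sub ((h1.clm_apply hw).clm_apply hv)).add h2

/-- The second derivative of `φ` is symmetric and disappears under antisymmetrization. -/
theorem formCurvature_pullback {a a' : E → E →L[ℝ] 𝔤} {φ : E → E} {y : E}
    (ha : DifferentiableAt ℝ a (φ y)) (hφ : ContDiffAt ℝ ∞ φ y)
    (h : a' =ᶠ[𝓝 y] fun z ↦ (a (φ z)).comp (fderiv ℝ φ z)) (v w : E) :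
    formCurvature G a' y v w = formCurvature G a (φ y) (fderiv ℝ φ y v) (fderiv ℝ φ y w) := by
  have h1 : HasFDerivAt φ (fderiv ℝ φ y) y := (hφ.differentiableAt (by simp)).hasFDerivAt
  have h2 : HasFDerivAt (fderiv ℝ φ) (fderiv ℝ (fderiv ℝ φ) y) y :=
    ((hφ.fderiv_right (m := ∞) (by simp)).differentiableAt (by simp)).hasFDerivAt
  have h3 := ((ha.hasFDerivAt.comp y h1).clm_comp h2).congr_of_eventuallyEq h
  have h4 := hφ.isSymmSndFDerivAt (by simp; exact ENat.LEInfty.out) v w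
  rw [formCurvature_apply, formCurvature_apply, h3.fderiv, h.self_of_nhds]
  simp [h4]

/-- Two connection forms which differ by the gauge transformation `T` have conjugate curvatures. -/
theorem formCurvature_gauge {a a' : E → E →L[ℝ] 𝔤} {T : E → 𝔤 →L[ℝ] 𝔤} {y : E}
    (ha : DifferentiableAt ℝ a y) (ha' : DifferentiableAt ℝ a' y) (hT : ContDiffAt ℝ ∞ T y)
    (h : ∀ᶠ z in 𝓝 y, ∀ v, (T z).comp (lieL G (a z v)) =
      fderiv ℝ T z v + (lieL G (a' z v)).comp (T z)) (u v : E) :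
    (T y).comp (lieL G (formCurvature G a y u v)) =
      (lieL G (formCurvature G a' y u v)).comp (T y) := by
  have hT1 : HasFDerivAt T (fderiv ℝ T y) y := (hT.differentiableAt (by simp)).hasFDerivAt
  have hT2 : HasFDerivAt (fderiv ℝ T) (fderiv ℝ (fderiv ℝ T) y) y :=
    ((hT.fderiv_right (m := ∞) (by simp)).differentiableAt (by simp)).hasFDerivAt
  have hlie : ∀ {c : E → E →L[ℝ] 𝔤}, DifferentiableAt ℝ c y → ∀ v,
      HasFDerivAt (fun z ↦ lieL G (c z v)) ((lieL G).comp ((fderiv ℝ c y).flip v)) y := by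
    intro c hc v
    refine ((lieL G).hasFDerivAt.comp y
      (hc.hasFDerivAt.clm_apply (hasFDerivAt_const v y))).congr_fderiv ?_
    ext; simp
  -- The gauge relation differentiated in direction `u`. Antisymmetrized in `u` and `v` it loses the
  -- second derivative of `T`; the Jacobi identity turns the brackets in the curvature into
  -- commutators, which match the remaining terms.
  have key : ∀ u v ξ, fderiv ℝ T y u (lieL G (a y v) ξ) + T y (lieL G (fderiv ℝ a y u v) ξ) =
      fderiv ℝ (fderiv ℝ T) y u v ξ + lieL G (fderiv ℝ a' y u v) (T y ξ)
        + lieL G (a' y v) (fderiv ℝ T y u ξ) := by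
    intro u v ξ
    have h1 := hT1.clm_comp (hlie ha v)
    have h2 := (hT2.clm_apply (hasFDerivAt_const v y)).add ((hlie ha' v).clm_comp hT1)
    have h3 : (fun z ↦ (T z).comp (lieL G (a z v))) =ᶠ[𝓝 y]
        fun z ↦ fderiv ℝ T z v + (lieL G (a' z v)).comp (T z) := by
      filter_upwards [h] with z hz using hz v
    have h4 := congrArg (fun L ↦ L u ξ) (h1.unique (h2.congr_of_eventuallyEq h3))
    simp at h4
    rw [add_comm, h4]
    abel
  have hy : ∀ v ξ, T y (lieL G (a y v) ξ) = fderiv ℝ T y v ξ + lieL G (a' y v) (T y ξ) :=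
    fun v ξ ↦ congrArg (fun L ↦ L ξ) (h.self_of_nhds v)
  have hs := hT.isSymmSndFDerivAt (by simp; exact ENat.LEInfty.out) u v
  ext ξ
  have e1 := eq_sub_of_add_eq' (key u v ξ)
  have e2 := eq_sub_of_add_eq' (key v u ξ)
  simp only [ContinuousLinearMap.comp_apply, formCurvature_apply, ← lieL_apply, map_add, map_sub,
    add_apply, sub_apply, lieL_lieL, hy, e1, e2, hs]
  abel

end FlatGauge

end

end QuantizedGravity

namespace QuantizedGravity

noncomputable section

set_option linter.unusedSectionVars false
set_option maxSynthPendingDepth 3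

/-! ### The gauge densities in charts -/

section Gauge

variable {E : Type*} [NormedAddCommGroup E] [NormedSpace ℝ E]
  {H : Type*} [TopologicalSpace H] {I : ModelWithCorners ℝ E H} [I.Boundaryless]
  {M : Type*} [TopologicalSpace M] [ChartedSpace H M] [IsManifold I ∞ M]
  {𝔤 : Type*} [NormedAddCommGroup 𝔤] [NormedSpace ℝ 𝔤] [FiniteDimensional ℝ 𝔤]
  [CompleteSpace 𝔤]
  {G : Type*} [TopologicalSpace G] [ChartedSpace 𝔤 G] [Group G] [LieGroup 𝓘(ℝ, 𝔤) ∞ G]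
  {E₀ : M → Type*} [TopologicalSpace (TotalSpace 𝔤 E₀)]
  [∀ x, AddCommGroup (E₀ x)] [∀ x, Module ℝ (E₀ x)] [∀ x, TopologicalSpace (E₀ x)]
  [∀ x, IsTopologicalAddGroup (E₀ x)] [∀ x, ContinuousSMul ℝ (E₀ x)] [FiberBundle 𝔤 E₀]
  [VectorBundle ℝ 𝔤 E₀] [ContMDiffVectorBundle ∞ 𝔤 E₀ I]

variable (𝔤 E₀) in
/-- The transition function from the trivialization at `i` to the one at `j`. -/
def transitionMap (i j p : M) : 𝔤 →L[ℝ] 𝔤 :=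
  ((trivializationAt 𝔤 E₀ i).coordChangeL ℝ (trivializationAt 𝔤 E₀ j) p : 𝔤 ≃L[ℝ] 𝔤)

theorem isInvertible_transitionMap (i j p : M) : (transitionMap 𝔤 E₀ i j p).IsInvertible := ⟨_, rfl⟩

theorem fiberCoord_change {i j p : M} (hi : p ∈ (trivializationAt 𝔤 E₀ i).baseSet)
    (hj : p ∈ (trivializationAt 𝔤 E₀ j).baseSet) (e : E₀ p) :
    fiberCoord 𝔤 j p e = transitionMap 𝔤 E₀ i j p (fiberCoord 𝔤 i p e) := by
  simp only [transitionMap, ContinuousLinearEquiv.coe_coe, fiberCoord]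
  rw [Trivialization.coordChangeL_apply _ _ ⟨hi, hj⟩, Trivialization.symm_apply_apply_mk _ hi]

theorem contMDiffAt_transitionMap {i j p : M} (hi : p ∈ (trivializationAt 𝔤 E₀ i).baseSet)
    (hj : p ∈ (trivializationAt 𝔤 E₀ j).baseSet) :
    ContMDiffAt I 𝓘(ℝ, 𝔤 →L[ℝ] 𝔤) ∞ (transitionMap 𝔤 E₀ i j) p :=
  (contMDiffOn_coordChangeL (IB := I) (n := ∞) (trivializationAt 𝔤 E₀ i)
    (trivializationAt 𝔤 E₀ j)).contMDiffAt (((trivializationAt 𝔤 E₀ i).open_baseSet.inter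
      (trivializationAt 𝔤 E₀ j).open_baseSet).mem_nhds ⟨hi, hj⟩)

theorem contMDiffOn_symm_const (i : M) (ξ : 𝔤) :
    ContMDiffOn I (I.prod 𝓘(ℝ, 𝔤)) ∞
      (fun p ↦ TotalSpace.mk' 𝔤 p ((trivializationAt 𝔤 E₀ i).symm p ξ))
      (trivializationAt 𝔤 E₀ i).baseSet := by
  have h := Bundle.Trivialization.contMDiffOn_symm (IB := I) (n := ∞) (trivializationAt 𝔤 E₀ i)
  have h2 : ContMDiffOn I (I.prod 𝓘(ℝ, 𝔤)) ∞ (fun p : M ↦ (p, ξ))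
      (trivializationAt 𝔤 E₀ i).baseSet := contMDiffOn_id.prodMk contMDiffOn_const
  refine (h.comp h2 fun p hp ↦ ?_).congr fun p hp ↦ ?_
  · rw [mem_preimage, Trivialization.mem_target]
    exact hp
  · simp only [Function.comp_apply]
    rw [← Trivialization.mk_symm _ hp]

variable (A : GaugeConnection I 𝔤 G E₀)

/-- Both formulas for the covariant derivative are applied to the section with constant coordinate
`ξ` at `i`. Its derivative vanishes in that trivialization and is that of the transition function in
the other. -/
theorem form_change {i j p : M} (hi : p ∈ (trivializationAt 𝔤 E₀ i).baseSet)
    (hj : p ∈ (trivializationAt 𝔤 E₀ j).baseSet) (ξ : 𝔤) (v : TangentSpace I p) :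
    let d : TangentSpace I p →L[ℝ] 𝔤 := mfderiv I 𝓘(ℝ, 𝔤) (fun q ↦ transitionMap 𝔤 E₀ i j q ξ) p
    transitionMap 𝔤 E₀ i j p (lieBracket G (A.form i p v) ξ) =
      d v + lieBracket G (A.form j p v) (transitionMap 𝔤 E₀ i j p ξ) := by
  let s : ∀ q : M, E₀ q := fun q ↦ (trivializationAt 𝔤 E₀ i).symm q ξ
  have hs : MDifferentiableAt I (I.prod 𝓘(ℝ, 𝔤)) (fun y ↦ TotalSpace.mk' 𝔤 y (s y)) p :=
    ((contMDiffOn_symm_const i ξ).contMDiffAt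
      ((trivializationAt 𝔤 E₀ i).open_baseSet.mem_nhds hi)).mdifferentiableAt (by simp)
  have h1 := A.cov_eq i p hi s hs v
  have h2 := A.cov_eq j p hj s hs v
  have hsi : ∀ q ∈ (trivializationAt 𝔤 E₀ i).baseSet, fiberCoord 𝔤 i q (s q) = ξ := fun q hq ↦ by
    simp only [fiberCoord, s]
    rw [Trivialization.apply_mk_symm _ hq]
  have hsj : ∀ q ∈ (trivializationAt 𝔤 E₀ i).baseSet, q ∈ (trivializationAt 𝔤 E₀ j).baseSet →
      fiberCoord 𝔤 j q (s q) = transitionMap 𝔤 E₀ i j q ξ := fun q hq hq' ↦ by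
    rw [fiberCoord_change hq hq', hsi q hq]
  have hd1 : mfderiv I 𝓘(ℝ, 𝔤) (fun y ↦ fiberCoord 𝔤 i y (s y)) p = 0 := by
    have : (fun y ↦ fiberCoord 𝔤 i y (s y)) =ᶠ[𝓝 p] fun _ ↦ ξ := by
      filter_upwards [(trivializationAt 𝔤 E₀ i).open_baseSet.mem_nhds hi] with q hq using hsi q hq
    rw [this.mfderiv_eq]
    exact mfderiv_const
  have hd2 : mfderiv I 𝓘(ℝ, 𝔤) (fun y ↦ fiberCoord 𝔤 j y (s y)) p =
      mfderiv I 𝓘(ℝ, 𝔤) (fun q ↦ transitionMap 𝔤 E₀ i j q ξ) p := by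
    refine Filter.EventuallyEq.mfderiv_eq ?_
    filter_upwards [(trivializationAt 𝔤 E₀ i).open_baseSet.mem_nhds hi,
      (trivializationAt 𝔤 E₀ j).open_baseSet.mem_nhds hj] with q hq hq' using hsj q hq hq'
  rw [hd1, hsi p hi] at h1
  rw [hd2, hsj p hi hj, fiberCoord_change hi hj, h1] at h2
  have h0 : (0 : TangentSpace I p →L[ℝ] 𝔤) v + lieBracket G (A.form i p v) ξ =
      lieBracket G (A.form i p v) ξ := by simp
  exact (congrArg _ h0).symm.trans h2

theorem localOneForm_apply (a : ∀ x : M, TangentSpace I x →L[ℝ] 𝔤) (x : M) (y v : E) :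
    localOneForm a x y v = (a ((extChartAt I x).symm y) : E →L[ℝ] 𝔤) (chartDeriv I x y v) := rfl

/-- The part of the chart domain at `x` which lies in the domain of the trivialization at `i`. -/
def gaugeDomain (I : ModelWithCorners ℝ E H) (𝔤 : Type*) [NormedAddCommGroup 𝔤] [NormedSpace ℝ 𝔤]
    (E₀ : M → Type*) [TopologicalSpace (TotalSpace 𝔤 E₀)] [∀ x, TopologicalSpace (E₀ x)]
    [FiberBundle 𝔤 E₀] (i x : M) : Set E :=
  (extChartAt I x).target ∩ (extChartAt I x).symm ⁻¹' (trivializationAt 𝔤 E₀ i).baseSet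

theorem isOpen_gaugeDomain (i x : M) : IsOpen (gaugeDomain I 𝔤 E₀ i x) :=
  (continuousOn_extChartAt_symm x).isOpen_inter_preimage (isOpen_extChartAt_target x)
    (trivializationAt 𝔤 E₀ i).open_baseSet

theorem contDiffAt_transitionMap_chart {i j x : M} {y : E} (hi : y ∈ gaugeDomain I 𝔤 E₀ i x)
    (hj : y ∈ gaugeDomain I 𝔤 E₀ j x) :
    ContDiffAt ℝ ∞ (fun z ↦ transitionMap 𝔤 E₀ i j ((extChartAt I x).symm z)) y := by
  rw [← contMDiffAt_iff_contDiffAt]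
  exact (contMDiffAt_transitionMap hi.2 hj.2).comp y (contMDiffAt_chart_symm hi.1)

theorem mfderiv_apply_chartDeriv {F : Type*} [NormedAddCommGroup F] [NormedSpace ℝ F]
    {f : M → F} {x : M} {y : E} (hy : y ∈ (extChartAt I x).target)
    (hf : MDifferentiableAt I 𝓘(ℝ, F) f ((extChartAt I x).symm y)) (v : E) :
    (mfderiv I 𝓘(ℝ, F) f ((extChartAt I x).symm y) : E →L[ℝ] F) (chartDeriv I x y v) =
      fderiv ℝ (fun z ↦ f ((extChartAt I x).symm z)) y v := by
  have h := mfderiv_comp_apply y hf ((contMDiffAt_chart_symm hy).mdifferentiableAt (by simp)) v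
  rw [mfderiv_eq_fderiv] at h
  exact h.symm

theorem localOneForm_change {i j x : M} {y : E} (hi : y ∈ gaugeDomain I 𝔤 E₀ i x)
    (hj : y ∈ gaugeDomain I 𝔤 E₀ j x) (v : E) :
    (transitionMap 𝔤 E₀ i j ((extChartAt I x).symm y)).comp
        (lieL G (localOneForm (A.form i) x y v)) =
      fderiv ℝ (fun z ↦ transitionMap 𝔤 E₀ i j ((extChartAt I x).symm z)) y v +
        (lieL G (localOneForm (A.form j) x y v)).comp
          (transitionMap 𝔤 E₀ i j ((extChartAt I x).symm y)) := by
  ext ξ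
  have h := form_change A hi.2 hj.2 ξ (chartDeriv I x y v)
  have hm : MDifferentiableAt I 𝓘(ℝ, 𝔤) (fun q ↦ transitionMap 𝔤 E₀ i j q ξ)
      ((extChartAt I x).symm y) :=
    ((contMDiffAt_transitionMap (I := I) hi.2 hj.2).clm_apply contMDiffAt_const).mdifferentiableAt
      (n := ∞) (by simp)
  have h2 := mfderiv_apply_chartDeriv hi.1 hm v
  have h3 := (((contDiffAt_transitionMap_chart hi hj).differentiableAt (by simp)).hasFDerivAt.clm_apply
    (hasFDerivAt_const ξ y)).fderiv
  rw [h3] at h2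
  have h4 : (mfderiv I 𝓘(ℝ, 𝔤) (fun q ↦ transitionMap 𝔤 E₀ i j q ξ) ((extChartAt I x).symm y) :
      E →L[ℝ] 𝔤) (chartDeriv I x y v) =
      fderiv ℝ (fun z ↦ transitionMap 𝔤 E₀ i j ((extChartAt I x).symm z)) y v ξ := by
    rw [h2, ContinuousLinearMap.comp_zero, zero_add, ContinuousLinearMap.flip_apply]
  exact h.trans (congrArg (· + _) h4)

/-- After applying `ad` the two curvatures are conjugate, and the Killing form sees no more than
that. -/
theorem cartanKilling_formCurvature_change {i j x : M} {y : E} (hi : y ∈ gaugeDomain I 𝔤 E₀ i x)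
    (hj : y ∈ gaugeDomain I 𝔤 E₀ j x) (u v u' v' : E) :
    cartanKilling G (formCurvature G (localOneForm (A.form i) x) y u v)
      (formCurvature G (localOneForm (A.form i) x) y u' v') =
    cartanKilling G (formCurvature G (localOneForm (A.form j) x) y u v)
      (formCurvature G (localOneForm (A.form j) x) y u' v') := by
  have hd : ∀ k, y ∈ gaugeDomain I 𝔤 E₀ k x → DifferentiableAt ℝ (localOneForm (A.form k) x) y :=
    fun k hk ↦ ((A.smooth_form k x).contDiffAt ((isOpen_gaugeDomain k x).mem_nhds hk)).differentiableAt
      (by simp)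
  have h := formCurvature_gauge G (T := fun z ↦ transitionMap 𝔤 E₀ i j ((extChartAt I x).symm z))
    (hd i hi) (hd j hj) (contDiffAt_transitionMap_chart hi hj) (by
      filter_upwards [(isOpen_gaugeDomain i x).mem_nhds hi, (isOpen_gaugeDomain j x).mem_nhds hj]
        with z hzi hzj v using localOneForm_change A hzi hzj v)
  exact cartanKilling_conj G (isInvertible_transitionMap i j _) (h u v) (h u' v')

theorem localOneForm_transition (a : ∀ x : M, TangentSpace I x →L[ℝ] 𝔤) {x x' : M} {y : E}
    (hy : y ∈ overlap I x' x) : localOneForm a x' y =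
      (localOneForm a x (transition I x' x y)).comp (fderiv ℝ (transition I x' x) y) := by
  ext v
  rw [ContinuousLinearMap.comp_apply, localOneForm_apply, localOneForm_apply, symm_transition hy,
    ← chartDeriv_comp_transition hy]
  rfl

variable [FiniteDimensional ℝ E]

/-- The contraction `γ_{ab} B^{ik} B^{jl} F^a_{ij} F^b_{kl}`. -/
def curvatureNormSq (G : Type*) [TopologicalSpace G] [ChartedSpace 𝔤 G] [Group G]
    [LieGroup 𝓘(ℝ, 𝔤) ∞ G] (B : E →L[ℝ] E →L[ℝ] ℝ) (F : E →L[ℝ] E →L[ℝ] 𝔤) : ℝ :=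
  ∑ i, ∑ j, cartanKilling G (F (Module.finBasis ℝ E i) (Module.finBasis ℝ E j))
    (F (reciprocal B i) (reciprocal B j))

/-- The double contraction is a metric trace of metric traces, each of them invariant. -/
theorem curvatureNormSq_pullback {B : E →L[ℝ] E →L[ℝ] ℝ} (hB : IsNondegForm B)
    {L : E →L[ℝ] E} (hL : L.IsInvertible) (F : E →L[ℝ] E →L[ℝ] 𝔤) :
    curvatureNormSq G (B.bilinearComp L L) (F.bilinearComp L L) = curvatureNormSq G B F := by
  have h : ∀ (B : E →L[ℝ] E →L[ℝ] ℝ) (F : E →L[ℝ] E →L[ℝ] 𝔤), curvatureNormSq G B F =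
      metricTrace B fun v v' ↦ metricTrace B fun w w' ↦ toBilin
        ((killingL G).bilinearComp (F v) (F v')) w w' := fun B F ↦ by
    simp only [curvatureNormSq, metricTrace, toBilin_apply, ContinuousLinearMap.bilinearComp_apply,
      killingL_apply]
  rw [h, h]
  have h1 : ∀ v v', (metricTrace (B.bilinearComp L L) fun w w' ↦ toBilin
      ((killingL G).bilinearComp (F.bilinearComp L L v) (F.bilinearComp L L v')) w w') =
      metricTrace B fun w w' ↦ toBilin ((killingL G).bilinearComp (F (L v)) (F (L v'))) w w' :=
    fun v v' ↦ metricTrace_pullback hB hL (toBilin ((killingL G).bilinearComp (F (L v)) (F (L v'))))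
  simp only [h1]
  exact metricTrace_pullback hB hL (LinearMap.mk₂ ℝ (fun v v' ↦ metricTrace B fun w w' ↦ toBilin
      ((killingL G).bilinearComp (F v) (F v')) w w')
    (fun a b c ↦ by simp [metricTrace, Finset.sum_add_distrib])
    (fun r a b ↦ by simp [metricTrace, Finset.mul_sum])
    (fun a b c ↦ by simp [metricTrace, Finset.sum_add_distrib])
    (fun r a b ↦ by simp [metricTrace, Finset.mul_sum]))

/-- Two changes: gauge invariance replaces the trivialization at the point `p` by the one at `i`,
and then the transition map replaces the chart at `p` by the one at `x`. -/
theorem yangMillsDensity_chart {σ : TwoTensor I M} (hσ : IsPseudoRiemannian σ) {i x : M} {y : E}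
    (hy : y ∈ gaugeDomain I 𝔤 E₀ i x) : yangMillsDensity σ A ((extChartAt I x).symm y) =
      curvatureNormSq G (localMetric σ x y) (formCurvature G (localOneForm (A.form i) x) y) := by
  set p := (extChartAt I x).symm y with hp
  have ho := mem_overlap_self hy.1
  have ht := transition_self hy.1
  rw [← hp] at ho ht
  have hpi : extChartAt I p p ∈ gaugeDomain I 𝔤 E₀ i p := ⟨mem_extChartAt_target p, by
    rw [mem_preimage, extChartAt_to_inv]; exact hy.2⟩
  have hpp : extChartAt I p p ∈ gaugeDomain I 𝔤 E₀ p p := ⟨mem_extChartAt_target p, by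
    rw [mem_preimage, extChartAt_to_inv]; exact FiberBundle.mem_baseSet_trivializationAt' p⟩
  have h1 : yangMillsDensity σ A p = curvatureNormSq G (localMetric σ p (extChartAt I p p))
      (formCurvature G (localOneForm (A.form i) p) (extChartAt I p p)) := by
    rw [localMetric_self]
    refine Finset.sum_congr rfl fun k _ ↦ Finset.sum_congr rfl fun l _ ↦ ?_
    exact cartanKilling_formCurvature_change A hpp hpi _ _ _ _
  have h2 : formCurvature G (localOneForm (A.form i) p) (extChartAt I p p) =
      (formCurvature G (localOneForm (A.form i) x) y).bilinearComp
        (fderiv ℝ (transition I p x) (extChartAt I p p))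
        (fderiv ℝ (transition I p x) (extChartAt I p p)) := by
    ext v w
    rw [formCurvature_pullback G (a := localOneForm (A.form i) x) (φ := transition I p x), ht]
    · rfl
    · rw [ht]
      exact ((A.smooth_form i x).contDiffAt ((isOpen_gaugeDomain i x).mem_nhds hy)).differentiableAt
        (by simp)
    · exact contDiffOn_transition.contDiffAt (isOpen_overlap.mem_nhds ho)
    · filter_upwards [isOpen_overlap.mem_nhds ho] with z hz using localOneForm_transition _ hz
  rw [h1, h2, localMetric_eq_pullback σ ho, ht]
  exact curvatureNormSq_pullback ((hσ x).nondeg y hy.1) (isInvertible_fderiv_transition ho) _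

theorem contDiffOn_yangMillsDensity {σ : TwoTensor I M} (hσ : IsPseudoRiemannian σ) (x : M) :
    ContDiffOn ℝ ∞ (fun y ↦ yangMillsDensity σ A ((extChartAt I x).symm y))
      (extChartAt I x).target := fun y hy ↦ by
  refine ContDiffAt.contDiffWithinAt ?_
  -- Smoothness is local, and the trivialization at the point itself covers a neighbourhood of it.
  set i := (extChartAt I x).symm y with hi
  have hyi : y ∈ gaugeDomain I 𝔤 E₀ i x := ⟨hy, FiberBundle.mem_baseSet_trivializationAt' i⟩
  have hW := isOpen_gaugeDomain (I := I) (𝔤 := 𝔤) (E₀ := E₀) i x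
  have h : ContDiffOn ℝ ∞ (fun y ↦ curvatureNormSq G (localMetric σ x y)
      (formCurvature G (localOneForm (A.form i) x) y)) (gaugeDomain I 𝔤 E₀ i x) := by
    have hr := fun k ↦ ((hσ x).contDiffOn_reciprocal k).mono
      (inter_subset_left : gaugeDomain I 𝔤 E₀ i x ⊆ _)
    simp only [curvatureNormSq, ← killingL_apply]
    refine ContDiffOn.sum fun k _ ↦ ContDiffOn.sum fun l _ ↦ ?_
    exact ContDiffOn.clm_apply (f := fun y ↦ killingL G (formCurvature G
        (localOneForm (A.form i) x) y (Module.finBasis ℝ E k) (Module.finBasis ℝ E l)))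
      ((killingL (𝔤 := 𝔤) G).contDiff.comp_contDiffOn (contDiffOn_formCurvature G hW
        (A.smooth_form i x) contDiffOn_const contDiffOn_const))
      (contDiffOn_formCurvature G hW (A.smooth_form i x) (hr k) (hr l))
  refine (h.contDiffAt (hW.mem_nhds hyi)).congr_of_eventuallyEq ?_
  filter_upwards [hW.mem_nhds hyi] with z hz using yangMillsDensity_chart A hσ hz

/-- The covariant derivative of a section in the chart at `x` and the trivialization at `i`. -/
def covariantForm (Φ : ∀ x : M, E₀ x) (i x : M) (y : E) : E →L[ℝ] 𝔤 :=
  fderiv ℝ (fun z ↦ fiberCoord 𝔤 i ((extChartAt I x).symm z) (Φ ((extChartAt I x).symm z))) y +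
    ((lieL G).flip (fiberCoord 𝔤 i ((extChartAt I x).symm y) (Φ ((extChartAt I x).symm y)))).comp
      (localOneForm (A.form i) x y)

variable (Φ : ContMDiffSection I 𝔤 ∞ E₀)

theorem contMDiffOn_fiberCoord (i : M) : ContMDiffOn I 𝓘(ℝ, 𝔤) ∞
    (fun q ↦ fiberCoord 𝔤 i q (Φ q)) (trivializationAt 𝔤 E₀ i).baseSet := by
  have h := Φ.contMDiff
  intro p hp
  have := (Trivialization.contMDiffAt_iff (e := trivializationAt 𝔤 E₀ i) (n := ∞) (IB := I)
    (f := fun q ↦ TotalSpace.mk' 𝔤 q (Φ q)) (x₀ := p) (IM := I)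
    (by rw [Trivialization.mem_source]; exact hp)).1 (h p)
  exact this.2.contMDiffWithinAt

theorem contDiffOn_fiberCoord_chart (i x : M) : ContDiffOn ℝ ∞
    (fun z ↦ fiberCoord 𝔤 i ((extChartAt I x).symm z) (Φ ((extChartAt I x).symm z)))
      (gaugeDomain I 𝔤 E₀ i x) := fun y hy ↦ by
  refine ContDiffAt.contDiffWithinAt ?_
  rw [← contMDiffAt_iff_contDiffAt]
  exact ContMDiffAt.comp y (g := fun q ↦ fiberCoord 𝔤 i q (Φ q)) (f := (extChartAt I x).symm)
    ((contMDiffOn_fiberCoord Φ i).contMDiffAt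
    ((trivializationAt 𝔤 E₀ i).open_baseSet.mem_nhds hy.2)) (contMDiffAt_chart_symm hy.1)

theorem covariantForm_apply {i x : M} {y : E} (hy : y ∈ gaugeDomain I 𝔤 E₀ i x) (v : E) :
    fiberCoord 𝔤 i ((extChartAt I x).symm y)
      (A.cov Φ ((extChartAt I x).symm y) (chartDeriv I x y v)) =
      covariantForm A (fun q ↦ Φ q) i x y v := by
  have h := A.cov_eq i _ hy.2 (fun q ↦ Φ q) ((Φ.contMDiff _).mdifferentiableAt (by simp))
    (chartDeriv I x y v)
  refine h.trans (congrArg (· + _) ?_)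
  exact mfderiv_apply_chartDeriv hy.1 (((contMDiffOn_fiberCoord Φ i).contMDiffAt
    ((trivializationAt 𝔤 E₀ i).open_baseSet.mem_nhds hy.2)).mdifferentiableAt (by simp)) v

/-- Here the structure group enters: from one trivialization to another the covariant derivative of
`Φ` changes by some `Ad g`, under which the Cartan-Killing metric is invariant. No regularity of `g`
in the point is needed. -/
theorem higgsDensity_chart (hE₀ : IsAdjointBundle 𝔤 G E₀) {σ : TwoTensor I M}
    (hσ : IsPseudoRiemannian σ) {i x : M} {y : E} (hy : y ∈ gaugeDomain I 𝔤 E₀ i x) :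
    higgsDensity σ A Φ ((extChartAt I x).symm y) = metricTrace (localMetric σ x y) fun v w ↦
      (killingL G).bilinearComp (covariantForm A (fun q ↦ Φ q) i x y)
        (covariantForm A (fun q ↦ Φ q) i x y) v w := by
  set p := (extChartAt I x).symm y with hp
  have hL := isInvertible_chartDeriv (I := I) hy.1
  have hB : IsNondegForm (formAt σ p) := by
    have := (hσ p).nondeg _ (mem_extChartAt_target p)
    rwa [localMetric_self] at this
  let f : E →L[ℝ] 𝔤 := (covariantForm A (fun q ↦ Φ q) i x y).comp (chartDeriv I x y).inverse
  have hf : ∀ v : E, fiberCoord 𝔤 i p (A.cov Φ p v) = f v := fun v ↦ by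
    have := covariantForm_apply A Φ hy ((chartDeriv I x y).inverse v)
    rw [hL.self_apply_inverse] at this
    exact this
  obtain ⟨g, hg⟩ := hE₀ i p p hy.2 (FiberBundle.mem_baseSet_trivializationAt' p)
  have h1 : higgsDensity σ A Φ p = metricTrace (formAt σ p) fun v w ↦
      toBilin ((killingL G).bilinearComp f f) v w := by
    simp only [higgsDensity, hg, cartanKilling_Ad, toBilin_apply,
      ContinuousLinearMap.bilinearComp_apply, killingL_apply]
    simp only [metricTrace]
    exact Finset.sum_congr rfl fun k _ ↦ congrArg₂ _ (hf _) (hf _)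
  rw [h1, ← metricTrace_pullback hB hL, localMetric_eq]
  simp only [toBilin_apply, ContinuousLinearMap.bilinearComp_apply, f,
    ContinuousLinearMap.comp_apply, hL.inverse_apply_self]
  rfl

theorem contDiffOn_higgsDensity (hE₀ : IsAdjointBundle 𝔤 G E₀) {σ : TwoTensor I M}
    (hσ : IsPseudoRiemannian σ) (x : M) :
    ContDiffOn ℝ ∞ (fun y ↦ higgsDensity σ A Φ ((extChartAt I x).symm y))
      (extChartAt I x).target := fun y hy ↦ by
  refine ContDiffAt.contDiffWithinAt ?_
  set i := (extChartAt I x).symm y with hi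
  have hyi : y ∈ gaugeDomain I 𝔤 E₀ i x := ⟨hy, FiberBundle.mem_baseSet_trivializationAt' i⟩
  have hW := isOpen_gaugeDomain (I := I) (𝔤 := 𝔤) (E₀ := E₀) i x
  have hc : ContDiffOn ℝ ∞ (covariantForm A (fun q ↦ Φ q) i x) (gaugeDomain I 𝔤 E₀ i x) := by
    have h1 := contDiffOn_fiberCoord_chart Φ i x
    exact (h1.fderiv_of_isOpen hW (m := ∞) (by simp)).add
      (((lieL (𝔤 := 𝔤) G).flip.contDiff.comp_contDiffOn h1).clm_comp (A.smooth_form i x))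
  have h : ContDiffOn ℝ ∞ (fun y ↦ metricTrace (localMetric σ x y) fun v w ↦
      (killingL G).bilinearComp (covariantForm A (fun q ↦ Φ q) i x y)
        (covariantForm A (fun q ↦ Φ q) i x y) v w) (gaugeDomain I 𝔤 E₀ i x) := by
    have hr := fun k ↦ ((hσ x).contDiffOn_reciprocal k).mono
      (inter_subset_left : gaugeDomain I 𝔤 E₀ i x ⊆ _)
    unfold metricTrace
    refine ContDiffOn.sum fun k _ ↦ ?_
    exact ContDiffOn.clm_apply (f := fun y ↦ killingL G
        (covariantForm A (fun q ↦ Φ q) i x y (Module.finBasis ℝ E k)))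
      ((killingL (𝔤 := 𝔤) G).contDiff.comp_contDiffOn (hc.clm_apply contDiffOn_const))
      (hc.clm_apply (hr k))
  refine (h.contDiffAt (hW.mem_nhds hyi)).congr_of_eventuallyEq ?_
  filter_upwards [hW.mem_nhds hyi] with z hz using higgsDensity_chart A Φ hE₀ hσ hz

theorem contDiffOn_potential {V : TotalSpace 𝔤 E₀ → ℝ}
    (hV : ContMDiff (I.prod 𝓘(ℝ, 𝔤)) 𝓘(ℝ, ℝ) ∞ V) (x : M) :
    ContDiffOn ℝ ∞ (fun y ↦ V ⟨(extChartAt I x).symm y, Φ ((extChartAt I x).symm y)⟩)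
      (extChartAt I x).target :=
  contDiffOn_comp_chart_symm (u := fun p ↦ V ⟨p, Φ p⟩) (hV.comp Φ.contMDiff)

end Gauge

end

end QuantizedGravity

namespace QuantizedGravity

noncomputable section

set_option linter.unusedSectionVars false
set_option maxSynthPendingDepth 3

/-! ### Warped products in coordinates -/

section WarpedForm

variable {E : Type*} [NormedAddCommGroup E] [NormedSpace ℝ E]

/-- The bilinear form `-c dt² + h B` on `ℝ × E`. -/
def warpedForm (c h : ℝ) (B : E →L[ℝ] E →L[ℝ] ℝ) : (ℝ × E) →L[ℝ] (ℝ × E) →L[ℝ] ℝ :=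
  (-c) • (ContinuousLinearMap.mul ℝ ℝ).bilinearComp (ContinuousLinearMap.fst ℝ ℝ E)
      (ContinuousLinearMap.fst ℝ ℝ E)
    + h • B.bilinearComp (ContinuousLinearMap.snd ℝ ℝ E) (ContinuousLinearMap.snd ℝ ℝ E)

theorem warpedForm_apply (c h : ℝ) (B : E →L[ℝ] E →L[ℝ] ℝ) (v w : ℝ × E) :
    warpedForm c h B v w = -c * (v.1 * w.1) + h * B v.2 w.2 := by
  simp [warpedForm]

variable [FiniteDimensional ℝ E] {c h : ℝ} {B : E →L[ℝ] E →L[ℝ] ℝ}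

theorem IsNondegForm.warpedForm (hB : IsNondegForm B) (hc : c ≠ 0) (hh : h ≠ 0) :
    IsNondegForm (warpedForm c h B) := by
  refine isNondegForm_of_injective (fun v w ↦ ?_) fun v hv ↦ ?_
  · rw [warpedForm_apply, warpedForm_apply, hB.symm, mul_comm v.1]
  · have h1 := hv (1, 0)
    rw [warpedForm_apply] at h1
    simp [hc] at h1
    have h2 : v.2 = 0 := hB.ext fun z ↦ by
      have := hv (0, z)
      rw [warpedForm_apply] at this
      simpa [hh] using this
    exact Prod.ext h1 h2

theorem warpedForm_inverse (hB : IsNondegForm B) (hc : c ≠ 0) (hh : h ≠ 0)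
    (ξ : (ℝ × E) →L[ℝ] ℝ) : (warpedForm c h B).inverse ξ =
      (-c⁻¹ * ξ (1, 0), h⁻¹ • B.inverse (ξ.comp (ContinuousLinearMap.inr ℝ ℝ E))) := by
  refine (hB.warpedForm hc hh).ext fun z ↦ ?_
  rw [(hB.warpedForm hc hh).apply_inverse, warpedForm_apply, map_smul, smul_apply,
    hB.apply_inverse]
  have : z = z.1 • ((1 : ℝ), (0 : E)) + (0, z.2) := by ext <;> simp
  conv_lhs => rw [this, map_add, map_smul]
  simp only [smul_eq_mul, ContinuousLinearMap.comp_apply, ContinuousLinearMap.inr_apply]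
  field_simp

/-- Computed in the product basis, whose reciprocal basis is explicit because the form is block
diagonal. -/
theorem metricTrace_warpedForm (hB : IsNondegForm B) (hc : c ≠ 0) (hh : h ≠ 0)
    (T : (ℝ × E) →L[ℝ] (ℝ × E) →L[ℝ] ℝ) :
    metricTrace (warpedForm c h B) (fun v w ↦ T v w) = -c⁻¹ * T (1, 0) (1, 0)
      + h⁻¹ * metricTrace B (fun v w ↦ T (0, v) (0, w)) := by
  have h1 := metricTrace_eq_sum (hB.warpedForm hc hh)
    ((Module.Basis.singleton Unit ℝ).prod (Module.finBasis ℝ E)) (toBilin T)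
  simp only [toBilin_apply] at h1
  rw [h1, Fintype.sum_sum_type]
  simp only [warpedForm_inverse hB hc hh, metricTrace, Finset.mul_sum]
  congr 1
  · simp only [Finset.univ_unique, PUnit.default_eq_unit, Finset.sum_singleton]
    have e1 : (coordL ((Module.Basis.singleton Unit ℝ).prod (Module.finBasis ℝ E))
        (Sum.inl PUnit.unit)).comp (ContinuousLinearMap.inr ℝ ℝ E) = 0 := by
      ext v; simp
    rw [e1]
    have e2 : ((-c⁻¹ * (coordL ((Module.Basis.singleton Unit ℝ).prod (Module.finBasis ℝ E))
        (Sum.inl PUnit.unit)) (1, 0), h⁻¹ • B.inverse 0) : ℝ × E) = (-c⁻¹) • ((1 : ℝ), (0 : E)) := by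
      simp
    rw [e2, map_smul]
    simp
  · refine Finset.sum_congr rfl fun i _ ↦ ?_
    have e1 : (coordL ((Module.Basis.singleton Unit ℝ).prod (Module.finBasis ℝ E))
        (Sum.inr i)).comp (ContinuousLinearMap.inr ℝ ℝ E) = coordL (Module.finBasis ℝ E) i := by
      ext v; simp
    rw [e1]
    have e2 : ((-c⁻¹ * (coordL ((Module.Basis.singleton Unit ℝ).prod (Module.finBasis ℝ E))
        (Sum.inr i)) (1, 0), h⁻¹ • B.inverse (coordL (Module.finBasis ℝ E) i)) : ℝ × E) =
        h⁻¹ • ((0 : ℝ), reciprocal B i) := by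
      simp; rfl
    rw [e2, map_smul]
    simp

/-- A block determinant in the product basis; `C` accounts for the passage from the standard basis
of `ℝ × E`. -/
theorem exists_det_gram_warpedForm (E : Type*) [NormedAddCommGroup E] [NormedSpace ℝ E]
    [FiniteDimensional ℝ E] : ∃ C : ℝ, 0 < C ∧ ∀ (c h : ℝ) (B : E →L[ℝ] E →L[ℝ] ℝ),
      (gram (Module.finBasis ℝ (ℝ × E)) (warpedForm c h B)).det =
        C * (-c * (h ^ Module.finrank ℝ E * (gram (Module.finBasis ℝ E) B).det)) := by
  obtain ⟨C, hC, hdet⟩ := exists_det_gram_eq (Module.finBasis ℝ (ℝ × E))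
    ((Module.Basis.singleton Unit ℝ).prod (Module.finBasis ℝ E))
  refine ⟨C, hC, fun c h B ↦ ?_⟩
  rw [hdet]
  congr 1
  have : gram ((Module.Basis.singleton Unit ℝ).prod (Module.finBasis ℝ E)) (warpedForm c h B) =
      Matrix.fromBlocks (Matrix.of fun _ _ ↦ -c) 0 0 (h • gram (Module.finBasis ℝ E) B) := by
    ext i j
    rcases i with i | i <;> rcases j with j | j <;> simp [gram, warpedForm_apply]
  rw [this, Matrix.det_fromBlocks_zero₂₁, Matrix.det_smul]
  simp

theorem contDiffOn_warpedForm {f : ℝ → ℝ} {G : E → E →L[ℝ] E →L[ℝ] ℝ} {V : Set E} {c : ℝ}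
    (hf : ContDiffOn ℝ ∞ f (Ioi 0)) (hG : ContDiffOn ℝ ∞ G V) :
    ContDiffOn ℝ ∞ (fun z : ℝ × E ↦ warpedForm c (f z.1) (G z.2)) (Ioi 0 ×ˢ V) := by
  have h1 : ContDiffOn ℝ ∞ (fun z : ℝ × E ↦ f z.1) (Ioi 0 ×ˢ V) :=
    hf.comp contDiff_fst.contDiffOn fun z hz ↦ hz.1
  have h2 : ContDiffOn ℝ ∞ (fun z : ℝ × E ↦ G z.2) (Ioi 0 ×ˢ V) :=
    hG.comp contDiff_snd.contDiffOn fun z hz ↦ hz.2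
  have h3 : ContDiffOn ℝ ∞ (fun z : ℝ × E ↦ (G z.2).bilinearComp (ContinuousLinearMap.snd ℝ ℝ E)
      (ContinuousLinearMap.snd ℝ ℝ E)) (Ioi 0 ×ˢ V) := by
    have e1 := h2.clm_comp (contDiffOn_const (c := ContinuousLinearMap.snd ℝ ℝ E))
    have e2 := (ContinuousLinearMap.flipₗᵢ ℝ (ℝ × E) E ℝ).contDiff.comp_contDiffOn e1
    exact (ContinuousLinearMap.flipₗᵢ ℝ (ℝ × E) (ℝ × E) ℝ).contDiff.comp_contDiffOn
      (e2.clm_comp (contDiffOn_const (c := ContinuousLinearMap.snd ℝ ℝ E)))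
  exact contDiffOn_const.add (h1.smul h3)

end WarpedForm

/-! ### Derivatives along affine subspaces -/

section Affine

variable {E F : Type*} [NormedAddCommGroup E] [NormedSpace ℝ E] [NormedAddCommGroup F]
  [NormedSpace ℝ F]

/-- Serves to restrict functions on coordinate domains of `Q` to slices `t = const`; its second
order version also to lines `x = const`. -/
theorem fderiv_comp_affine {f : F → ℝ} {q : F} {L : E →L[ℝ] F} {A : E → F}
    (hA : ∀ y, A y = q + L y) {U : Set F} (hU : IsOpen U) (hf : ContDiffOn ℝ ∞ f U) {y : E}
    (hy : A y ∈ U) : fderiv ℝ (fun z ↦ f (A z)) y = (fderiv ℝ f (A y)).comp L := by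
  have hAd : HasFDerivAt A L y := by
    have : A = fun y ↦ q + L y := funext hA
    rw [this]; exact L.hasFDerivAt.const_add q
  exact (((hf.contDiffAt (hU.mem_nhds hy)).differentiableAt (by simp)).hasFDerivAt.comp y hAd).fderiv

theorem fderiv_fderiv_comp_affine {f : F → ℝ} {q : F} {L : E →L[ℝ] F} {A : E → F}
    (hA : ∀ y, A y = q + L y) {U : Set F} (hU : IsOpen U) (hf : ContDiffOn ℝ ∞ f U) {y : E}
    (hy : A y ∈ U) (v w : E) : fderiv ℝ (fderiv ℝ (fun z ↦ f (A z))) y v w =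
      fderiv ℝ (fderiv ℝ f) (A y) (L v) (L w) := by
  have hA' : A = fun y ↦ q + L y := funext hA
  have hAd : HasFDerivAt A L y := by rw [hA']; exact L.hasFDerivAt.const_add q
  have hc : Continuous A := by rw [hA']; fun_prop
  have h1 : fderiv ℝ (fun z ↦ f (A z)) =ᶠ[𝓝 y] fun z ↦ (fderiv ℝ f (A z)).comp L := by
    filter_upwards [hc.continuousAt.preimage_mem_nhds (hU.mem_nhds hy)] with z hz
      using fderiv_comp_affine hA hU hf hz
  have h2 : HasFDerivAt (fderiv ℝ f) (fderiv ℝ (fderiv ℝ f) (A y)) (A y) :=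
    (((hf.fderiv_of_isOpen hU (m := ∞) (by simp)).contDiffAt (hU.mem_nhds hy)).differentiableAt
      (by simp)).hasFDerivAt
  have h3 := ((h2.comp y hAd).clm_comp (hasFDerivAt_const L y)).congr_of_eventuallyEq h1
  rw [h3.fderiv]
  simp

end Affine

/-! ### The spacetime in charts -/

section Spacetime

theorem extChartAt_posReal_apply (t t' : PosReal) : extChartAt 𝓘(ℝ, ℝ) t t' = (t' : ℝ) := rfl

theorem extChartAt_posReal_target (t : PosReal) : (extChartAt 𝓘(ℝ, ℝ) t).target = Ioi 0 := by
  ext y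
  constructor
  · intro hy
    rw [← (extChartAt 𝓘(ℝ, ℝ) t).right_inv hy, extChartAt_posReal_apply]
    exact ((extChartAt 𝓘(ℝ, ℝ) t).symm y).2
  · intro hy
    exact mem_extChartAt_target (I := 𝓘(ℝ, ℝ)) (⟨y, hy⟩ : PosReal)

theorem extChartAt_posReal_symm (t : PosReal) {s : ℝ} (hs : 0 < s) :
    (extChartAt 𝓘(ℝ, ℝ) t).symm s = ⟨s, hs⟩ := by
  have h : s ∈ (extChartAt 𝓘(ℝ, ℝ) t).target := by rw [extChartAt_posReal_target]; exact hs
  apply Subtype.ext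
  rw [← extChartAt_posReal_apply t, (extChartAt 𝓘(ℝ, ℝ) t).right_inv h]

/-- All preferred charts of the half line coincide, so the chart at `t` can be taken for the one at
`s`. -/
theorem chartDeriv_posReal (t : PosReal) {s : ℝ} (hs : 0 < s) :
    chartDeriv 𝓘(ℝ, ℝ) t s = ContinuousLinearMap.id ℝ ℝ :=
  chartDeriv_self (I := 𝓘(ℝ, ℝ)) (x := (⟨s, hs⟩ : PosReal))

variable {n : ℕ} {S₀ : Type*} [TopologicalSpace S₀]
  [ChartedSpace (EuclideanSpace ℝ (Fin n)) S₀]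

theorem extChartAt_spacetime (p : PosReal × S₀) : extChartAt (IQ n) p =
    (extChartAt 𝓘(ℝ, ℝ) p.1).prod (extChartAt (IS n) p.2) := extChartAt_prod p

theorem extChartAt_spacetime_target (p : PosReal × S₀) : (extChartAt (IQ n) p).target =
    Ioi 0 ×ˢ (extChartAt (IS n) p.2).target := by
  rw [extChartAt_spacetime, PartialEquiv.prod_target, extChartAt_posReal_target]

theorem extChartAt_spacetime_symm (p : PosReal × S₀) {z : ℝ × EuclideanSpace ℝ (Fin n)}
    (hz : 0 < z.1) : (extChartAt (IQ n) p).symm z = (⟨z.1, hz⟩, (extChartAt (IS n) p.2).symm z.2) := by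
  rw [extChartAt_spacetime]
  exact Prod.ext (extChartAt_posReal_symm p.1 hz) rfl

theorem extChartAt_spacetime_apply (p q : PosReal × S₀) : extChartAt (IQ n) p q =
    ((q.1 : ℝ), extChartAt (IS n) p.2 q.2) := by
  rw [extChartAt_spacetime]; rfl

variable [IsManifold (IS n) ∞ S₀]

/-- Reconciles two manifold structures on `E × F`: as a vector space and as a product of manifolds.
-/
theorem mfderiv_self_prod {E F E' H' N : Type*} [NormedAddCommGroup E] [NormedSpace ℝ E]
    [NormedAddCommGroup F] [NormedSpace ℝ F] [NormedAddCommGroup E'] [NormedSpace ℝ E']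
    [TopologicalSpace H'] {J : ModelWithCorners ℝ E' H'} [TopologicalSpace N] [ChartedSpace H' N]
    (f : E × F → N) (z : E × F) :
    (mfderiv 𝓘(ℝ, E × F) J f z : E × F →L[ℝ] E') =
      (mfderiv (𝓘(ℝ, E).prod 𝓘(ℝ, F)) J f z : E × F →L[ℝ] E') := by
  rw [modelWithCornersSelf_prod, ← chartedSpaceSelf_prod]

theorem chartDeriv_spacetime (p : PosReal × S₀) {z : ℝ × EuclideanSpace ℝ (Fin n)}
    (hz : z ∈ (extChartAt (IQ n) p).target) : chartDeriv (IQ n) p z =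
      (ContinuousLinearMap.id ℝ ℝ).prodMap (chartDeriv (IS n) p.2 z.2) := by
  rw [extChartAt_spacetime_target] at hz
  have h1 : z.1 ∈ (extChartAt 𝓘(ℝ, ℝ) p.1).target := by rw [extChartAt_posReal_target]; exact hz.1
  have h := mfderiv_prodMap (p := z)
    ((contMDiffAt_chart_symm (I := 𝓘(ℝ, ℝ)) h1).mdifferentiableAt (by simp))
    ((contMDiffAt_chart_symm (I := IS n) hz.2).mdifferentiableAt (by simp))
  have h2 : (extChartAt (IQ n) p).symm = Prod.map (extChartAt 𝓘(ℝ, ℝ) p.1).symm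
      (extChartAt (IS n) p.2).symm := by
    rw [extChartAt_spacetime]; rfl
  rw [← chartDeriv_posReal p.1 hz.1, chartDeriv, h2]
  exact (mfderiv_self_prod _ _).trans h

/-- The coefficient of `-dt²`. -/
def timeCoeff (n : ℕ) : ℝ := 32 * ((n : ℝ) - 1) / (n : ℝ) ^ 2

theorem timeCoeff_pos (hn : 2 ≤ n) : 0 < timeCoeff n := by
  have : (2 : ℝ) ≤ n := by exact_mod_cast hn
  have h1 : (0 : ℝ) < n - 1 := by linarith
  unfold timeCoeff
  positivity

theorem formAt_warpedMetric (σ : TwoTensor (IS n) S₀) (f : ℝ → ℝ) (p : PosReal × S₀) :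
    formAt (warpedMetric σ f) p = warpedForm (timeCoeff n) (f p.1 / ((n : ℝ) - 1)) (formAt σ p.2) :=
  rfl

theorem warpedMetric_apply (σ : TwoTensor (IS n) S₀) (f : ℝ → ℝ) (p : PosReal × S₀)
    (v w : ℝ × EuclideanSpace ℝ (Fin n)) :
    formAt (warpedMetric σ f) p v w =
      -timeCoeff n * (v.1 * w.1) + f p.1 / ((n : ℝ) - 1) * formAt σ p.2 v.2 w.2 := by
  rw [formAt_warpedMetric, warpedForm_apply]

theorem localMetric_warpedMetric (σ : TwoTensor (IS n) S₀) (f : ℝ → ℝ) (p : PosReal × S₀)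
    {z : ℝ × EuclideanSpace ℝ (Fin n)} (hz : z ∈ (extChartAt (IQ n) p).target) :
    localMetric (warpedMetric σ f) p z =
      warpedForm (timeCoeff n) (f z.1 / ((n : ℝ) - 1)) (localMetric σ p.2 z.2) := by
  have hz' := hz
  rw [extChartAt_spacetime_target] at hz'
  refine ContinuousLinearMap.ext fun v ↦ ContinuousLinearMap.ext fun w ↦ ?_
  rw [localMetric_eq, chartDeriv_spacetime p hz, ContinuousLinearMap.bilinearComp_apply,
    extChartAt_spacetime_symm p hz'.1, warpedMetric_apply, warpedForm_apply, localMetric_eq]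
  rfl

theorem isPseudoRiemannian_warpedMetric (hn : 2 ≤ n) {σ : TwoTensor (IS n) S₀}
    (hσ : IsPseudoRiemannian σ) {f : ℝ → ℝ} (hf : ContDiffOn ℝ ∞ f (Ioi 0))
    (hf0 : ∀ t, 0 < t → 0 < f t) : IsPseudoRiemannian (warpedMetric σ f) := fun p ↦ by
  have h1 : (0 : ℝ) < n - 1 := by
    have : (2 : ℝ) ≤ n := by exact_mod_cast hn
    linarith
  refine ⟨isOpen_extChartAt_target p, ?_, fun z hz ↦ ?_⟩
  · have := contDiffOn_warpedForm (c := timeCoeff n) (hf.div_const ((n : ℝ) - 1)) (hσ p.2).smooth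
    rw [← extChartAt_spacetime_target p] at this
    exact this.congr fun z hz ↦ localMetric_warpedMetric σ f p hz
  · rw [localMetric_warpedMetric σ f p hz]
    rw [extChartAt_spacetime_target] at hz
    exact ((hσ p.2).nondeg _ hz.2).warpedForm (timeCoeff_pos hn).ne'
      (div_pos (hf0 _ hz.1) h1).ne'

theorem isLorentzMetric_warpedMetric (hn : 2 ≤ n) (σ : RiemannMetric n S₀) {f : ℝ → ℝ}
    (hf : ContDiffOn ℝ ∞ f (Ioi 0)) (hf0 : ∀ t, 0 < t → 0 < f t) :
    IsLorentzMetric (warpedMetric σ.inner f) where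
  smooth p := (isPseudoRiemannian_warpedMetric hn (isPseudoRiemannian_inner σ) hf hf0 p).smooth
  symm p v w := by
    have key : ∀ v w : ℝ × EuclideanSpace ℝ (Fin n), formAt (warpedMetric σ.inner f) p v w =
        formAt (warpedMetric σ.inner f) p w v := fun v w ↦ by
      rw [warpedMetric_apply, warpedMetric_apply, mul_comm v.1]
      congr 2
      exact σ.symm p.2 _ _
    exact key v w
  signature p := by
    have h1 : (0 : ℝ) < n - 1 := by
      have : (2 : ℝ) ≤ n := by exact_mod_cast hn
      linarith
    have hc := timeCoeff_pos hn
    have key : ∀ v : ℝ × EuclideanSpace ℝ (Fin n), v ≠ 0 →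
        formAt (warpedMetric σ.inner f) p (1, 0) v = 0 →
        0 < formAt (warpedMetric σ.inner f) p v v := fun v hv hv0 ↦ by
      rw [warpedMetric_apply] at hv0 ⊢
      have hv1 : v.1 = 0 := by simpa [hc.ne'] using hv0
      have hv2 : v.2 ≠ 0 := fun h ↦ hv (Prod.ext hv1 h)
      have h4 := mul_pos (div_pos (hf0 _ p.1.2) h1) (σ.pos p.2 v.2 hv2)
      rw [hv1, mul_zero, mul_zero, zero_add]
      exact h4
    -- The negative direction is `∂/∂t`, and its orthogonal complement consists of the spatial
    -- vectors.
    refine ⟨timeField p, ?_, fun v hv hv0 ↦ key v hv hv0⟩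
    change formAt (warpedMetric σ.inner f) p (1, 0) (1, 0) < 0
    rw [warpedMetric_apply]
    simpa using hc

theorem isTimeOrientation_warpedMetric (hn : 2 ≤ n) (σ : TwoTensor (IS n) S₀) (f : ℝ → ℝ) :
    IsTimeOrientation (warpedMetric σ f) timeField where
  continuous := by
    rw [continuous_iff_continuousAt]
    intro p
    rw [FiberBundle.continuousAt_totalSpace]
    refine ⟨continuousAt_id, ?_⟩
    -- In each tangent trivialization the field has the constant coordinates `(1, 0)`.
    have h : (fun q : PosReal × S₀ ↦ (trivializationAt (ℝ × EuclideanSpace ℝ (Fin n))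
        (TangentSpace (IQ n)) p (⟨q, timeField q⟩ : TangentBundle (IQ n) (PosReal × S₀))).2) =ᶠ[𝓝 p]
        fun _ ↦ ((1 : ℝ), (0 : EuclideanSpace ℝ (Fin n))) := by
      filter_upwards [(isOpen_extChartAt_source (I := IQ n) p).mem_nhds (mem_extChartAt_source p)]
        with q hq
      have hq' : q ∈ (trivializationAt (ℝ × EuclideanSpace ℝ (Fin n))
        (TangentSpace (IQ n) : PosReal × S₀ → Type _) p).baseSet := by simpa using hq
      have h1 := symmL_eq_chartDeriv (I := IQ n) hq
      rw [chartDeriv_spacetime p ((extChartAt (IQ n) p).map_source hq)] at h1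
      have h2 : (trivializationAt (ℝ × EuclideanSpace ℝ (Fin n)) (TangentSpace (IQ n)) p).symmL ℝ q
          ((1 : ℝ), (0 : EuclideanSpace ℝ (Fin n))) = timeField q :=
        (congrArg (fun L : (ℝ × EuclideanSpace ℝ (Fin n)) →L[ℝ] ℝ × EuclideanSpace ℝ (Fin n) ↦
          L (1, 0)) h1).trans (Prod.ext rfl (map_zero (chartDeriv (IS n) p.2 (extChartAt (IQ n) p q).2)))
      rw [← h2, Trivialization.symmL_apply _ hq', Trivialization.apply_mk_symm _ hq']
    exact (continuousAt_const).congr h.symm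
  timelike p := by
    change formAt (warpedMetric σ f) p (1, 0) (1, 0) < 0
    rw [warpedMetric_apply]
    simpa using timeCoeff_pos hn

end Spacetime

end

end QuantizedGravity

namespace QuantizedGravity

noncomputable section

set_option linter.unusedSectionVars false
set_option maxSynthPendingDepth 3

/-! ### The wave operator in charts -/

section Wave

variable {n : ℕ} {S₀ : Type*} [TopologicalSpace S₀]
  [ChartedSpace (EuclideanSpace ℝ (Fin n)) S₀]

/-- The operator `c⁻¹ ü - (n-1) t^{2-4/n} Δ u + b u`, where `c` is the coefficient of `-dt²`. -/
def modelWave (σ : TwoTensor (IS n) S₀) (b : ℝ → S₀ → ℝ) (u : PosReal × S₀ → ℝ)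
    (p : PosReal × S₀) : ℝ :=
  (timeCoeff n)⁻¹ * timeDeriv2 u p
    - ((n : ℝ) - 1) * (p.1 : ℝ) ^ (2 - 4 / (n : ℝ)) * laplacian σ (fun y ↦ u (p.1, y)) p.2
    + b p.1 p.2 * u p

/-- `b` is a smooth function on `ℝ₊ × S₀`. -/
def IsSmoothPotential (n : ℕ) {S₀ : Type*} [TopologicalSpace S₀]
    [ChartedSpace (EuclideanSpace ℝ (Fin n)) S₀] (b : ℝ → S₀ → ℝ) : Prop :=
  ∀ x : S₀, ContDiffOn ℝ ∞ (fun z : ℝ × EuclideanSpace ℝ (Fin n) ↦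
    b z.1 ((extChartAt (IS n) x).symm z.2)) (Ioi 0 ×ˢ (extChartAt (IS n) x).target)

theorem contDiffOn_rpow_fst {E : Type*} [NormedAddCommGroup E] [NormedSpace ℝ E] (r : ℝ)
    (U : Set E) : ContDiffOn ℝ ∞ (fun z : ℝ × E ↦ z.1 ^ r) (Ioi 0 ×ˢ U) := fun z hz ↦
  ((Real.contDiffAt_rpow_const_of_ne (ne_of_gt hz.1)).comp z contDiffAt_fst).contDiffWithinAt

/-! ### The zero order coefficient of the wave operator -/

section Potential

variable [IsManifold (IS n) ∞ S₀]
  {𝔤 : Type*} [NormedAddCommGroup 𝔤] [NormedSpace ℝ 𝔤] [FiniteDimensional ℝ 𝔤] [CompleteSpace 𝔤]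
  {G : Type*} [TopologicalSpace G] [ChartedSpace 𝔤 G] [Group G] [LieGroup 𝓘(ℝ, 𝔤) ∞ G]
  {E₀ : S₀ → Type*} [TopologicalSpace (TotalSpace 𝔤 E₀)]
  [∀ x, AddCommGroup (E₀ x)] [∀ x, Module ℝ (E₀ x)] [∀ x, TopologicalSpace (E₀ x)]
  [∀ x, IsTopologicalAddGroup (E₀ x)] [∀ x, ContinuousSMul ℝ (E₀ x)] [FiberBundle 𝔤 E₀]

/-- The coefficient of `u` in the wave operator. -/
def wavePotential (σ : TwoTensor (IS n) S₀) (A : GaugeConnection (IS n) 𝔤 G E₀)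
    (Φ : ∀ x : S₀, E₀ x) (V : TotalSpace 𝔤 E₀ → ℝ) (α₁ α₂ m Λ : ℝ) (t : ℝ) (x : S₀) : ℝ :=
  t ^ (2 - 4 / (n : ℝ)) * (-((n : ℝ) / 2) * scalarCurvature σ x
    + α₁ * ((n : ℝ) / 8) * yangMillsDensity σ A x + α₂ * ((n : ℝ) / 4) * higgsDensity σ A Φ x
    + α₂ * ((n : ℝ) / 2) * m * V ⟨x, Φ x⟩) + (n : ℝ) * t ^ 2 * Λ

/-- From here on the scalar curvature, the gauge fields and the constants occur only through the
coefficient of `u`. -/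
theorem waveOperator_eq (σ : TwoTensor (IS n) S₀) (A : GaugeConnection (IS n) 𝔤 G E₀)
    (Φ : ∀ x : S₀, E₀ x) (V : TotalSpace 𝔤 E₀ → ℝ) (α₁ α₂ m Λ : ℝ) :
    waveOperator σ A Φ V α₁ α₂ m Λ = modelWave σ (wavePotential σ A Φ V α₁ α₂ m Λ) := by
  funext u p
  have : 1 / 32 * ((n : ℝ) ^ 2 / ((n : ℝ) - 1)) = (timeCoeff n)⁻¹ := by
    rw [timeCoeff, inv_div, div_mul_div_comm, one_mul]
  simp only [waveOperator, modelWave, wavePotential, this]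
  ring

variable [VectorBundle ℝ 𝔤 E₀] [ContMDiffVectorBundle ∞ 𝔤 E₀ (IS n)]

theorem isSmoothPotential_wavePotential (hE₀ : IsAdjointBundle 𝔤 G E₀)
    {σ : TwoTensor (IS n) S₀}
    (hσ : IsPseudoRiemannian σ) (A : GaugeConnection (IS n) 𝔤 G E₀)
    (Φ : ContMDiffSection (IS n) 𝔤 ∞ E₀) {V : TotalSpace 𝔤 E₀ → ℝ}
    (hV : ContMDiff ((IS n).prod 𝓘(ℝ, 𝔤)) 𝓘(ℝ, ℝ) ∞ V) (α₁ α₂ m Λ : ℝ) :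
    IsSmoothPotential n (wavePotential σ A Φ V α₁ α₂ m Λ) := fun x ↦ by
  have hs : MapsTo (Prod.snd : ℝ × EuclideanSpace ℝ (Fin n) → _)
      (Ioi 0 ×ˢ (extChartAt (IS n) x).target) (extChartAt (IS n) x).target := fun z hz ↦ hz.2
  have h1 : ContDiffOn ℝ ∞ (fun y ↦ scalarCurvature σ ((extChartAt (IS n) x).symm y))
      (extChartAt (IS n) x).target :=
    (hσ x).contDiffOn_flatScalarCurvature.congr fun y hy ↦ scalarCurvature_chart hσ hy
  have h2 := ((((contDiffOn_const (c := -((n : ℝ) / 2))).mul h1).add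
    ((contDiffOn_const (c := α₁ * ((n : ℝ) / 8))).mul
      (contDiffOn_yangMillsDensity A hσ x))).add
    ((contDiffOn_const (c := α₂ * ((n : ℝ) / 4))).mul
      (contDiffOn_higgsDensity A Φ hE₀ hσ x))).add
    ((contDiffOn_const (c := α₂ * ((n : ℝ) / 2) * m)).mul (contDiffOn_potential Φ hV x))
  exact ((contDiffOn_rpow_fst _ _).mul (h2.comp contDiff_snd.contDiffOn hs)).add
    (by fun_prop)

end Potential

/-! ### The wave operator in a fixed chart and its principal part -/

section Local

variable [IsManifold (IS n) ∞ S₀]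

theorem timeDeriv2_chart {u : PosReal × S₀ → ℝ} (hu : ContMDiff (IQ n) 𝓘(ℝ, ℝ) ∞ u)
    (p : PosReal × S₀) {z : ℝ × EuclideanSpace ℝ (Fin n)} (hz : z ∈ (extChartAt (IQ n) p).target) :
    timeDeriv2 u ((extChartAt (IQ n) p).symm z) =
      fderiv ℝ (fderiv ℝ fun w ↦ u ((extChartAt (IQ n) p).symm w)) z (1, 0) (1, 0) := by
  have hz' := hz
  rw [extChartAt_spacetime_target] at hz'
  have hA : ∀ s : ℝ, ((s, z.2) : ℝ × EuclideanSpace ℝ (Fin n)) =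
      (0, z.2) + ContinuousLinearMap.inl ℝ ℝ _ s := fun s ↦ by simp
  have h1 := fderiv_fderiv_comp_affine hA (isOpen_extChartAt_target p)
    (contDiffOn_comp_chart_symm (x := p) hu) (y := z.1) hz (1 : ℝ) 1
  simp only [ContinuousLinearMap.inl_apply] at h1
  rw [← h1, extChartAt_spacetime_symm p hz'.1]
  -- The default value `0` for `s ≤ 0` is harmless, since only a neighbourhood of the positive
  -- number `z.1` counts.
  have h2 : (fun s : ℝ ↦ if h : 0 < s then
      u (⟨s, h⟩, (extChartAt (IS n) p.2).symm z.2) else 0) =ᶠ[𝓝 z.1]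
      fun s ↦ u ((extChartAt (IQ n) p).symm (s, z.2)) := by
    filter_upwards [lt_mem_nhds hz'.1] with s hs
    rw [dif_pos hs, extChartAt_spacetime_symm p (z := (s, z.2)) hs]
  rw [timeDeriv2, h2.iteratedDeriv_eq 2, iteratedDeriv, iteratedFDeriv_two_apply]

theorem contMDiff_slice {u : PosReal × S₀ → ℝ} (hu : ContMDiff (IQ n) 𝓘(ℝ, ℝ) ∞ u) (t : PosReal) :
    ContMDiff (IS n) 𝓘(ℝ, ℝ) ∞ (fun y ↦ u (t, y)) :=
  hu.comp (contMDiff_const.prodMk contMDiff_id)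

theorem modelWave_chart {σ : TwoTensor (IS n) S₀} (hσ : IsPseudoRiemannian σ) (b : ℝ → S₀ → ℝ)
    {u : PosReal × S₀ → ℝ} (hu : ContMDiff (IQ n) 𝓘(ℝ, ℝ) ∞ u)
    (p : PosReal × S₀) {z : ℝ × EuclideanSpace ℝ (Fin n)} (hz : z ∈ (extChartAt (IQ n) p).target) :
    let F := fun w ↦ u ((extChartAt (IQ n) p).symm w)
    modelWave σ b u ((extChartAt (IQ n) p).symm z) =
      (timeCoeff n)⁻¹ * fderiv ℝ (fderiv ℝ F) z (1, 0) (1, 0)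
        - ((n : ℝ) - 1) * z.1 ^ (2 - 4 / (n : ℝ)) *
          flatLaplacian (localMetric σ p.2) (fun y ↦ F (z.1, y)) z.2
        + b z.1 ((extChartAt (IS n) p.2).symm z.2) * F z := by
  intro F
  have hz' := hz
  rw [extChartAt_spacetime_target] at hz'
  rw [modelWave, timeDeriv2_chart hu p hz, extChartAt_spacetime_symm p hz'.1]
  dsimp only
  rw [laplacian_chart hσ (contMDiff_slice hu _) hz'.2]
  have h1 : (fun y ↦ u (⟨z.1, hz'.1⟩, (extChartAt (IS n) p.2).symm y)) = fun y ↦ F (z.1, y) := by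
    funext y
    simp only [F]
    rw [extChartAt_spacetime_symm p (z := (z.1, y)) hz'.1]
  rw [h1]
  congr 2
  simp only [F]
  rw [extChartAt_spacetime_symm p hz'.1]

/-- The contraction `B^{ij} Γ(b_i, b_j)` of the Christoffel symbols. -/
def contractedChristoffel {E : Type*} [NormedAddCommGroup E] [NormedSpace ℝ E]
    [FiniteDimensional ℝ E] (B : E → E →L[ℝ] E →L[ℝ] ℝ) (y : E) : E :=
  ∑ i, christoffelSymbol B y (Module.finBasis ℝ E i) (reciprocal (B y) i)

theorem flatLaplacian_eq {E : Type*} [NormedAddCommGroup E] [NormedSpace ℝ E]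
    [FiniteDimensional ℝ E] (B : E → E →L[ℝ] E →L[ℝ] ℝ) (f : E → ℝ) (y : E) :
    flatLaplacian B f y = metricTrace (B y) (fun v w ↦ fderiv ℝ (fderiv ℝ f) y v w)
      - fderiv ℝ f y (contractedChristoffel B y) := by
  simp only [flatLaplacian, metricTrace, contractedChristoffel, map_sum, Finset.sum_sub_distrib]

theorem contDiffOn_contractedChristoffel {E : Type*} [NormedAddCommGroup E] [NormedSpace ℝ E]
    [FiniteDimensional ℝ E] {B : E → E →L[ℝ] E →L[ℝ] ℝ} {U : Set E} (hB : IsMetricOn B U) :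
    ContDiffOn ℝ ∞ (contractedChristoffel B) U := by
  refine ContDiffOn.sum fun i _ ↦ ?_
  simp only [← christoffelL_apply]
  exact (hB.contDiffOn_christoffelL.clm_apply contDiffOn_const).clm_apply
    (hB.contDiffOn_reciprocal i)

/-- The exponent of the warping function is the one for which the spatial part of the inverse metric
is `(n - 1) t^(2 - 4/n)` times that of `σ`, the coefficient of the Laplacian. The contracted
Christoffel symbols give the first order term. -/
theorem isNormallyHyperbolic_modelWave (hn : 2 ≤ n) {σ : TwoTensor (IS n) S₀}
    (hσ : IsPseudoRiemannian σ) {b : ℝ → S₀ → ℝ} (hb : IsSmoothPotential n b) :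
    IsNormallyHyperbolic (warpedMetric σ fun t ↦ t ^ (4 / (n : ℝ) - 2)) (modelWave σ b) := fun p ↦ by
  have hn1 : (0 : ℝ) < n - 1 := by
    have : (2 : ℝ) ≤ n := by exact_mod_cast hn
    linarith
  have hs : MapsTo (Prod.snd : ℝ × EuclideanSpace ℝ (Fin n) → _)
      (Ioi 0 ×ˢ (extChartAt (IS n) p.2).target) (extChartAt (IS n) p.2).target := fun z hz ↦ hz.2
  refine ⟨fun z ↦ (0, (((n : ℝ) - 1) * z.1 ^ (2 - 4 / (n : ℝ))) •
      contractedChristoffel (localMetric σ p.2) z.2),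
    fun z ↦ b z.1 ((extChartAt (IS n) p.2).symm z.2), ?_, ?_, fun u hu z hz ↦ ?_⟩
  · rw [extChartAt_spacetime_target]
    exact contDiffOn_const.prodMk ((contDiffOn_const.mul (contDiffOn_rpow_fst _ _)).smul
      ((contDiffOn_contractedChristoffel (hσ p.2)).comp contDiff_snd.contDiffOn hs))
  · rw [extChartAt_spacetime_target]
    exact hb p.2
  · intro f
    have hz' := hz
    rw [extChartAt_spacetime_target] at hz'
    have ht : (0 : ℝ) < z.1 := hz'.1
    have hA : ∀ y : EuclideanSpace ℝ (Fin n), ((z.1, y) : ℝ × EuclideanSpace ℝ (Fin n)) =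
        (z.1, 0) + ContinuousLinearMap.inr ℝ ℝ _ y := fun s ↦ by simp
    have hU := isOpen_extChartAt_target (I := IQ n) p
    have hf := contDiffOn_comp_chart_symm (x := p) hu
    rw [modelWave_chart hσ b hu p hz, flatLaplacian_eq,
      fderiv_comp_affine hA hU hf hz, localMetric_warpedMetric _ _ p hz,
      metricTrace_warpedForm ((hσ p.2).nondeg _ hz'.2) (timeCoeff_pos hn).ne'
        (div_pos (Real.rpow_pos_of_pos ht _) hn1).ne']
    simp only [fderiv_fderiv_comp_affine hA hU hf hz, ContinuousLinearMap.inr_apply,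
      ContinuousLinearMap.comp_apply]
    have e1 : ((z.1 ^ (4 / (n : ℝ) - 2) / ((n : ℝ) - 1))⁻¹) =
        ((n : ℝ) - 1) * z.1 ^ (2 - 4 / (n : ℝ)) := by
      rw [inv_div, show (4 / (n : ℝ) - 2) = -(2 - 4 / (n : ℝ)) by ring, Real.rpow_neg ht.le,
        div_inv_eq_mul]
    have e2 : ((0 : ℝ), (((n : ℝ) - 1) * z.1 ^ (2 - 4 / (n : ℝ))) •
        contractedChristoffel (localMetric σ p.2) z.2) = (((n : ℝ) - 1) * z.1 ^ (2 - 4 / (n : ℝ))) •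
        ((0 : ℝ), contractedChristoffel (localMetric σ p.2) z.2) := by simp
    rw [e1, e2, map_smul, smul_eq_mul]
    ring

end Local

end Wave

end

end QuantizedGravity

namespace QuantizedGravity

noncomputable section

set_option linter.unusedSectionVars false
set_option maxSynthPendingDepth 3

/-! ### Causal curves -/

section Arcs

/-- Induction on the number of break points between `a` and `b`; splitting at one of them leaves
fewer on either side. This carries transitive estimates from `C¹` arcs to piecewise `C¹` curves. -/
theorem relation_of_arcs {D : Set ℝ} (hD : ∀ a b, (D ∩ Icc a b).Finite) {R : ℝ → ℝ → Prop}
    (trans : ∀ a b c, a < b → b < c → R a b → R b c → R a c)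
    (arc : ∀ a b, a < b → Disjoint D (Ioo a b) → R a b) : ∀ a b, a < b → R a b := by
  have hf : ∀ a b, (D ∩ Ioo a b).Finite := fun a b ↦
    (hD a b).subset (inter_subset_inter_right D Ioo_subset_Icc_self)
  suffices h : ∀ (k : ℕ) (a b : ℝ), (D ∩ Ioo a b).ncard = k → a < b → R a b from
    fun a b ↦ h _ a b rfl
  intro k
  induction k using Nat.strong_induction_on with
  | _ k ih =>
    intro a b hk hab
    by_cases hd : Disjoint D (Ioo a b)
    · exact arc a b hab hd
    · obtain ⟨d, hdD, hd⟩ := not_disjoint_iff.1 hd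
      have h1 : D ∩ Ioo a d ⊂ D ∩ Ioo a b :=
        ⟨inter_subset_inter_right D (Ioo_subset_Ioo_right hd.2.le),
          fun h ↦ lt_irrefl d (h ⟨hdD, hd⟩).2.2⟩
      have h2 : D ∩ Ioo d b ⊂ D ∩ Ioo a b :=
        ⟨inter_subset_inter_right D (Ioo_subset_Ioo_left hd.1.le),
          fun h ↦ lt_irrefl d (h ⟨hdD, hd⟩).2.1⟩
      exact trans a d b hd.1 hd.2
        (ih _ (hk ▸ ncard_lt_ncard h1 (hf a b)) a d rfl hd.1)
        (ih _ (hk ▸ ncard_lt_ncard h2 (hf a b)) d b rfl hd.2)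

end Arcs

/-! ### Causal curves of warped metrics and Cauchy hypersurfaces -/

section Causality

variable {n : ℕ} {S₀ : Type*} [TopologicalSpace S₀]
  [ChartedSpace (EuclideanSpace ℝ (Fin n)) S₀]

theorem hasMFDerivWithinAt_spacetime {γ : ℝ → PosReal × S₀} {s : Set ℝ} {x : ℝ}
    {L : ℝ →L[ℝ] ℝ × EuclideanSpace ℝ (Fin n)} (h : HasMFDerivWithinAt 𝓘(ℝ, ℝ) (IQ n) γ s x L) :
    HasDerivWithinAt (fun r ↦ ((γ r).1 : ℝ)) (L 1).1 s x ∧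
      HasMFDerivWithinAt 𝓘(ℝ, ℝ) (IS n) (fun r ↦ (γ r).2) s x
        ((ContinuousLinearMap.snd ℝ ℝ (EuclideanSpace ℝ (Fin n))).comp L) := by
  obtain ⟨h1, h2⟩ := h
  have e : writtenInExtChartAt 𝓘(ℝ, ℝ) (IQ n) x γ = fun r ↦
      (((γ r).1 : ℝ), extChartAt (IS n) (γ x).2 (γ r).2) := by
    funext r
    simp only [writtenInExtChartAt, Function.comp_apply, extChartAt_spacetime_apply]
    rfl
  rw [e] at h2
  refine ⟨?_, h1.snd, ?_⟩
  · have := h2.fst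
    simp only [mfld_simps] at this
    exact this.hasDerivWithinAt
  · have := h2.snd
    simp only [mfld_simps] at this ⊢
    exact this

theorem IsCausalArc.hasDerivWithinAt {g : TwoTensor (IQ n) (PosReal × S₀)}
    {T : ∀ p : PosReal × S₀, TangentSpace (IQ n) p} {γ : ℝ → PosReal × S₀} {a b : ℝ}
    (h : IsCausalArc g T γ a b) {s : ℝ} (hs : s ∈ Icc a b) :
    let v : ℝ × EuclideanSpace ℝ (Fin n) := velocity (IQ n) γ a b s
    HasDerivWithinAt (fun r ↦ ((γ r).1 : ℝ)) v.1 (Icc a b) s ∧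
      HasMFDerivWithinAt 𝓘(ℝ, ℝ) (IS n) (fun r ↦ (γ r).2) (Icc a b) s
        (ContinuousLinearMap.smulRight (1 : ℝ →L[ℝ] ℝ) v.2) := by
  intro v
  have h1 := hasMFDerivWithinAt_spacetime
    ((h.1 s hs).mdifferentiableWithinAt (by simp)).hasMFDerivWithinAt
  refine ⟨h1.1, ?_⟩
  have e : ContinuousLinearMap.smulRight (1 : ℝ →L[ℝ] ℝ) v.2 =
      (ContinuousLinearMap.snd ℝ ℝ (EuclideanSpace ℝ (Fin n))).comp
        (mfderivWithin 𝓘(ℝ, ℝ) (IQ n) γ (Icc a b) s :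
          ℝ →L[ℝ] ℝ × EuclideanSpace ℝ (Fin n)) :=
    ContinuousLinearMap.ext_ring (one_smul ℝ v.2)
  exact h1.2.congr_mfderiv e.symm

variable [IsManifold (IS n) ∞ S₀]

/-- The Riemannian distance of `σ`. -/
def riemannDist (σ : RiemannMetric n S₀) (x y : S₀) : ENNReal :=
  letI : RiemannianBundle (fun x : S₀ ↦ TangentSpace (IS n) x) := ⟨σ.toRiemannianMetric⟩
  riemannianEDist (IS n) x y

theorem riemannDist_comm (σ : RiemannMetric n S₀) (x y : S₀) :
    riemannDist σ x y = riemannDist σ y x :=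
  letI : RiemannianBundle (fun x : S₀ ↦ TangentSpace (IS n) x) := ⟨σ.toRiemannianMetric⟩
  riemannianEDist_comm

theorem riemannDist_self (σ : RiemannMetric n S₀) (x : S₀) : riemannDist σ x x = 0 :=
  letI : RiemannianBundle (fun x : S₀ ↦ TangentSpace (IS n) x) := ⟨σ.toRiemannianMetric⟩
  riemannianEDist_self

theorem riemannDist_triangle (σ : RiemannMetric n S₀) (x y z : S₀) :
    riemannDist σ x z ≤ riemannDist σ x y + riemannDist σ y z :=
  letI : RiemannianBundle (fun x : S₀ ↦ TangentSpace (IS n) x) := ⟨σ.toRiemannianMetric⟩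
  riemannianEDist_triangle

/-- The distance is at most the length of the curve, and `C` bounds its speed. -/
theorem riemannDist_le_lintegral (σ : RiemannMetric n S₀) {x : ℝ → S₀} {a b : ℝ} (hab : a ≤ b)
    (hx : ContMDiffOn 𝓘(ℝ, ℝ) (IS n) 1 x (Icc a b)) {v : ℝ → EuclideanSpace ℝ (Fin n)}
    (hv : ∀ s ∈ Icc a b, HasMFDerivWithinAt 𝓘(ℝ, ℝ) (IS n) x (Icc a b) s
      (ContinuousLinearMap.smulRight (1 : ℝ →L[ℝ] ℝ) (v s))) {C : ℝ → ℝ}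
    (hC : ∀ s ∈ Icc a b, formAt σ.inner (x s) (v s) (v s) ≤ C s ^ 2)
    (hC0 : ∀ s ∈ Icc a b, 0 ≤ C s) :
    riemannDist σ (x a) (x b) ≤ ∫⁻ s in Icc a b, ENNReal.ofReal (C s) := by
  let : RiemannianBundle (fun x : S₀ ↦ TangentSpace (IS n) x) := ⟨σ.toRiemannianMetric⟩
  rcases hab.eq_or_lt with rfl | hab'
  · rw [riemannDist_self]; exact zero_le
  refine (riemannianEDist_le_pathELength hx rfl rfl hab).trans ?_
  rw [pathELength_eq_lintegral_mfderivWithin_Icc]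
  refine setLIntegral_mono' measurableSet_Icc fun s hs ↦ ?_
  have hd : (mfderivWithin 𝓘(ℝ, ℝ) (IS n) x (Icc a b) s : ℝ →L[ℝ] EuclideanSpace ℝ (Fin n)) =
      ContinuousLinearMap.smulRight (1 : ℝ →L[ℝ] ℝ) (v s) :=
    (hv s hs).mfderivWithin ((uniqueDiffOn_Icc hab').uniqueMDiffOn s hs)
  have hd1 : (mfderivWithin 𝓘(ℝ, ℝ) (IS n) x (Icc a b) s : ℝ →L[ℝ] EuclideanSpace ℝ (Fin n)) 1 =
      v s := by rw [hd]; exact one_smul ℝ (v s)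
  have key : ∀ w : TangentSpace (IS n) (x s), ‖w‖ₑ =
      ENNReal.ofReal √(formAt σ.inner (x s) w w) := fun w ↦ by
    rw [← ofReal_norm, norm_eq_sqrt_real_inner]
    rfl
  refine (key _).trans_le (ENNReal.ofReal_le_ofReal ?_)
  refine Real.sqrt_le_iff.2 ⟨hC0 s hs, ?_⟩
  refine le_trans (le_of_eq ?_) (hC s hs)
  exact congrArg (fun w : EuclideanSpace ℝ (Fin n) ↦ formAt σ.inner (x s) w w) hd1

variable {σ : RiemannMetric n S₀} {f : ℝ → ℝ}

/-- The pairing with `∂/∂t` is `-c v.1`, which gives the sign; the causality inequality, solved for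
the spatial part, gives the bound. -/
theorem IsFutureCausal.warpedMetric (hn : 2 ≤ n) (hf0 : ∀ t, 0 < t → 0 < f t) {p : PosReal × S₀}
    {v : ℝ × EuclideanSpace ℝ (Fin n)}
    (h : IsFutureCausal (warpedMetric σ.inner f) timeField p v) : 0 < v.1 ∧
      formAt σ.inner p.2 v.2 v.2 ≤ timeCoeff n * (n - 1) / f p.1 * v.1 ^ 2 := by
  have hc := timeCoeff_pos hn
  have hn1 : (0 : ℝ) < n - 1 := by
    have : (2 : ℝ) ≤ n := by exact_mod_cast hn
    linarith
  have hf := hf0 p.1 p.1.2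
  obtain ⟨h1, h2⟩ := h
  change formAt (QuantizedGravity.warpedMetric σ.inner f) p v v ≤ 0 at h1
  change formAt (QuantizedGravity.warpedMetric σ.inner f) p (1, 0) v < 0 at h2
  rw [warpedMetric_apply] at h1 h2
  constructor
  · simp at h2
    exact (mul_pos_iff_of_pos_left hc).1 h2
  · rw [div_mul_eq_mul_div, le_div_iff₀ hf]
    have h3 : f p.1 / ((n : ℝ) - 1) * formAt σ.inner p.2 v.2 v.2 ≤ timeCoeff n * (v.1 * v.1) := by
      linarith
    rw [div_mul_eq_mul_div, div_le_iff₀ hn1] at h3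
    nlinarith

theorem IsCausalArc.time_lt (hn : 2 ≤ n) (hf0 : ∀ t, 0 < t → 0 < f t) {γ : ℝ → PosReal × S₀}
    {a b : ℝ} (h : IsCausalArc (warpedMetric σ.inner f) timeField γ a b) :
    StrictMonoOn (fun s ↦ ((γ s).1 : ℝ)) (Icc a b) := by
  refine strictMonoOn_of_hasDerivWithinAt_pos (convex_Icc a b)
    (fun s hs ↦ (h.hasDerivWithinAt hs).1.continuousWithinAt)
    (fun s hs ↦ (h.hasDerivWithinAt (interior_subset hs)).1.mono interior_subset)
    fun s hs ↦ ((h.2 s (interior_subset hs)).warpedMetric hn hf0).1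

/-- A nonnegative derivative of a continuous function is automatically integrable, so the
fundamental theorem of calculus applies without continuity of the velocity. -/
theorem IsCausalArc.integrable_velocity (hn : 2 ≤ n) (hf0 : ∀ t, 0 < t → 0 < f t)
    {γ : ℝ → PosReal × S₀} {a b : ℝ} (hab : a < b)
    (h : IsCausalArc (warpedMetric σ.inner f) timeField γ a b) :
    IntegrableOn (fun s ↦ Prod.fst (velocity (IQ n) γ a b s : ℝ × EuclideanSpace ℝ (Fin n)))
      (Ioc a b) ∧
    ∫ s in a..b, Prod.fst (velocity (IQ n) γ a b s : ℝ × EuclideanSpace ℝ (Fin n)) =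
      (γ b).1 - (γ a).1 := by
  have hcont : ContinuousOn (fun s ↦ ((γ s).1 : ℝ)) (Icc a b) :=
    fun s hs ↦ (h.hasDerivWithinAt hs).1.continuousWithinAt
  have hder : ∀ s ∈ Ioo a b, HasDerivAt (fun s ↦ ((γ s).1 : ℝ))
      (Prod.fst (velocity (IQ n) γ a b s : ℝ × EuclideanSpace ℝ (Fin n))) s := fun s hs ↦
    (h.hasDerivWithinAt (Ioo_subset_Icc_self hs)).1.hasDerivAt (Icc_mem_nhds hs.1 hs.2)
  have hint := intervalIntegral.integrableOn_deriv_of_nonneg hcont hder fun s hs ↦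
    ((h.2 s (Ioo_subset_Icc_self hs)).warpedMetric hn hf0).1.le
  exact ⟨hint, intervalIntegral.integral_eq_sub_of_hasDerivAt_of_le hab.le hcont hder
    ((intervalIntegrable_iff_integrableOn_Ioc_of_le hab.le).2 hint)⟩

theorem IsCausalArc.riemannDist_le (hn : 2 ≤ n) (hf0 : ∀ t, 0 < t → 0 < f t)
    {γ : ℝ → PosReal × S₀} {a b : ℝ} (hab : a < b)
    (h : IsCausalArc (warpedMetric σ.inner f) timeField γ a b) {K : ℝ} (hK : 0 ≤ K)
    (hfK : ∀ t ∈ Icc ((γ a).1 : ℝ) (γ b).1, timeCoeff n * (n - 1) / f t ≤ K ^ 2) :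
    riemannDist σ (γ a).2 (γ b).2 ≤ ENNReal.ofReal (K * ((γ b).1 - (γ a).1)) := by
  obtain ⟨h1, h2⟩ := h.integrable_velocity hn hf0 hab
  have hm := (h.time_lt hn hf0).monotoneOn
  have hv : ∀ s ∈ Icc a b, 0 < Prod.fst (velocity (IQ n) γ a b s : ℝ × EuclideanSpace ℝ (Fin n)) :=
    fun s hs ↦ ((h.2 s hs).warpedMetric hn hf0).1
  refine (riemannDist_le_lintegral σ hab.le (contMDiff_snd.comp_contMDiffOn h.1)
    (fun s hs ↦ (h.hasDerivWithinAt hs).2)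
    (C := fun s ↦ K * Prod.fst (velocity (IQ n) γ a b s : ℝ × EuclideanSpace ℝ (Fin n)))
    (fun s hs ↦ ?_) fun s hs ↦ mul_nonneg hK (hv s hs).le).trans (le_of_eq ?_)
  · refine ((h.2 s hs).warpedMetric hn hf0).2.trans ?_
    rw [mul_pow]
    exact mul_le_mul_of_nonneg_right (hfK _ ⟨hm (left_mem_Icc.2 hab.le) hs hs.1,
      hm hs (right_mem_Icc.2 hab.le) hs.2⟩) (sq_nonneg _)
  · rw [← restrict_Ioc_eq_restrict_Icc, ← ofReal_integral_eq_lintegral_ofReal (h1.const_mul K),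
      integral_const_mul, ← intervalIntegral.integral_of_le hab.le, h2]
    exact (ae_restrict_iff' measurableSet_Ioc).2 (ae_of_all _ fun s hs ↦
      mul_nonneg hK (hv s (Ioc_subset_Icc_self hs)).le)

/-- The spatial part of the velocity only reduces proper time, which is therefore at most `√c` times
the increase of `t`; as `t` is positive at the start, its final value bounds the increase. -/
theorem IsCausalArc.properTime_le (hn : 2 ≤ n) (hf0 : ∀ t, 0 < t → 0 < f t)
    {γ : ℝ → PosReal × S₀} {a b : ℝ} (hab : a < b)
    (h : IsCausalArc (warpedMetric σ.inner f) timeField γ a b) :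
    properTime (warpedMetric σ.inner f) γ a b ≤ √(timeCoeff n) * (γ b).1 := by
  obtain ⟨h1, h2⟩ := h.integrable_velocity hn hf0 hab
  have hn1 : (0 : ℝ) < n - 1 := by
    have : (2 : ℝ) ≤ n := by exact_mod_cast hn
    linarith
  have h3 : properTime (warpedMetric σ.inner f) γ a b ≤ ∫ s in a..b, √(timeCoeff n) *
      Prod.fst (velocity (IQ n) γ a b s : ℝ × EuclideanSpace ℝ (Fin n)) := by
    rw [properTime, intervalIntegral.integral_of_le hab.le, intervalIntegral.integral_of_le hab.le]
    refine integral_mono_of_nonneg (ae_of_all _ fun s ↦ Real.sqrt_nonneg _) (h1.const_mul _) ?_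
    refine (ae_restrict_iff' measurableSet_Ioc).2 (ae_of_all _ fun s hs ↦ ?_)
    set v : ℝ × EuclideanSpace ℝ (Fin n) := velocity (IQ n) γ a b s with hv
    have hv1 : 0 < v.1 := ((h.2 s (Ioc_subset_Icc_self hs)).warpedMetric hn hf0).1
    change √(-formAt (warpedMetric σ.inner f) (γ s) v v) ≤ √(timeCoeff n) * v.1
    rw [Real.sqrt_le_iff]
    refine ⟨by positivity, ?_⟩
    rw [mul_pow, Real.sq_sqrt (timeCoeff_pos hn).le, warpedMetric_apply]
    have h4 : 0 ≤ formAt σ.inner (γ s).2 v.2 v.2 := by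
      by_cases hv2 : v.2 = 0
      · rw [hv2]; simp
      · exact (σ.pos (γ s).2 v.2 hv2).le
    have := mul_nonneg (div_pos (hf0 _ (γ s).1.2) hn1).le h4
    linarith
  refine h3.trans ?_
  rw [intervalIntegral.integral_const_mul, h2]
  have : (0 : ℝ) < (γ a).1 := (γ a).1.2
  exact mul_le_mul_of_nonneg_left (by linarith) (Real.sqrt_nonneg _)

theorem IsInextendibleCausalCurve.strictMono (hn : 2 ≤ n) (hf0 : ∀ t, 0 < t → 0 < f t)
    {γ : ℝ → PosReal × S₀} (h : IsInextendibleCausalCurve (warpedMetric σ.inner f) timeField γ) :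
    StrictMono (fun s ↦ ((γ s).1 : ℝ)) := by
  obtain ⟨D, hD, harc⟩ := h.causal
  exact relation_of_arcs hD (R := fun a b ↦ ((γ a).1 : ℝ) < (γ b).1)
    (fun a b c _ _ ↦ lt_trans) fun a b hab hd ↦ (harc a b hab hd).time_lt hn hf0
      (left_mem_Icc.2 hab.le) (right_mem_Icc.2 hab.le) hab

theorem IsInextendibleCausalCurve.riemannDist_le (hn : 2 ≤ n) (hf0 : ∀ t, 0 < t → 0 < f t)
    {γ : ℝ → PosReal × S₀} (h : IsInextendibleCausalCurve (warpedMetric σ.inner f) timeField γ)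
    {K t₀ t₁ : ℝ} (hK : 0 ≤ K)
    (hfK : ∀ t ∈ Icc t₀ t₁, timeCoeff n * (n - 1) / f t ≤ K ^ 2) {a b : ℝ}
    (ha : ((γ a).1 : ℝ) ∈ Icc t₀ t₁) (hb : ((γ b).1 : ℝ) ∈ Icc t₀ t₁) :
    riemannDist σ (γ a).2 (γ b).2 ≤ ENNReal.ofReal (K * |((γ a).1 : ℝ) - (γ b).1|) := by
  obtain ⟨D, hD, harc⟩ := h.causal
  have hm := h.strictMono hn hf0
  have key : ∀ a b, a < b → t₀ ≤ ((γ a).1 : ℝ) → ((γ b).1 : ℝ) ≤ t₁ →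
      riemannDist σ (γ a).2 (γ b).2 ≤ ENNReal.ofReal (K * ((γ b).1 - (γ a).1)) := by
    refine relation_of_arcs hD (fun a b c hab hbc h1 h2 ha hc ↦ ?_) fun a b hab hd ha hb ↦ ?_
    · refine (riemannDist_triangle σ _ (γ b).2 _).trans ((add_le_add
        (h1 ha ((hm hbc).le.trans hc)) (h2 (ha.trans (hm hab).le) hc)).trans (le_of_eq ?_))
      rw [← ENNReal.ofReal_add (mul_nonneg hK (sub_nonneg.2 (hm hab).le))
        (mul_nonneg hK (sub_nonneg.2 (hm hbc).le))]
      congr 1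
      ring
    · exact (harc a b hab hd).riemannDist_le hn hf0 hab hK fun t ht ↦
        hfK t ⟨ha.trans ht.1, ht.2.trans hb⟩
  rcases lt_trichotomy a b with hab | rfl | hab
  · rw [abs_sub_comm, abs_of_pos (sub_pos.2 (hm hab))]
    exact key a b hab ha.1 hb.2
  · rw [riemannDist_self]; exact zero_le
  · rw [riemannDist_comm, abs_of_pos (sub_pos.2 (hm hab))]
    exact key b a hab hb.1 ha.2

/-- While `t` stays in a compact part of `(0, ∞)`, the distance covered in `S₀` is at most a
constant times the change of `t`. Convergence of `t` makes the projection Cauchy, and completeness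
yields an end point. The filter `k` is general so as to serve both ends of the curve. -/
theorem IsInextendibleCausalCurve.exists_tendsto [T2Space S₀] (hn : 2 ≤ n)
    (hσ : IsCompleteMetric σ)
    (hf : ContinuousOn f (Ioi 0)) (hf0 : ∀ t, 0 < t → 0 < f t)
    {γ : ℝ → PosReal × S₀} (h : IsInextendibleCausalCurve (warpedMetric σ.inner f) timeField γ)
    {k : Filter ℝ} [k.NeBot] [k.IsCountablyGenerated] {l : ℝ} (hl : 0 < l)
    (hk : Tendsto (fun s ↦ ((γ s).1 : ℝ)) k (𝓝 l)) : ∃ p, Tendsto γ k (𝓝 p) := by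
  have hc := timeCoeff_pos hn
  have hn1 : (0 : ℝ) < n - 1 := by
    have : (2 : ℝ) ≤ n := by exact_mod_cast hn
    linarith
  -- The window `[l/2, 2l]` is a compact neighbourhood of `l` in `(0, ∞)`, on which `1 / f` is
  -- bounded.
  obtain ⟨K, hK, hfK⟩ : ∃ K, 0 ≤ K ∧
      ∀ t ∈ Icc (l / 2) (2 * l), timeCoeff n * (n - 1) / f t ≤ K ^ 2 := by
    have hsub : Icc (l / 2) (2 * l) ⊆ Ioi 0 := fun t ht ↦ lt_of_lt_of_le (half_pos hl) ht.1
    obtain ⟨C, hC⟩ := isCompact_Icc.exists_bound_of_continuousOn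
      ((continuousOn_const (c := timeCoeff n * (n - 1))).div (hf.mono hsub)
        fun t ht ↦ (hf0 t (hsub ht)).ne')
    refine ⟨√(max C 0), Real.sqrt_nonneg _, fun t ht ↦ ?_⟩
    rw [Real.sq_sqrt (le_max_right _ _)]
    exact (le_abs_self _).trans ((hC t ht).trans (le_max_left _ _))
  have hwin : ∀ᶠ s in k, ((γ s).1 : ℝ) ∈ Icc (l / 2) (2 * l) :=
    hk (Icc_mem_nhds (by linarith) (by linarith))
  have hsmall : Tendsto (fun s ↦ ENNReal.ofReal (K * |((γ s).1 : ℝ) - l|)) k (𝓝 0) := by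
    have := ((hk.sub_const l).abs.const_mul K)
    simp only [sub_self, abs_zero, mul_zero] at this
    simpa using ENNReal.tendsto_ofReal this
  have hseq : ∀ u : ℕ → ℝ, Tendsto u atTop k → ∃ x, Tendsto (fun j ↦ (γ (u j)).2) atTop (𝓝 x) := by
    intro u hu
    refine hσ _ fun ε hε ↦ ?_
    obtain ⟨N, hN⟩ := eventually_atTop.1 ((hu.eventually hwin).and
      (hu.eventually (hsmall.eventually_lt_const (ENNReal.half_pos hε.ne'))))
    refine ⟨N, fun i hi j hj ↦ ?_⟩
    change riemannDist σ (γ (u i)).2 (γ (u j)).2 < ε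
    obtain ⟨h1, h2⟩ := hN i hi
    obtain ⟨h3, h4⟩ := hN j hj
    refine (h.riemannDist_le hn hf0 hK hfK h1 h3).trans_lt ?_
    calc ENNReal.ofReal (K * |((γ (u i)).1 : ℝ) - (γ (u j)).1|)
        ≤ ENNReal.ofReal (K * |((γ (u i)).1 : ℝ) - l| + K * |((γ (u j)).1 : ℝ) - l|) := by
          refine ENNReal.ofReal_le_ofReal ?_
          rw [← mul_add]
          refine mul_le_mul_of_nonneg_left ?_ hK
          rw [abs_sub_comm ((γ (u j)).1 : ℝ)]
          exact abs_sub_le _ _ _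
      _ ≤ _ := ENNReal.ofReal_add_le
      _ < ε / 2 + ε / 2 := ENNReal.add_lt_add h2 h4
      _ = ε := ENNReal.add_halves ε
  obtain ⟨w, hw⟩ := exists_seq_tendsto k
  obtain ⟨x, hx⟩ := hseq w hw
  refine ⟨(⟨l, hl⟩, x), Tendsto.prodMk_nhds (tendsto_subtype_rng.2 hk) ?_⟩
  refine tendsto_of_seq_tendsto fun u hu ↦ ?_
  -- Completeness gives a limit for each sequence separately; interleaving `u` with the reference
  -- sequence `w` shows that their limits coincide.
  let z : ℕ → ℝ := fun j ↦ if Even j then u (j / 2) else w (j / 2)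
  have hdiv : Tendsto (fun j : ℕ ↦ j / 2) atTop atTop :=
    Nat.tendsto_div_const_atTop (by norm_num)
  have hz : Tendsto z atTop k := (hu.comp hdiv).if' (hw.comp hdiv)
  obtain ⟨y, hy⟩ := hseq z hz
  have h2 : Tendsto (fun j : ℕ ↦ 2 * j) atTop atTop :=
    
    tendsto_atTop_mono (fun j ↦ by rw [id]; omega) tendsto_id
  have h3 : Tendsto (fun j : ℕ ↦ 2 * j + 1) atTop atTop := 
    tendsto_atTop_mono (fun j ↦ by rw [id]; omega) tendsto_id
  have hyu : Tendsto (fun j ↦ (γ (u j)).2) atTop (𝓝 y) :=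
    (hy.comp h2).congr fun j ↦ by simp [z]
  have hyw : Tendsto (fun j ↦ (γ (w j)).2) atTop (𝓝 y) :=
    (hy.comp h3).congr fun j ↦ by
      simp only [Function.comp_apply, z]
      rw [if_neg (by simp), show (2 * j + 1) / 2 = j by omega]
  rw [tendsto_nhds_unique hx hyw]
  exact hyu

/-- Strict monotonicity of `t` gives uniqueness and the intermediate value theorem existence: if `t`
had a finite limit at the future end, or a positive one at the past end, the curve would have an end
point there. -/
theorem isCauchyHypersurface_slice [T2Space S₀] (hn : 2 ≤ n) (hσ : IsCompleteMetric σ)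
    (hf : ContinuousOn f (Ioi 0)) (hf0 : ∀ t, 0 < t → 0 < f t) (t : PosReal) :
    IsCauchyHypersurface (warpedMetric σ.inner f) timeField (range (slice (S₀ := S₀) t)) := by
  intro γ h
  have hm := h.strictMono hn hf0
  have hcont : Continuous (fun s ↦ ((γ s).1 : ℝ)) :=
    continuous_subtype_val.comp (continuous_fst.comp h.continuous)
  have hmem : ∀ s, γ s ∈ range (slice (S₀ := S₀) t) ↔ ((γ s).1 : ℝ) = t := fun s ↦ by
    constructor
    · rintro ⟨x, hx⟩
      rw [← hx]
      rfl
    · intro hs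
      exact ⟨(γ s).2, Prod.ext (Subtype.ext hs.symm) rfl⟩
  have hge : ∃ s, (t : ℝ) ≤ (γ s).1 := by
    rcases tendsto_atTop_of_monotone hm.monotone with h1 | ⟨l, h1⟩
    · exact (h1.eventually_ge_atTop (t : ℝ)).exists
    · refine absurd (h.exists_tendsto hn hσ hf hf0 ?_ h1) h.no_future_end
      exact lt_of_lt_of_le (γ 0).1.2 (hm.monotone.ge_of_tendsto h1 0)
  have hle : ∃ s, ((γ s).1 : ℝ) ≤ t := by
    have hb : BddBelow (range fun s ↦ ((γ s).1 : ℝ)) := ⟨0, by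
      rintro _ ⟨s, rfl⟩
      exact (γ s).1.2.le⟩
    have h1 := tendsto_atBot_ciInf hm.monotone hb
    rcases (le_ciInf fun s ↦ (γ s).1.2.le : (0 : ℝ) ≤ ⨅ s, ((γ s).1 : ℝ)).lt_or_eq with h2 | h2
    · exact absurd (h.exists_tendsto hn hσ hf hf0 h2 h1) h.no_past_end
    · rw [← h2] at h1
      exact (h1.eventually_le_const t.2).exists
  obtain ⟨s, hs⟩ := mem_range_of_exists_le_of_exists_ge hcont hle hge
  refine ⟨s, (hmem s).2 hs, fun s' hs' ↦ hm.injective ?_⟩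
  exact ((hmem s').1 hs').trans hs.symm

theorem isGloballyHyperbolic_warpedMetric [T2Space S₀] (hn : 2 ≤ n) (hσ : IsCompleteMetric σ)
    (hf : ContDiffOn ℝ ∞ f (Ioi 0)) (hf0 : ∀ t, 0 < t → 0 < f t) :
    IsGloballyHyperbolic (warpedMetric σ.inner f) (timeField (S₀ := S₀)) where
  lorentz := isLorentzMetric_warpedMetric hn σ hf hf0
  timeOrientation := isTimeOrientation_warpedMetric hn σ.inner f
  cauchy := ⟨_, isCauchyHypersurface_slice hn hσ hf.continuousOn hf0 ⟨1, mem_Ioi.2 one_pos⟩⟩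

end Causality

end

end QuantizedGravity

namespace QuantizedGravity

noncomputable section

set_option linter.unusedSectionVars false
set_option maxSynthPendingDepth 3

/-! ### Curvature of warped products -/

section WarpedCurvature

variable {E : Type*} [NormedAddCommGroup E] [NormedSpace ℝ E] [FiniteDimensional ℝ E]
  {G : (ℝ × E) → (ℝ × E) →L[ℝ] (ℝ × E) →L[ℝ] ℝ} {B : E → E →L[ℝ] E →L[ℝ] ℝ} {V : Set E}
  {h : ℝ → ℝ} {c : ℝ}

theorem fderiv_apply_apply {F : Type*} [NormedAddCommGroup F] [NormedSpace ℝ F]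
    {G : F → F →L[ℝ] F →L[ℝ] ℝ} {z : F} (hG : DifferentiableAt ℝ G z) (u v w : F) :
    fderiv ℝ (fun z ↦ G z v w) z u = fderiv ℝ G z u v w := by
  have := (hG.hasFDerivAt.clm_apply (hasFDerivAt_const v z)).clm_apply (hasFDerivAt_const w z)
  rw [this.fderiv]
  simp

theorem isMetricOn_warpedForm (hB : IsMetricOn B V) (hc : c ≠ 0)
    (hh : ContDiffOn ℝ ∞ h (Ioi 0)) (hh0 : ∀ t, 0 < t → h t ≠ 0)
    (hG : ∀ z ∈ Ioi 0 ×ˢ V, G z = warpedForm c (h z.1) (B z.2)) :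
    IsMetricOn G (Ioi 0 ×ˢ V) where
  isOpen := isOpen_Ioi.prod hB.isOpen
  smooth := (contDiffOn_warpedForm hh hB.smooth).congr hG
  nondeg z hz := by
    rw [hG z hz]
    exact (hB.nondeg _ hz.2).warpedForm hc (hh0 _ hz.1)

theorem fderiv_warpedForm (hB : IsMetricOn B V) (hc : c ≠ 0)
    (hh : ContDiffOn ℝ ∞ h (Ioi 0)) (hh0 : ∀ t, 0 < t → h t ≠ 0)
    (hG : ∀ z ∈ Ioi 0 ×ˢ V, G z = warpedForm c (h z.1) (B z.2)) {z : ℝ × E}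
    (hz : z ∈ Ioi 0 ×ˢ V) (u v w : ℝ × E) :
    fderiv ℝ G z u v w =
      deriv h z.1 * u.1 * B z.2 v.2 w.2 + h z.1 * fderiv ℝ B z.2 u.2 v.2 w.2 := by
  have hGm := isMetricOn_warpedForm hB hc hh hh0 hG
  rw [← fderiv_apply_apply (hGm.differentiableAt hz)]
  have h1 : (fun z ↦ G z v w) =ᶠ[𝓝 z] fun z ↦ -c * (v.1 * w.1) + h z.1 * B z.2 v.2 w.2 := by
    filter_upwards [hGm.isOpen.mem_nhds hz] with z' hz'
    rw [hG z' hz', warpedForm_apply]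
  have h2 : HasFDerivAt (fun z : ℝ × E ↦ h z.1)
      ((ContinuousLinearMap.toSpanSingleton ℝ (deriv h z.1)).comp
        (ContinuousLinearMap.fst ℝ ℝ E)) z :=
    HasFDerivAt.comp z (((hh.contDiffAt (isOpen_Ioi.mem_nhds hz.1)).differentiableAt
      (by simp)).hasDerivAt.hasFDerivAt) hasFDerivAt_fst
  have h3 : HasFDerivAt (fun z : ℝ × E ↦ B z.2)
      ((fderiv ℝ B z.2).comp (ContinuousLinearMap.snd ℝ ℝ E)) z :=
    HasFDerivAt.comp z (hB.differentiableAt hz.2).hasFDerivAt hasFDerivAt_snd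
  have h4 : HasFDerivAt (fun z : ℝ × E ↦ -c * (v.1 * w.1) + h z.1 * B z.2 v.2 w.2) _ z :=
    ((h2.mul ((h3.clm_apply (hasFDerivAt_const v.2 z)).clm_apply
    (hasFDerivAt_const w.2 z))).const_add (-c * (v.1 * w.1)))
  rw [h1.fderiv_eq, h4.fderiv]
  simp
  ring

/-- By the Koszul formula, tested against all vectors: besides the symbols of `B` only those
containing `h'` occur, one with an upper time index and one with a lower. -/
theorem christoffelSymbol_warpedForm (hB : IsMetricOn B V) (hc : c ≠ 0)
    (hh : ContDiffOn ℝ ∞ h (Ioi 0)) (hh0 : ∀ t, 0 < t → h t ≠ 0)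
    (hG : ∀ z ∈ Ioi 0 ×ˢ V, G z = warpedForm c (h z.1) (B z.2)) {z : ℝ × E}
    (hz : z ∈ Ioi 0 ×ˢ V) (v w : ℝ × E) :
    christoffelSymbol G z v w = (deriv h z.1 / (2 * c) * B z.2 v.2 w.2,
      christoffelSymbol B z.2 v.2 w.2 + (deriv h z.1 / (2 * h z.1)) • (v.1 • w.2 + w.1 • v.2)) := by
  have hGm := isMetricOn_warpedForm hB hc hh hh0 hG
  have hhz := hh0 _ hz.1
  refine (hGm.nondeg z hz).ext fun y ↦ ?_
  rw [hGm.apply_christoffel hz, hG z hz, warpedForm_apply]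
  simp only [fderiv_warpedForm hB hc hh hh0 hG hz, map_add, map_smul, add_apply,
    smul_apply, smul_eq_mul, hB.apply_christoffel hz.2, (hB.nondeg _ hz.2).symm v.2 y.2]
  field_simp
  ring

/-- Only the spatial component is computed, since the sectional curvature pairs it with a spatial
vector. For spatial arguments no derivative in `t` occurs, and the extra term is a product of a
symbol with upper and one with lower time index. -/
theorem curvatureTensor_warpedForm (hB : IsMetricOn B V) (hc : c ≠ 0)
    (hh : ContDiffOn ℝ ∞ h (Ioi 0)) (hh0 : ∀ t, 0 < t → h t ≠ 0)
    (hG : ∀ z ∈ Ioi 0 ×ˢ V, G z = warpedForm c (h z.1) (B z.2)) {z : ℝ × E}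
    (hz : z ∈ Ioi 0 ×ˢ V) (u v w : E) :
    (curvatureTensor G z (0, u) (0, v) (0, w)).2 = curvatureTensor B z.2 u v w
      + (deriv h z.1 ^ 2 / (4 * c * h z.1)) • (B z.2 v w • u - B z.2 u w • v) := by
  have hGm := isMetricOn_warpedForm hB hc hh hh0 hG
  have hΓ := fun v w ↦ christoffelSymbol_warpedForm hB hc hh hh0 hG hz v w
  have hd : ∀ u v w : E, (fderiv ℝ (fun z ↦ christoffelSymbol G z (0, v) (0, w)) z (0, u)).2 =
      fderiv ℝ (fun y ↦ christoffelSymbol B y v w) z.2 u := fun u v w ↦ by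
    have h1 := (hGm.hasFDerivAt_christoffel hz (0, v) (0, w)).snd
    have h2 : HasFDerivAt (fun z : ℝ × E ↦ christoffelSymbol B z.2 v w) _ z :=
      HasFDerivAt.comp z (hB.hasFDerivAt_christoffel hz.2 v w) hasFDerivAt_snd
    have h3 : (fun z ↦ (christoffelSymbol G z (0, v) (0, w)).2) =ᶠ[𝓝 z]
        fun z : ℝ × E ↦ christoffelSymbol B z.2 v w := by
      filter_upwards [hGm.isOpen.mem_nhds hz] with z' hz'
      rw [christoffelSymbol_warpedForm hB hc hh hh0 hG hz']
      simp
    rw [(hGm.hasFDerivAt_christoffel hz (0, v) (0, w)).fderiv,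
      (hB.hasFDerivAt_christoffel hz.2 v w).fderiv]
    exact congrArg (fun L ↦ L (0, u)) (h1.unique (h2.congr_of_eventuallyEq h3))
  simp only [curvatureTensor, Prod.snd_add, Prod.snd_sub, hd, hΓ, zero_smul, add_zero, smul_zero,
    zero_add]
  have hhz := hh0 _ hz.1
  simp only [← christoffelL_apply]
  have : deriv h z.1 ^ 2 / (4 * c * h z.1) =
      deriv h z.1 / (2 * h z.1) * (deriv h z.1 / (2 * c)) := by field_simp; norm_num
  rw [this]
  module

end WarpedCurvature

/-! ### The big bang -/

section BigBang

variable {n : ℕ} {S₀ : Type*} [TopologicalSpace S₀]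
  [ChartedSpace (EuclideanSpace ℝ (Fin n)) S₀] [IsManifold (IS n) ∞ S₀]

/-- Strict Cauchy-Schwarz: `σ` is evaluated on `σ(w, w) v - σ(v, w) w`, which is nonzero by
independence. -/
theorem gram_pos (σ : RiemannMetric n S₀) {x : S₀} {v w : EuclideanSpace ℝ (Fin n)}
    (h : LinearIndependent ℝ ![v, w]) : 0 < formAt σ.inner x v v * formAt σ.inner x w w -
      formAt σ.inner x v w ^ 2 := by
  have hpos : ∀ v : EuclideanSpace ℝ (Fin n), v ≠ 0 → 0 < formAt σ.inner x v v := σ.pos x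
  have hsymm : ∀ v w : EuclideanSpace ℝ (Fin n), formAt σ.inner x v w = formAt σ.inner x w v :=
    σ.symm x
  have hw : w ≠ 0 := h.ne_zero 1
  have hww := hpos w hw
  have hu : formAt σ.inner x w w • v - formAt σ.inner x v w • w ≠ 0 := fun h0 ↦ by
    have := (LinearIndependent.pair_iff.1 h) (formAt σ.inner x w w) (-formAt σ.inner x v w)
      (by rw [neg_smul, ← sub_eq_add_neg]; exact h0)
    exact hww.ne' this.1
  have h1 := hpos _ hu
  simp only [map_sub, map_smul, sub_apply, smul_apply, smul_eq_mul, hsymm w v] at h1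
  refine pos_of_mul_pos_right (a := formAt σ.inner x w w) ?_ hww.le
  linarith

/-- Scaling a metric by a constant divides sectional curvatures by it, and the Gram determinant of
the plane cancels from the term with the square of `f'`. -/
theorem sectionalCurvature_warpedMetric (hn : 2 ≤ n) (σ : RiemannMetric n S₀) {f : ℝ → ℝ}
    (hf : ContDiffOn ℝ ∞ f (Ioi 0)) (hf0 : ∀ t, 0 < t → 0 < f t) (t : PosReal) (x : S₀)
    {v w : EuclideanSpace ℝ (Fin n)} (hvw : LinearIndependent ℝ ![v, w]) :
    sectionalCurvature (warpedMetric σ.inner f) (t, x) (spatial (t, x) v) (spatial (t, x) w) =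
      (n - 1) / f t * sectionalCurvature σ.inner x v w +
        (deriv f t / f t) ^ 2 / (4 * timeCoeff n) := by
  have hn1 : (0 : ℝ) < n - 1 := by
    have : (2 : ℝ) ≤ n := by exact_mod_cast hn
    linarith
  have hc := timeCoeff_pos hn
  have hft := hf0 t t.2
  have hD := gram_pos (x := x) σ hvw
  set p : PosReal × S₀ := (t, x) with hp
  have hz : extChartAt (IQ n) p p ∈ Ioi (0 : ℝ) ×ˢ (extChartAt (IS n) x).target := by
    rw [← extChartAt_spacetime_target p]
    exact mem_extChartAt_target p
  have hzp := extChartAt_spacetime_apply (n := n) p p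
  have key := curvatureTensor_warpedForm (isPseudoRiemannian_inner σ x) hc.ne'
    (hf.div_const ((n : ℝ) - 1)) (fun t ht ↦ (div_pos (hf0 t ht) hn1).ne')
    (G := localMetric (warpedMetric σ.inner f) p)
    (fun z hz ↦ localMetric_warpedMetric σ.inner f p
      (by rw [extChartAt_spacetime_target]; exact hz)) hz v w w
  rw [deriv_div_const] at key
  have hz1 : (extChartAt (IQ n) p p).1 = t := by rw [hzp]
  have hz2 : (extChartAt (IQ n) p p).2 = extChartAt (IS n) x x := by rw [hzp]
  rw [hz1, hz2, localMetric_self] at key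
  have h1 : formAt (warpedMetric σ.inner f) p (curvature (warpedMetric σ.inner f) p (0, v) (0, w)
      (0, w)) (0, v) = f t / (n - 1) * (formAt σ.inner x (curvature σ.inner x v w w) v +
        (deriv f t / (n - 1)) ^ 2 / (4 * timeCoeff n * (f t / (n - 1))) *
          (formAt σ.inner x v v * formAt σ.inner x w w - formAt σ.inner x v w ^ 2)) := by
    have hsymm : formAt σ.inner x w v = formAt σ.inner x v w := σ.symm x w v
    rw [warpedMetric_apply, curvature_eq, key, curvature_eq, show p.1 = t from rfl,
      show p.2 = x from rfl]
    simp only [map_add, map_sub, map_smul, add_apply, sub_apply, smul_apply, smul_eq_mul, hsymm]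
    simp only [mul_zero, zero_add]
    ring
  have h2 : ∀ v w : EuclideanSpace ℝ (Fin n),
      formAt (warpedMetric σ.inner f) p (0, v) (0, w) = f t / (n - 1) * formAt σ.inner x v w :=
    fun v w ↦ by rw [warpedMetric_apply]; simp [hp]
  have h3 : sectionalCurvature (warpedMetric σ.inner f) p (spatial p v) (spatial p w) =
      formAt (warpedMetric σ.inner f) p (curvature (warpedMetric σ.inner f) p (0, v) (0, w)
        (0, w)) (0, v) / (formAt (warpedMetric σ.inner f) p (0, v) (0, v) *
        formAt (warpedMetric σ.inner f) p (0, w) (0, w) -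
        formAt (warpedMetric σ.inner f) p (0, v) (0, w) ^ 2) := rfl
  have h4 : sectionalCurvature σ.inner x v w = formAt σ.inner x (curvature σ.inner x v w w) v /
      (formAt σ.inner x v v * formAt σ.inner x w w - formAt σ.inner x v w ^ 2) := rfl
  rw [h3, h1, h2, h2, h2, h4]
  have e : f t / (n - 1) * formAt σ.inner x v v * (f t / (n - 1) * formAt σ.inner x w w) -
      (f t / (n - 1) * formAt σ.inner x v w) ^ 2 = (f t / (n - 1)) ^ 2 *
      (formAt σ.inner x v v * formAt σ.inner x w w - formAt σ.inner x v w ^ 2) := by ring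
  rw [e]
  generalize formAt σ.inner x v v * formAt σ.inner x w w - formAt σ.inner x v w ^ 2 = d at hD ⊢
  field_simp

theorem mfderiv_slice (t : PosReal) (x : S₀) (v : EuclideanSpace ℝ (Fin n)) :
    (mfderiv (IS n) (IQ n) (slice t) x : EuclideanSpace ℝ (Fin n) →L[ℝ]
      ℝ × EuclideanSpace ℝ (Fin n)) v = (0, v) := by
  have h : HasMFDerivAt (IS n) (IQ n) (slice (S₀ := S₀) t) x
      ((0 : EuclideanSpace ℝ (Fin n) →L[ℝ] ℝ).prod (ContinuousLinearMap.id ℝ _)) :=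
    (hasMFDerivAt_const t x).prodMk (hasMFDerivAt_id x)
  exact congrArg (fun L : EuclideanSpace ℝ (Fin n) →L[ℝ] ℝ × EuclideanSpace ℝ (Fin n) ↦ L v)
    h.mfderiv

theorem formAt_inducedMetric_slice (σ : TwoTensor (IS n) S₀) (f : ℝ → ℝ) (t : PosReal) (x : S₀) :
    formAt (inducedMetric (IS n) (warpedMetric σ f) (slice t)) x =
      (f t / ((n : ℝ) - 1)) • formAt σ x := by
  refine ContinuousLinearMap.ext fun v ↦ ContinuousLinearMap.ext fun w ↦ ?_
  have h : formAt (inducedMetric (IS n) (warpedMetric σ f) (slice t)) x v w =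
      formAt (warpedMetric σ f) (t, x)
        ((mfderiv (IS n) (IQ n) (slice t) x : EuclideanSpace ℝ (Fin n) →L[ℝ]
          ℝ × EuclideanSpace ℝ (Fin n)) v)
        ((mfderiv (IS n) (IQ n) (slice t) x : EuclideanSpace ℝ (Fin n) →L[ℝ]
          ℝ × EuclideanSpace ℝ (Fin n)) w) := rfl
  rw [h, mfderiv_slice, mfderiv_slice, warpedMetric_apply]
  simp

theorem christoffelSymbol_const_smul {E : Type*} [NormedAddCommGroup E] [NormedSpace ℝ E]
    [FiniteDimensional ℝ E] {B : E → E →L[ℝ] E →L[ℝ] ℝ} {V : Set E} (hB : IsMetricOn B V) {k : ℝ}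
    (hk : k ≠ 0) {y : E} (hy : y ∈ V) (v w : E) :
    christoffelSymbol (fun y ↦ k • B y) y v w = christoffelSymbol B y v w := by
  have hkB : IsMetricOn (fun y ↦ k • B y) V := ⟨hB.isOpen, hB.smooth.const_smul k, fun y hy ↦
    isNondegForm_of_injective (fun v w ↦ by simp [(hB.nondeg y hy).symm v w]) fun v hv ↦
      (hB.nondeg y hy).ext fun z ↦ by simpa [hk] using hv z⟩
  refine (hkB.nondeg y hy).ext fun z ↦ ?_
  rw [hkB.apply_christoffel hy]
  have : fderiv ℝ (fun y ↦ k • B y) y = k • fderiv ℝ B y :=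
    fderiv_fun_const_smul (hB.differentiableAt hy) k
  simp only [this, smul_apply, smul_eq_mul, hB.apply_christoffel hy]
  ring

/-- In charts the slice is `y ↦ (t, y)`, with vanishing second derivatives. The induced Christoffel
symbols are those of `σ`, since constant factors do not change them; they cancel the spatial part of
the ambient ones, and a multiple of `∂/∂t` remains. -/
theorem secondCovariantDerivative_slice (hn : 2 ≤ n) {σ : TwoTensor (IS n) S₀}
    (hσ : IsPseudoRiemannian σ) {f : ℝ → ℝ}
    (hf : ContDiffOn ℝ ∞ f (Ioi 0)) (hf0 : ∀ t, 0 < t → 0 < f t) (t : PosReal) (x : S₀)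
    (v w : EuclideanSpace ℝ (Fin n)) :
    secondCovariantDerivative (IS n) (warpedMetric σ f) (slice t) x v w =
      (deriv f t / (n - 1) / (2 * timeCoeff n) * formAt σ x v w, 0) := by
  have hn1 : (0 : ℝ) < n - 1 := by
    have : (2 : ℝ) ≤ n := by exact_mod_cast hn
    linarith
  have hc := timeCoeff_pos hn
  have hy := mem_extChartAt_target (I := IS n) x
  set y := extChartAt (IS n) x x with hy_def
  have hF : (fun z ↦ extChartAt (IQ n) (slice t x) (slice t ((extChartAt (IS n) x).symm z))) =ᶠ[𝓝 y]
      fun z ↦ ((t : ℝ), z) := by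
    filter_upwards [(isOpen_extChartAt_target x).mem_nhds hy] with z hz
    rw [extChartAt_spacetime_apply]
    simp only [slice]
    rw [(extChartAt (IS n) x).right_inv hz]
  have hd : ∀ z : EuclideanSpace ℝ (Fin n), fderiv ℝ (fun z : EuclideanSpace ℝ (Fin n) ↦
      ((t : ℝ), z)) z = ContinuousLinearMap.inr ℝ ℝ _ := fun z ↦
    ((hasFDerivAt_const (t : ℝ) z).prodMk (hasFDerivAt_id z)).fderiv
  have hd' : fderiv ℝ (fun z : EuclideanSpace ℝ (Fin n) ↦ ((t : ℝ), z)) =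
      fun _ ↦ ContinuousLinearMap.inr ℝ ℝ _ := funext hd
  have hchr : christoffel (inducedMetric (IS n) (warpedMetric σ f) (slice t)) x y v w =
      christoffelSymbol (localMetric σ x) y v w := by
    rw [christoffel_eq, ← christoffelSymbol_const_smul (hσ x)
      (div_pos (hf0 t t.2) hn1).ne' hy]
    congr 1
    funext z
    rw [localMetric_eq, formAt_inducedMetric_slice]
    rfl
  have hz : ((t : ℝ), y) ∈ Ioi (0 : ℝ) ×ˢ (extChartAt (IS n) x).target := ⟨t.2, hy⟩
  have hg : christoffel (warpedMetric σ f) (slice t x) ((t : ℝ), y) (0, v) (0, w) =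
      (deriv f t / (n - 1) / (2 * timeCoeff n) * formAt σ x v w,
        christoffelSymbol (localMetric σ x) y v w) := by
    rw [christoffel_eq, christoffelSymbol_warpedForm (hσ x) hc.ne' (hf.div_const ((n : ℝ) - 1))
      (fun t ht ↦ (div_pos (hf0 t ht) hn1).ne')
      (fun z hz ↦ localMetric_warpedMetric σ f (slice t x)
        (by rw [extChartAt_spacetime_target]; exact hz)) hz, deriv_div_const]
    simp only [hy_def, localMetric_self]
    simp
  have hval : extChartAt (IQ n) (slice t x) (slice t ((extChartAt (IS n) x).symm y)) =
      ((t : ℝ), y) := hF.eq_of_nhds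
  simp only [secondCovariantDerivative]
  rw [← hy_def, hF.fderiv.fderiv_eq, hF.fderiv_eq, hd', hval, hchr]
  simp only [ContinuousLinearMap.inr_apply, hg]
  simp

theorem secondFundamentalForm_slice (hn : 2 ≤ n) {σ : TwoTensor (IS n) S₀}
    (hσ : IsPseudoRiemannian σ) {f : ℝ → ℝ}
    (hf : ContDiffOn ℝ ∞ f (Ioi 0)) (hf0 : ∀ t, 0 < t → 0 < f t) (t : PosReal)
    {ν : ∀ x : S₀, TangentSpace (IQ n) (slice t x)} (x : S₀)
    (hν : ν x = ((-(√(timeCoeff n))⁻¹, 0) : ℝ × EuclideanSpace ℝ (Fin n)))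
    (v w : EuclideanSpace ℝ (Fin n)) :
    secondFundamentalForm (IS n) (warpedMetric σ f) (slice t) ν x v w =
      -(deriv f t / (n - 1) / (2 * √(timeCoeff n))) * formAt σ x v w := by
  have hc := timeCoeff_pos hn
  have h : secondFundamentalForm (IS n) (warpedMetric σ f) (slice t) ν x v w =
      -formAt (warpedMetric σ f) (slice t x)
        (secondCovariantDerivative (IS n) (warpedMetric σ f) (slice t) x v w)
        (-(√(timeCoeff n))⁻¹, 0) := by
    rw [← hν]; rfl
  rw [h, secondCovariantDerivative_slice hn hσ hf hf0, warpedMetric_apply]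
  simp only [map_zero, mul_zero, add_zero]
  have h1 := Real.sqrt_pos.2 hc
  have h2 := Real.mul_self_sqrt hc.le
  generalize √(timeCoeff n) = s at *
  rw [← h2]
  field_simp

theorem metricTrace_smul_self {E : Type*} [NormedAddCommGroup E] [NormedSpace ℝ E]
    [FiniteDimensional ℝ E] {B : E →L[ℝ] E →L[ℝ] ℝ} (hB : IsNondegForm B) {k : ℝ} (hk : k ≠ 0)
    (l : ℝ) : metricTrace (k • B) (fun v w ↦ l * B v w) = l / k * Module.finrank ℝ E := by
  have hkB : IsNondegForm (k • B) :=
    isNondegForm_of_injective (fun v w ↦ by simp [hB.symm v w]) fun v hv ↦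
      hB.ext fun z ↦ by simpa [hk] using hv z
  have h : ∀ i, l * B (Module.finBasis ℝ E i) (reciprocal (k • B) i) = l / k := fun i ↦ by
    have := hkB.apply_inverse' (LinearMap.toContinuousLinearMap ((Module.finBasis ℝ E).coord i))
      (Module.finBasis ℝ E i)
    rw [smul_apply, smul_apply, smul_eq_mul] at this
    change k * B (Module.finBasis ℝ E i) (reciprocal (k • B) i) = _ at this
    simp at this
    field_simp
    linear_combination l * this
  simp only [metricTrace, h]
  simp [mul_comm]

theorem meanCurvature_slice (hn : 2 ≤ n) {σ : TwoTensor (IS n) S₀}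
    (hσ : IsPseudoRiemannian σ) {f : ℝ → ℝ}
    (hf : ContDiffOn ℝ ∞ f (Ioi 0)) (hf0 : ∀ t, 0 < t → 0 < f t) (t : PosReal)
    {ν : ∀ x : S₀, TangentSpace (IQ n) (slice t x)} (x : S₀)
    (hν : ν x = ((-(√(timeCoeff n))⁻¹, 0) : ℝ × EuclideanSpace ℝ (Fin n))) :
    meanCurvature (IS n) (warpedMetric σ f) (slice t) ν x =
      -(deriv f t / f t) / (2 * √(timeCoeff n)) * n := by
  have hn1 : (0 : ℝ) < n - 1 := by
    have : (2 : ℝ) ≤ n := by exact_mod_cast hn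
    linarith
  have hft := hf0 t t.2
  have hB : IsNondegForm (formAt σ x) := by
    rw [← localMetric_self]
    exact (hσ x).nondeg _ (mem_extChartAt_target x)
  have h : secondFundamentalForm (IS n) (warpedMetric σ f) (slice t) ν x = fun v w ↦
      -(deriv f t / (n - 1) / (2 * √(timeCoeff n))) * formAt σ x v w :=
    funext fun v ↦ funext fun w ↦ secondFundamentalForm_slice hn hσ hf hf0 t x hν v w
  rw [meanCurvature, h, formAt_inducedMetric_slice, metricTrace_smul_self hB (div_pos hft hn1).ne',
    finrank_euclideanSpace_fin]
  have h1 := Real.sqrt_pos.2 (timeCoeff_pos hn)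
  field_simp

theorem isUmbilical_slice (hn : 2 ≤ n) {σ : TwoTensor (IS n) S₀}
    (hσ : IsPseudoRiemannian σ) {f : ℝ → ℝ}
    (hf : ContDiffOn ℝ ∞ f (Ioi 0)) (hf0 : ∀ t, 0 < t → 0 < f t) (t : PosReal)
    {ν : ∀ x : S₀, TangentSpace (IQ n) (slice t x)}
    (hν : ∀ x, ν x = ((-(√(timeCoeff n))⁻¹, 0) : ℝ × EuclideanSpace ℝ (Fin n))) :
    IsUmbilical (IS n) (warpedMetric σ f) (slice t) ν := by
  intro x
  have hn1 : (0 : ℝ) < n - 1 := by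
    have : (2 : ℝ) ≤ n := by exact_mod_cast hn
    linarith
  have hn0 : (0 : ℝ) < n := by linarith
  have hft := hf0 t t.2
  have key : ∀ v w : EuclideanSpace ℝ (Fin n),
      secondFundamentalForm (IS n) (warpedMetric σ f) (slice t) ν x v w =
      meanCurvature (IS n) (warpedMetric σ f) (slice t) ν x /
        Module.finrank ℝ (EuclideanSpace ℝ (Fin n)) *
        formAt (inducedMetric (IS n) (warpedMetric σ f) (slice t)) x v w := fun v w ↦ by
    rw [meanCurvature_slice hn hσ hf hf0 t x (hν x),
      secondFundamentalForm_slice hn hσ hf hf0 t x (hν x), formAt_inducedMetric_slice,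
      finrank_euclideanSpace_fin]
    have h1 := Real.sqrt_pos.2 (timeCoeff_pos hn)
    simp only [smul_apply, smul_eq_mul]
    field_simp
  exact key

theorem isPastUnitNormal_slice (hn : 2 ≤ n) (σ : TwoTensor (IS n) S₀) (f : ℝ → ℝ) (t : PosReal)
    {ν : ∀ x : S₀, TangentSpace (IQ n) (slice t x)}
    (hν : ∀ x, ν x = ((-(√(timeCoeff n))⁻¹, 0) : ℝ × EuclideanSpace ℝ (Fin n))) :
    IsPastUnitNormal (IS n) (warpedMetric σ f) timeField (slice t) ν := by
  intro x
  have hc := timeCoeff_pos hn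
  have h1 := Real.sqrt_pos.2 hc
  have h2 := Real.mul_self_sqrt hc.le
  rw [hν x]
  refine ⟨?_, ?_, fun v ↦ ?_⟩
  · change formAt (warpedMetric σ f) (slice t x) (-(√(timeCoeff n))⁻¹, 0)
      (-(√(timeCoeff n))⁻¹, 0) = -1
    rw [warpedMetric_apply]
    simp only [map_zero, mul_zero, add_zero]
    generalize √(timeCoeff n) = s at *
    rw [← h2]
    field_simp
  · change 0 < formAt (warpedMetric σ f) (slice t x) (1, 0) (-(√(timeCoeff n))⁻¹, 0)
    rw [warpedMetric_apply]
    simp only [map_zero, mul_zero, add_zero, one_mul, neg_mul_neg]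
    positivity
  · have key : ∀ w : ℝ × EuclideanSpace ℝ (Fin n), w.1 = 0 → formAt (warpedMetric σ f) (slice t x)
        (-(√(timeCoeff n))⁻¹, 0) w = 0 := fun w hw ↦ by
      rw [warpedMetric_apply, hw]
      simp
    exact key _ (congrArg Prod.fst (mfderiv_slice t x v))

/-- The past directed unit normal of the slices. -/
def sliceNormal (t : PosReal) (x : S₀) : TangentSpace (IQ n) (slice t x) :=
  ((-(√(timeCoeff n))⁻¹, 0) : ℝ × EuclideanSpace ℝ (Fin n))

theorem hasBigBang_warpedMetric [T2Space S₀] (hn : 3 ≤ n) {σ : RiemannMetric n S₀}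
    (hσ : IsCompleteMetric σ) :
    HasBigBang (warpedMetric σ.inner fun t ↦ t ^ (4 / (n : ℝ) - 2)) := by
  have hn2 : 2 ≤ n := by omega
  have hn3 : (3 : ℝ) ≤ n := by exact_mod_cast hn
  have hc := timeCoeff_pos hn2
  have hσ' := isPseudoRiemannian_inner σ
  set r : ℝ := 4 / (n : ℝ) - 2 with hr
  have hr0 : r < 0 := by
    rw [hr, sub_neg, div_lt_iff₀ (by linarith)]
    linarith
  have hf : ContDiffOn ℝ ∞ (fun t : ℝ ↦ t ^ r) (Ioi 0) := fun t ht ↦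
    (Real.contDiffAt_rpow_const_of_ne (ne_of_gt ht)).contDiffWithinAt
  have hf0 : ∀ t : ℝ, 0 < t → 0 < t ^ r := fun t ht ↦ Real.rpow_pos_of_pos ht r
  have hlog : ∀ t : ℝ, 0 < t → deriv (fun t : ℝ ↦ t ^ r) t / t ^ r = r / t := fun t ht ↦ by
    rw [(Real.hasDerivAt_rpow_const (Or.inl ht.ne')).deriv, Real.rpow_sub_one ht.ne']
    have := (hf0 t ht).ne'
    field_simp
  refine ⟨isCauchyHypersurface_slice hn2 hσ hf.continuousOn hf0, fun t₀ ↦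
    ⟨√(timeCoeff n) * t₀, fun γ a b hab h ht ↦ (h.properTime_le hn2 hf0 hab).trans
      (mul_le_mul_of_nonneg_left ht (Real.sqrt_nonneg _))⟩,
    ⟨fun t x ↦ sliceNormal t x,
      fun t ↦ isPastUnitNormal_slice hn2 _ _ t fun x ↦ rfl,
      fun t ↦ isUmbilical_slice hn2 hσ' hf hf0 t fun x ↦ rfl, fun C ↦ ?_⟩, fun x v w hvw ↦ ?_⟩
  -- The squared mean curvature is `r² n² / (4 c t²)`, and `ε` is obtained by solving for `t`. The
  -- number `|C| + 1` keeps the divisor positive, and the factor `1/2` in the witness makes the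
  -- inequality strict.
  · obtain ⟨ε, hε, hεC⟩ : ∃ ε > 0, ε ^ 2 * (4 * timeCoeff n * (|C| + 1)) < r ^ 2 * n ^ 2 := by
      have h1 : 0 < r ^ 2 * (n : ℝ) ^ 2 := by
        have := hr0.ne
        positivity
      have h2 : 0 < 4 * timeCoeff n * (|C| + 1) := by positivity
      have := hr0.ne
      refine ⟨√(r ^ 2 * n ^ 2 / (4 * timeCoeff n * (|C| + 1)) / 2), by positivity, ?_⟩
      rw [Real.sq_sqrt (by positivity)]
      rw [div_right_comm, div_mul_cancel₀ _ h2.ne']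
      exact half_lt_self h1
    refine ⟨ε, hε, fun t ht x ↦ ?_⟩
    have ht0 : (0 : ℝ) < t := t.2
    rw [meanCurvature_slice hn2 hσ' hf hf0 t (ν := fun x ↦ sliceNormal t x) x rfl, hlog t ht0]
    have h1 : (-(r / (t : ℝ)) / (2 * √(timeCoeff n)) * n) ^ 2 =
        r ^ 2 * n ^ 2 / (t ^ 2 * (4 * timeCoeff n)) := by
      rw [mul_pow, div_pow, mul_pow, Real.sq_sqrt hc.le, neg_sq, div_pow]
      field_simp
      norm_num
    rw [h1, lt_div_iff₀ (by positivity)]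
    refine lt_of_le_of_lt ?_ hεC
    have h3 : (t : ℝ) ^ 2 ≤ ε ^ 2 := by gcongr
    calc C * (t ^ 2 * (4 * timeCoeff n)) ≤ (|C| + 1) * (t ^ 2 * (4 * timeCoeff n)) := by
          gcongr
          exact (le_abs_self C).trans (by linarith)
      _ ≤ (|C| + 1) * (ε ^ 2 * (4 * timeCoeff n)) := by gcongr
      _ = _ := by ring
  · have h1 : ∀ t : PosReal, sectionalCurvature (warpedMetric σ.inner fun t ↦ t ^ r) (t, x)
        (spatial (t, x) v) (spatial (t, x) w) =
        ((n : ℝ) - 1) * sectionalCurvature σ.inner x v w * (t : ℝ) ^ (-r) +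
          r ^ 2 / (4 * timeCoeff n) * ((t : ℝ)⁻¹) ^ 2 := fun t ↦ by
      have ht0 : (0 : ℝ) < t := t.2
      rw [sectionalCurvature_warpedMetric hn2 σ hf hf0 t x hvw, hlog t ht0,
        Real.rpow_neg ht0.le]
      field_simp
    simp only [h1]
    -- On the half line, tending to `0` means tending to `0` from the right.
    have hle : comap (Subtype.val : PosReal → ℝ) (𝓝 0) = comap Subtype.val (𝓝[>] 0) := by
      rw [nhdsWithin, comap_inf, comap_principal]
      have : (Subtype.val : PosReal → ℝ) ⁻¹' Ioi 0 = univ := eq_univ_of_forall fun t ↦ t.2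
      rw [this, principal_univ, inf_top_eq]
    -- Since `-r` is positive, the curvature of `σ` is damped out, while the other term grows like
    -- `t⁻²`.
    have h2 : Tendsto (fun t : ℝ ↦ ((n : ℝ) - 1) * sectionalCurvature σ.inner x v w * t ^ (-r) +
        r ^ 2 / (4 * timeCoeff n) * (t⁻¹) ^ 2) (𝓝[>] 0) atTop := by
      have h3 : Tendsto (fun t : ℝ ↦ t ^ (-r)) (𝓝[>] 0) (𝓝 0) := by
        have := (Real.continuousAt_rpow_const 0 (-r) (Or.inr (by linarith))).tendsto
        rw [Real.zero_rpow (by linarith)] at this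
        exact this.mono_left nhdsWithin_le_nhds
      refine Tendsto.add_atTop (h3.const_mul _) ?_
      exact (((tendsto_pow_atTop (by norm_num)).comp tendsto_inv_nhdsGT_zero).const_mul_atTop
        (by have := hr0.ne; positivity))
    rw [hle]
    exact h2.comp tendsto_comap

end BigBang

end

end QuantizedGravity

namespace QuantizedGravity

noncomputable section

set_option linter.unusedSectionVars false
set_option maxSynthPendingDepth 3

/-! ### The divergence form of the Laplacian -/

section Divergence

/-- `det (1 + r M) = 1 + r tr M + r² p(r)` with a polynomial `p`. -/
theorem hasDerivAt_det_one_add_smul {ι : Type*} [Fintype ι] [DecidableEq ι] (M : Matrix ι ι ℝ) :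
    HasDerivAt (fun r : ℝ ↦ (1 + r • M).det) M.trace 0 := by
  rw [funext fun r : ℝ ↦ Matrix.det_one_add_smul r M]
  set p := (Matrix.det (1 + (Polynomial.X : Polynomial ℝ) • M.map Polynomial.C)).divX.divX
  have h1 := (p.hasDerivAt (0 : ℝ)).mul (hasDerivAt_pow 2 (0 : ℝ))
  have h2 : HasDerivAt (fun r : ℝ ↦ 1 + M.trace * r + p.eval r * r ^ 2) _ 0 :=
    (((hasDerivAt_id (0 : ℝ)).const_mul M.trace).const_add 1).add h1
  exact h2.congr_deriv (by simp)

variable {E : Type*} [NormedAddCommGroup E] [NormedSpace ℝ E] [FiniteDimensional ℝ E]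

/-- Factoring out the Gram matrix of `B` reduces the variation of the determinant to one at the
identity matrix. -/
theorem gram_add_smul {ι : Type*} [Fintype ι] [DecidableEq ι] (b : Module.Basis ι ℝ E)
    {B : E →L[ℝ] E →L[ℝ] ℝ} (hB : IsNondegForm B) (r : ℝ) (T : E →L[ℝ] E →L[ℝ] ℝ) :
    gram b (B + r • T) =
      gram b B * (1 + r • Matrix.of fun k j ↦ T (B.inverse (coordL b k)) (b j)) := by
  rw [mul_add, mul_one, Matrix.mul_smul]
  ext i j
  have h : ∑ k, B (b i) (b k) • B.inverse (coordL b k) = b i := by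
    conv_rhs => rw [← hB.inv.inverse_apply_self (b i)]
    rw [← Finset.sum_congr rfl fun k _ ↦ map_smul _ _ _, ← map_sum]
    congr 1
    ext v
    conv_rhs => rw [← sum_coordL_smul b v]
    simp only [sum_apply, smul_apply, map_sum, map_smul, smul_eq_mul, mul_comm]
  simp only [gram, Matrix.of_apply, add_apply, smul_apply, smul_eq_mul, Matrix.add_apply,
    Matrix.smul_apply, Matrix.mul_apply]
  congr 2
  conv_lhs => rw [← h]
  simp

/-- Jacobi's formula. The determinant is polynomial in the form, hence differentiable, and the
derivative is read off along lines. -/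
theorem fderiv_det_gram {ι : Type*} [Fintype ι] [DecidableEq ι] (b : Module.Basis ι ℝ E)
    {B : E →L[ℝ] E →L[ℝ] ℝ} (hB : IsNondegForm B) :
    ∃ L : (E →L[ℝ] E →L[ℝ] ℝ) →L[ℝ] ℝ, HasFDerivAt (fun T ↦ (gram b T).det) L B ∧
      ∀ T, L T = (gram b B).det * ∑ j, T (B.inverse (coordL b j)) (b j) := by
  have hd : ContDiff ℝ 1 (fun T : E →L[ℝ] E →L[ℝ] ℝ ↦ (gram b T).det) := by
    simp only [Matrix.det_apply, gram, Matrix.of_apply]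
    refine ContDiff.sum fun s _ ↦ ContDiff.const_smul _ (contDiff_prod fun i _ ↦ ?_)
    exact (contDiff_id.clm_apply contDiff_const).clm_apply contDiff_const
  have h1 := (hd.differentiable (by simp) B).hasFDerivAt
  refine ⟨_, h1, fun T ↦ ?_⟩
  have h2 : HasDerivAt (fun r : ℝ ↦ (gram b (B + r • T)).det)
      (fderiv ℝ (fun T : E →L[ℝ] E →L[ℝ] ℝ ↦ (gram b T).det) B T) 0 := by
    have h3 : HasDerivAt (fun r : ℝ ↦ B + r • T) T 0 := by
      simpa using ((hasDerivAt_id (0 : ℝ)).smul_const T).const_add B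
    have h1' : HasFDerivAt (fun T : E →L[ℝ] E →L[ℝ] ℝ ↦ (gram b T).det)
        (fderiv ℝ (fun T : E →L[ℝ] E →L[ℝ] ℝ ↦ (gram b T).det) B) (B + (0 : ℝ) • T) := by
      simpa using h1
    exact h1'.comp_hasDerivAt (0 : ℝ) h3
  simp only [gram_add_smul b hB, Matrix.det_mul] at h2
  rw [h2.unique ((hasDerivAt_det_one_add_smul _).const_mul _)]
  rfl

variable {B : E → E →L[ℝ] E →L[ℝ] ℝ} {V : Set E} {y : E}

/-- The square of the density is differentiated instead of the root. The form is only known to be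
nondegenerate, so both signs of the determinant are treated. -/
theorem IsMetricOn.fderiv_flatVolume (hB : IsMetricOn B V) (hy : y ∈ V) (v : E) :
    fderiv ℝ (flatVolume B) y v = 1 / 2 * flatVolume B y *
      ∑ j, fderiv ℝ B y v (reciprocal (B y) j) (Module.finBasis ℝ E j) := by
  obtain ⟨L, hL, hLT⟩ := fderiv_det_gram (Module.finBasis ℝ E) (hB.nondeg y hy)
  have hd := hL.comp y (hB.differentiableAt hy).hasFDerivAt
  have hne := det_gram_ne_zero (Module.finBasis ℝ E) (hB.nondeg y hy)
  have hs := hB.flatVolume_pos hy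
  have h1 := ((hB.contDiffOn_flatVolume.contDiffAt (hB.isOpen.mem_nhds hy)).differentiableAt
    (by simp)).hasFDerivAt
  have h2 : (fun y ↦ flatVolume B y * flatVolume B y) =
      fun y ↦ |(gram (Module.finBasis ℝ E) (B y)).det| := funext fun y ↦
    Real.mul_self_sqrt (abs_nonneg _)
  have h3 : HasFDerivAt (fun y ↦ flatVolume B y * flatVolume B y) _ y := h1.mul h1
  have hv := hLT (fderiv ℝ B y v)
  have h4 : flatVolume B y * flatVolume B y = |(gram (Module.finBasis ℝ E) (B y)).det| :=
    congrFun h2 y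
  rw [h2] at h3
  have key : flatVolume B y * fderiv ℝ (flatVolume B) y v +
      flatVolume B y * fderiv ℝ (flatVolume B) y v = flatVolume B y * flatVolume B y *
      ∑ j, fderiv ℝ B y v ((B y).inverse (coordL (Module.finBasis ℝ E) j))
        (Module.finBasis ℝ E j) := by
    rw [h4]
    rcases hne.lt_or_gt with h0 | h0
    · have h5 := h3.unique (hd.abs_of_neg h0)
      have := congrArg (fun L ↦ L v) h5
      simp only [add_apply, smul_apply, smul_eq_mul, neg_apply, ContinuousLinearMap.comp_apply,
        hv] at this
      rw [this, abs_of_neg h0]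
      ring
    · have h5 := h3.unique (hd.abs_of_pos h0)
      have := congrArg (fun L ↦ L v) h5
      simp only [add_apply, smul_apply, smul_eq_mul, ContinuousLinearMap.comp_apply, hv] at this
      rw [this, abs_of_pos h0]
  refine mul_left_cancel₀ hs.ne' ?_
  change _ = flatVolume B y * (1 / 2 * flatVolume B y *
    ∑ j, fderiv ℝ B y v ((B y).inverse (coordL (Module.finBasis ℝ E) j)) (Module.finBasis ℝ E j))
  linear_combination (1 / 2) * key

theorem IsNondegForm.sum_reciprocal {B : E →L[ℝ] E →L[ℝ] ℝ} (hB : IsNondegForm B)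
    (ξ : E →L[ℝ] ℝ) : ∑ i, ξ (reciprocal B i) • Module.finBasis ℝ E i = B.inverse ξ := by
  conv_rhs => rw [← sum_coordL_smul (Module.finBasis ℝ E) (B.inverse ξ)]
  exact Finset.sum_congr rfl fun i _ ↦ congrArg (· • _)
    (hB.dual_symm ξ (coordL (Module.finBasis ℝ E) i))

theorem IsNondegForm.sum_swap {B : E →L[ℝ] E →L[ℝ] ℝ} (hB : IsNondegForm B)
    (T : E →L[ℝ] E →L[ℝ] ℝ) : ∑ i, T (reciprocal B i) (Module.finBasis ℝ E i) =
      ∑ i, T (Module.finBasis ℝ E i) (reciprocal B i) := by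
  have h : ∀ i, reciprocal B i = ∑ j, coordL (Module.finBasis ℝ E) j (reciprocal B i) •
      Module.finBasis ℝ E j := fun i ↦ (sum_coordL_smul _ _).symm
  have hs : ∀ i j, coordL (Module.finBasis ℝ E) j (reciprocal B i) =
      coordL (Module.finBasis ℝ E) i (reciprocal B j) := fun i j ↦ hB.dual_symm _ _
  calc ∑ i, T (reciprocal B i) (Module.finBasis ℝ E i)
      = ∑ i, ∑ j, coordL (Module.finBasis ℝ E) j (reciprocal B i) *
          T (Module.finBasis ℝ E j) (Module.finBasis ℝ E i) := by
        refine Finset.sum_congr rfl fun i _ ↦ ?_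
        conv_lhs => rw [h i]
        simp only [sum_apply, smul_apply, map_sum, map_smul, smul_eq_mul]
    _ = ∑ j, ∑ i, coordL (Module.finBasis ℝ E) j (reciprocal B i) *
          T (Module.finBasis ℝ E j) (Module.finBasis ℝ E i) := Finset.sum_comm
    _ = _ := by
        refine Finset.sum_congr rfl fun j _ ↦ ?_
        conv_rhs => rw [h j]
        simp only [map_sum, map_smul, smul_eq_mul, hs]

/-- Differentiate the defining relation of the reciprocal basis, whose right side is a constant
coordinate functional. -/
theorem IsMetricOn.hasFDerivAt_reciprocal (hB : IsMetricOn B V) (hy : y ∈ V)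
    (i : Fin (Module.finrank ℝ E)) :
    HasFDerivAt (fun y ↦ reciprocal (B y) i) (fderiv ℝ (fun y ↦ reciprocal (B y) i) y) y ∧
      ∀ v w, B y (fderiv ℝ (fun y ↦ reciprocal (B y) i) y v) w =
        -fderiv ℝ B y v (reciprocal (B y) i) w := by
  have h1 := (((hB.contDiffOn_reciprocal i).contDiffAt
    (hB.isOpen.mem_nhds hy)).differentiableAt (by simp)).hasFDerivAt
  refine ⟨h1, fun v w ↦ ?_⟩
  have h2 := (hB.differentiableAt hy).hasFDerivAt.clm_apply h1
  have h3 : (fun y ↦ B y (reciprocal (B y) i)) =ᶠ[𝓝 y] fun _ ↦ coordL (Module.finBasis ℝ E) i := by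
    filter_upwards [hB.isOpen.mem_nhds hy] with z hz
    exact ContinuousLinearMap.ext fun w ↦ (hB.nondeg z hz).apply_inverse _ w
  have h4 := congrArg (fun L ↦ L v w) (h2.unique ((hasFDerivAt_const _ y).congr_of_eventuallyEq h3))
  simp at h4
  linarith

/-- The flux `s F^i` of the gradient of `F`, where `s` is the volume density. -/
def gradFlux (B : E → E →L[ℝ] E →L[ℝ] ℝ) (F : E → ℝ) (i : Fin (Module.finrank ℝ E)) (y : E) : ℝ :=
  flatVolume B y * fderiv ℝ F y (reciprocal (B y) i)

theorem IsMetricOn.contDiffOn_gradFlux (hB : IsMetricOn B V) {F : E → ℝ} (hF : ContDiffOn ℝ ∞ F V)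
    (i : Fin (Module.finrank ℝ E)) : ContDiffOn ℝ ∞ (gradFlux B F i) V :=
  hB.contDiffOn_flatVolume.mul
    ((hF.fderiv_of_isOpen hB.isOpen (by simp)).clm_apply (hB.contDiffOn_reciprocal i))

/-- The divergence form of the Laplacian. With `X` the gradient, the derivative of the density
yields half the trace of `∂_X B`, the derivative of the reciprocal basis yields the rest, and
together they are the contracted Christoffel term. -/
theorem IsMetricOn.sum_fderiv_gradFlux (hB : IsMetricOn B V) (hy : y ∈ V) {F : E → ℝ}
    (hF : ContDiffOn ℝ ∞ F V) :
    ∑ i, fderiv ℝ (gradFlux B F i) y (Module.finBasis ℝ E i) =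
      flatVolume B y * flatLaplacian B F y := by
  have hn := hB.nondeg y hy
  have hs := ((hB.contDiffOn_flatVolume.contDiffAt (hB.isOpen.mem_nhds hy)).differentiableAt
    (by simp)).hasFDerivAt
  have hF2 : HasFDerivAt (fderiv ℝ F) (fderiv ℝ (fderiv ℝ F) y) y :=
    (((hF.fderiv_of_isOpen hB.isOpen (m := ∞) (by simp)).contDiffAt
      (hB.isOpen.mem_nhds hy)).differentiableAt (by simp)).hasFDerivAt
  set X := (B y).inverse (fderiv ℝ F y) with hX
  have hBX : ∀ w, fderiv ℝ F y w = B y X w := fun w ↦ (hn.apply_inverse _ w).symm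
  have h1 : ∀ i, fderiv ℝ (gradFlux B F i) y (Module.finBasis ℝ E i) =
      fderiv ℝ F y (reciprocal (B y) i) * fderiv ℝ (flatVolume B) y (Module.finBasis ℝ E i) +
      flatVolume B y * (fderiv ℝ (fderiv ℝ F) y (Module.finBasis ℝ E i) (reciprocal (B y) i)
        - fderiv ℝ B y (Module.finBasis ℝ E i) (reciprocal (B y) i) X) := fun i ↦ by
    obtain ⟨hr, hr'⟩ := hB.hasFDerivAt_reciprocal hy i
    have h : HasFDerivAt (gradFlux B F i) _ y := hs.mul (hF2.clm_apply hr)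
    rw [h.fderiv]
    simp only [add_apply, smul_apply, smul_eq_mul, ContinuousLinearMap.comp_apply,
      ContinuousLinearMap.flip_apply]
    rw [hBX (fderiv ℝ _ y _), hn.symm X, hr']
    ring
  have h2 : ∑ i, fderiv ℝ F y (reciprocal (B y) i) *
      fderiv ℝ (flatVolume B) y (Module.finBasis ℝ E i) = fderiv ℝ (flatVolume B) y X := by
    rw [hX, ← hn.sum_reciprocal (fderiv ℝ F y)]
    simp
  have h3 : ∀ i, fderiv ℝ F y (christoffelSymbol B y (Module.finBasis ℝ E i) (reciprocal (B y) i)) =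
      1 / 2 * (fderiv ℝ B y (Module.finBasis ℝ E i) (reciprocal (B y) i) X
        + fderiv ℝ B y (reciprocal (B y) i) (Module.finBasis ℝ E i) X
        - fderiv ℝ B y X (Module.finBasis ℝ E i) (reciprocal (B y) i)) := fun i ↦ by
    rw [hBX, hn.symm, hB.apply_christoffel hy]
  have h4 := hn.sum_swap ((ContinuousLinearMap.compL ℝ E (E →L[ℝ] ℝ) ℝ
    (ContinuousLinearMap.apply ℝ ℝ X)).comp (fderiv ℝ B y))
  simp only [ContinuousLinearMap.comp_apply, ContinuousLinearMap.compL_apply,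
    ContinuousLinearMap.apply_apply] at h4
  have h5 := hn.sum_swap (fderiv ℝ B y X)
  simp only [h1, flatLaplacian, metricTrace, h3, Finset.sum_add_distrib, h2, Finset.sum_sub_distrib,
    ← Finset.mul_sum, h4]
  rw [hB.fderiv_flatVolume hy, h5]
  ring

/-- The products of first derivatives of `F` and `G` cancel by symmetry of the inverse metric. -/
theorem IsMetricOn.sum_fderiv_wronskian (hB : IsMetricOn B V) (hy : y ∈ V) {F G : E → ℝ}
    (hF : ContDiffOn ℝ ∞ F V) (hG : ContDiffOn ℝ ∞ G V) :
    ∑ i, fderiv ℝ (fun y ↦ G y * gradFlux B F i y - F y * gradFlux B G i y) y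
        (Module.finBasis ℝ E i) =
      flatVolume B y * (flatLaplacian B F y * G y - F y * flatLaplacian B G y) := by
  have hn := hB.nondeg y hy
  have hd : ∀ {f : E → ℝ}, ContDiffOn ℝ ∞ f V → HasFDerivAt f (fderiv ℝ f y) y := fun hf ↦
    ((hf.contDiffAt (hB.isOpen.mem_nhds hy)).differentiableAt (by simp)).hasFDerivAt
  have h1 : ∀ i, fderiv ℝ (fun y ↦ G y * gradFlux B F i y - F y * gradFlux B G i y) y
      (Module.finBasis ℝ E i) =
      G y * fderiv ℝ (gradFlux B F i) y (Module.finBasis ℝ E i)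
        - F y * fderiv ℝ (gradFlux B G i) y (Module.finBasis ℝ E i)
        + flatVolume B y * (fderiv ℝ F y (reciprocal (B y) i) * fderiv ℝ G y (Module.finBasis ℝ E i)
          - fderiv ℝ G y (reciprocal (B y) i) * fderiv ℝ F y (Module.finBasis ℝ E i)) := fun i ↦ by
    have h : HasFDerivAt (fun y ↦ G y * gradFlux B F i y - F y * gradFlux B G i y) _ y :=
      ((hd hG).mul (hd (hB.contDiffOn_gradFlux hF i))).sub
        ((hd hF).mul (hd (hB.contDiffOn_gradFlux hG i)))
    rw [h.fderiv]
    simp only [add_apply, sub_apply, smul_apply, smul_eq_mul, gradFlux]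
    ring
  have h2 : ∀ ξ η : E →L[ℝ] ℝ, ∑ i, ξ (reciprocal (B y) i) * η (Module.finBasis ℝ E i) =
      η ((B y).inverse ξ) := fun ξ η ↦ by
    rw [← hn.sum_reciprocal ξ]
    simp
  simp only [h1, Finset.sum_add_distrib, Finset.sum_sub_distrib, ← Finset.mul_sum, h2,
    hB.sum_fderiv_gradFlux hy hF, hB.sum_fderiv_gradFlux hy hG,
    hn.dual_symm (fderiv ℝ G y) (fderiv ℝ F y)]
  ring

end Divergence

end

end QuantizedGravity

namespace QuantizedGravity

noncomputable section

set_option linter.unusedSectionVars false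
set_option maxSynthPendingDepth 3

/-! ### Integrals of divergences -/

section Integrals

variable {F : Type*} [NormedAddCommGroup F] [NormedSpace ℝ F] [FiniteDimensional ℝ F]
  [MeasurableSpace F] [BorelSpace F] (μ : Measure F) [μ.IsAddHaarMeasure] {T K : Set F} {f : F → ℝ}

theorem integrableOn_of_eq_zero_off_compact (hT : IsOpen T) (hf : ContinuousOn f T)
    (hK : IsCompact K) (hKT : K ⊆ T) (h0 : ∀ z ∈ T, z ∉ K → f z = 0) : IntegrableOn f T μ :=
  ((hf.mono hKT).integrableOn_compact hK).of_forall_sdiff_eq_zero hT.measurableSet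
    fun z hz ↦ h0 z hz.1 hz.2

theorem fderiv_eq_zero_off_compact (hT : IsOpen T) (hK : IsCompact K)
    (h0 : ∀ z ∈ T, z ∉ K → f z = 0) {z : F} (hz : z ∈ T) (hzK : z ∉ K) : fderiv ℝ f z = 0 := by
  have : f =ᶠ[𝓝 z] fun _ ↦ 0 := by
    filter_upwards [hT.mem_nhds hz, hK.isClosed.isOpen_compl.mem_nhds hzK] with w h1 h2
      using h0 w h1 h2
  rw [this.fderiv_eq, fderiv_fun_const, Pi.zero_apply]

/-- Integration by parts against the constant function `1`. -/
theorem integral_fderiv_eq_zero (hf : ContDiff ℝ ∞ f) (hc : HasCompactSupport f) (v : F) :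
    ∫ z, fderiv ℝ f z v ∂μ = 0 := by
  have h1 : Integrable (fun z ↦ fderiv ℝ f z v) μ := by
    refine Continuous.integrable_of_hasCompactSupport ?_ ?_
    · exact (hf.continuous_fderiv (by simp)).clm_apply continuous_const
    · exact (hc.fderiv (𝕜 := ℝ)).comp_left (g := fun L : F →L[ℝ] ℝ ↦ L v) rfl
  have h := integral_bilinear_hasLineDerivAt_right_eq_neg_left_of_integrable (μ := μ)
    (f := fun _ : F ↦ (1 : ℝ)) (f' := fun _ ↦ 0) (g := f) (g' := fun z ↦ fderiv ℝ f z v) (v := v)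
    (B := ContinuousLinearMap.mul ℝ ℝ) (by simp) (by simpa using h1)
    (by simpa using hf.continuous.integrable_of_hasCompactSupport hc)
    (fun z _ ↦ by simpa using (hasFDerivAt_const (1 : ℝ) z).hasLineDerivAt v)
    (fun z _ ↦ ((hf.differentiable (by simp) z).hasFDerivAt.hasLineDerivAt v))
  simpa using h

/-- Expressions in a chart are smooth only on its target. Vanishing off a compact subset, they
extend by zero to smooth functions on the whole space. -/
theorem setIntegral_fderiv_eq_zero (hT : IsOpen T) (hf : ContDiffOn ℝ ∞ f T)
    (hK : IsCompact K) (hKT : K ⊆ T) (h0 : ∀ z ∈ T, z ∉ K → f z = 0) (v : F) :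
    IntegrableOn (fun z ↦ fderiv ℝ f z v) T μ ∧ ∫ z in T, fderiv ℝ f z v ∂μ = 0 := by
  have hd0 := fun z (hz : z ∈ T) (hzK : z ∉ K) ↦ fderiv_eq_zero_off_compact hT hK h0 hz hzK
  refine ⟨integrableOn_of_eq_zero_off_compact μ hT
    (((hf.fderiv_of_isOpen hT (m := ∞) (by simp)).continuousOn).clm_apply continuousOn_const)
    hK hKT fun z hz hzK ↦ by rw [hd0 z hz hzK]; rfl, ?_⟩
  set f' := T.indicator f with hf'
  have heq : ∀ z ∈ T, f' =ᶠ[𝓝 z] f := fun z hz ↦ by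
    filter_upwards [hT.mem_nhds hz] with w hw using indicator_of_mem hw f
  have hoff : ∀ z ∉ K, f' z = 0 := fun z hz ↦ by
    by_cases hzT : z ∈ T
    · rw [hf', indicator_of_mem hzT, h0 z hzT hz]
    · exact indicator_of_notMem hzT f
  have hsmooth : ContDiff ℝ ∞ f' := by
    rw [contDiff_iff_contDiffAt]
    intro z
    by_cases hz : z ∈ K
    · exact (hf.contDiffAt (hT.mem_nhds (hKT hz))).congr_of_eventuallyEq (heq z (hKT hz))
    · have : f' =ᶠ[𝓝 z] fun _ ↦ 0 := by
        filter_upwards [hK.isClosed.isOpen_compl.mem_nhds hz] with w hw using hoff w hw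
      exact contDiffAt_const.congr_of_eventuallyEq this
  have hcomp : HasCompactSupport f' := HasCompactSupport.intro hK hoff
  have h1 : ∫ z in T, fderiv ℝ f z v ∂μ = ∫ z in T, fderiv ℝ f' z v ∂μ :=
    setIntegral_congr_fun hT.measurableSet fun z hz ↦ by
      rw [(heq z hz).fderiv_eq]
  rw [h1, ← integral_fderiv_eq_zero μ hsmooth hcomp v]
  refine setIntegral_eq_integral_of_forall_compl_eq_zero fun z hz ↦ ?_
  rw [fderiv_eq_zero_off_compact isOpen_univ hK (fun z _ ↦ hoff z) (mem_univ z)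
    fun h ↦ hz (hKT h)]
  rfl

end Integrals

/-! ### Green's formula for the wave operator in a chart -/

section Green

variable {E : Type*} [NormedAddCommGroup E] [NormedSpace ℝ E] [FiniteDimensional ℝ E]
  {B : E → E →L[ℝ] E →L[ℝ] ℝ} {V : Set E} {F G : ℝ × E → ℝ} {τ ρ : ℝ → ℝ}

/-- The spatial flux of the Wronskian of `F` and `G`. -/
def spatialFlux (B : E → E →L[ℝ] E →L[ℝ] ℝ) (τ : ℝ → ℝ) (F G : ℝ × E → ℝ)
    (i : Fin (Module.finrank ℝ E)) (z : ℝ × E) : ℝ :=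
  τ z.1 * (G z * (flatVolume B z.2 * fderiv ℝ F z (0, reciprocal (B z.2) i))
    - F z * (flatVolume B z.2 * fderiv ℝ G z (0, reciprocal (B z.2) i)))

theorem contDiffOn_spatialFlux (hB : IsMetricOn B V) (hτ : ContDiffOn ℝ ∞ τ (Ioi 0))
    (hF : ContDiffOn ℝ ∞ F (Ioi 0 ×ˢ V)) (hG : ContDiffOn ℝ ∞ G (Ioi 0 ×ˢ V))
    (i : Fin (Module.finrank ℝ E)) :
    ContDiffOn ℝ ∞ (spatialFlux B τ F G i) (Ioi 0 ×ˢ V) := by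
  have hT : IsOpen (Ioi (0 : ℝ) ×ˢ V) := isOpen_Ioi.prod hB.isOpen
  have hfst : MapsTo (Prod.fst : ℝ × E → ℝ) (Ioi 0 ×ˢ V) (Ioi 0) := fun z hz ↦ hz.1
  have hsnd : MapsTo (Prod.snd : ℝ × E → E) (Ioi 0 ×ˢ V) V := fun z hz ↦ hz.2
  have hs := hB.contDiffOn_flatVolume.comp contDiff_snd.contDiffOn hsnd
  have hr := contDiffOn_const (c := (0 : ℝ)).prodMk
    ((hB.contDiffOn_reciprocal i).comp contDiff_snd.contDiffOn hsnd)
  have hd : ∀ {F : ℝ × E → ℝ}, ContDiffOn ℝ ∞ F (Ioi 0 ×ˢ V) →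
      ContDiffOn ℝ ∞ (fun z : ℝ × E ↦ fderiv ℝ F z (0, reciprocal (B z.2) i)) (Ioi 0 ×ˢ V) :=
    fun hF ↦ (hF.fderiv_of_isOpen hT (m := ∞) (by simp)).clm_apply hr
  exact (hτ.comp contDiff_fst.contDiffOn hfst).mul
    ((hG.mul (hs.mul (hd hF))).sub (hF.mul (hs.mul (hd hG))))

theorem sum_fderiv_spatialFlux (hB : IsMetricOn B V) (hτ : ContDiffOn ℝ ∞ τ (Ioi 0))
    (hF : ContDiffOn ℝ ∞ F (Ioi 0 ×ˢ V)) (hG : ContDiffOn ℝ ∞ G (Ioi 0 ×ˢ V)) {z : ℝ × E}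
    (hz : z ∈ Ioi 0 ×ˢ V) :
    ∑ i, fderiv ℝ (spatialFlux B τ F G i) z (0, Module.finBasis ℝ E i) =
      τ z.1 * (flatVolume B z.2 * (flatLaplacian B (fun y ↦ F (z.1, y)) z.2 * G z
        - F z * flatLaplacian B (fun y ↦ G (z.1, y)) z.2)) := by
  have hT : IsOpen (Ioi (0 : ℝ) ×ˢ V) := isOpen_Ioi.prod hB.isOpen
  have hA : ∀ y : E, ((z.1, y) : ℝ × E) = (z.1, 0) + ContinuousLinearMap.inr ℝ ℝ E y :=
    fun y ↦ by simp
  have hm : MapsTo (fun y : E ↦ (z.1, y)) V (Ioi 0 ×ˢ V) := fun y hy ↦ ⟨hz.1, hy⟩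
  have hsl : ∀ {F : ℝ × E → ℝ}, ContDiffOn ℝ ∞ F (Ioi 0 ×ˢ V) →
      ContDiffOn ℝ ∞ (fun y ↦ F (z.1, y)) V := fun hF ↦
    hF.comp (contDiff_const.prodMk contDiff_id).contDiffOn hm
  have hgf : ∀ {F : ℝ × E → ℝ}, ContDiffOn ℝ ∞ F (Ioi 0 ×ˢ V) → ∀ i, ∀ y ∈ V,
      flatVolume B y * fderiv ℝ F (z.1, y) (0, reciprocal (B y) i) =
        gradFlux B (fun y ↦ F (z.1, y)) i y := fun hF i y hy ↦ by
    rw [gradFlux, fderiv_comp_affine hA hT hF (y := y) (hm hy)]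
    rfl
  rw [← hB.sum_fderiv_wronskian hz.2 (hsl hF) (hsl hG), Finset.mul_sum]
  refine Finset.sum_congr rfl fun i _ ↦ ?_
  have h1 := fderiv_comp_affine hA hT (contDiffOn_spatialFlux hB hτ hF hG i) (y := z.2) hz
  have h2 := congrArg (fun L ↦ L (Module.finBasis ℝ E i)) h1
  simp only [ContinuousLinearMap.comp_apply, ContinuousLinearMap.inr_apply] at h2
  rw [← h2]
  have h3 : (fun y ↦ spatialFlux B τ F G i (z.1, y)) =ᶠ[𝓝 z.2] fun y ↦ τ z.1 *
      (G (z.1, y) * gradFlux B (fun y ↦ F (z.1, y)) i y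
        - F (z.1, y) * gradFlux B (fun y ↦ G (z.1, y)) i y) := by
    filter_upwards [hB.isOpen.mem_nhds hz.2] with y hy
    rw [← hgf hF i y hy, ← hgf hG i y hy]
    rfl
  have h4 : DifferentiableAt ℝ (fun y ↦ G (z.1, y) * gradFlux B (fun y ↦ F (z.1, y)) i y
        - F (z.1, y) * gradFlux B (fun y ↦ G (z.1, y)) i y) z.2 :=
    ((((hsl hG).mul (hB.contDiffOn_gradFlux (hsl hF) i)).sub
      ((hsl hF).mul (hB.contDiffOn_gradFlux (hsl hG) i))).contDiffAt
        (hB.isOpen.mem_nhds hz.2)).differentiableAt (by simp)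
  rw [h3.fderiv_eq, fderiv_const_mul h4]
  rfl

/-- The temporal flux of the Wronskian of `F` and `G`. -/
def timeFlux (B : E → E →L[ℝ] E →L[ℝ] ℝ) (ρ : ℝ → ℝ) (F G : ℝ × E → ℝ) (z : ℝ × E) : ℝ :=
  ρ z.1 * flatVolume B z.2 * (fderiv ℝ F z (1, 0) * G z - F z * fderiv ℝ G z (1, 0))

theorem contDiffOn_timeFlux (hB : IsMetricOn B V) (hρ : ContDiffOn ℝ ∞ ρ (Ioi 0))
    (hF : ContDiffOn ℝ ∞ F (Ioi 0 ×ˢ V)) (hG : ContDiffOn ℝ ∞ G (Ioi 0 ×ˢ V)) :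
    ContDiffOn ℝ ∞ (timeFlux B ρ F G) (Ioi 0 ×ˢ V) := by
  have hT : IsOpen (Ioi (0 : ℝ) ×ˢ V) := isOpen_Ioi.prod hB.isOpen
  have hfst : MapsTo (Prod.fst : ℝ × E → ℝ) (Ioi 0 ×ˢ V) (Ioi 0) := fun z hz ↦ hz.1
  have hsnd : MapsTo (Prod.snd : ℝ × E → E) (Ioi 0 ×ˢ V) V := fun z hz ↦ hz.2
  have hd : ∀ {F : ℝ × E → ℝ}, ContDiffOn ℝ ∞ F (Ioi 0 ×ˢ V) →
      ContDiffOn ℝ ∞ (fun z : ℝ × E ↦ fderiv ℝ F z (1, 0)) (Ioi 0 ×ˢ V) :=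
    fun hF ↦ (hF.fderiv_of_isOpen hT (m := ∞) (by simp)).clm_apply contDiffOn_const
  exact ((hρ.comp contDiff_fst.contDiffOn hfst).mul
    (hB.contDiffOn_flatVolume.comp contDiff_snd.contDiffOn hsnd)).mul
      (((hd hF).mul hG).sub (hF.mul (hd hG)))

/-- The derivative of the weight produces a second time flux, weighted with `deriv ρ`; it is the
only obstruction to symmetry. -/
theorem fderiv_timeFlux (hB : IsMetricOn B V) (hρ : ContDiffOn ℝ ∞ ρ (Ioi 0))
    (hF : ContDiffOn ℝ ∞ F (Ioi 0 ×ˢ V)) (hG : ContDiffOn ℝ ∞ G (Ioi 0 ×ˢ V)) {z : ℝ × E}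
    (hz : z ∈ Ioi 0 ×ˢ V) :
    fderiv ℝ (timeFlux B ρ F G) z (1, 0) =
      ρ z.1 * flatVolume B z.2 * (fderiv ℝ (fderiv ℝ F) z (1, 0) (1, 0) * G z
        - F z * fderiv ℝ (fderiv ℝ G) z (1, 0) (1, 0)) + timeFlux B (deriv ρ) F G z := by
  have hT : IsOpen (Ioi (0 : ℝ) ×ˢ V) := isOpen_Ioi.prod hB.isOpen
  have hρ' : HasFDerivAt (fun z : ℝ × E ↦ ρ z.1)
      ((ContinuousLinearMap.toSpanSingleton ℝ (deriv ρ z.1)).comp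
        (ContinuousLinearMap.fst ℝ ℝ E)) z :=
    HasFDerivAt.comp z (((hρ.contDiffAt (isOpen_Ioi.mem_nhds hz.1)).differentiableAt
      (by simp)).hasDerivAt.hasFDerivAt) hasFDerivAt_fst
  have hs : HasFDerivAt (fun z : ℝ × E ↦ flatVolume B z.2)
      ((fderiv ℝ (flatVolume B) z.2).comp (ContinuousLinearMap.snd ℝ ℝ E)) z :=
    HasFDerivAt.comp z ((hB.contDiffOn_flatVolume.contDiffAt
      (hB.isOpen.mem_nhds hz.2)).differentiableAt (by simp)).hasFDerivAt hasFDerivAt_snd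
  have hd : ∀ {F : ℝ × E → ℝ}, ContDiffOn ℝ ∞ F (Ioi 0 ×ˢ V) →
      HasFDerivAt F (fderiv ℝ F z) z := fun hF ↦
    ((hF.contDiffAt (hT.mem_nhds hz)).differentiableAt (by simp)).hasFDerivAt
  have hd2 : ∀ {F : ℝ × E → ℝ}, ContDiffOn ℝ ∞ F (Ioi 0 ×ˢ V) →
      HasFDerivAt (fun z ↦ fderiv ℝ F z (1, 0))
        ((fderiv ℝ (fderiv ℝ F) z).flip (1, 0)) z := fun hF ↦ by
    have := ((((hF.fderiv_of_isOpen hT (m := ∞) (by simp)).contDiffAt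
      (hT.mem_nhds hz)).differentiableAt (by simp)).hasFDerivAt).clm_apply
        (hasFDerivAt_const ((1 : ℝ), (0 : E)) z)
    refine this.congr_fderiv ?_
    simp
  have h : HasFDerivAt (timeFlux B ρ F G) _ z :=
    (hρ'.mul hs).mul (((hd2 hF).mul (hd hG)).sub ((hd hF).mul (hd2 hG)))
  rw [h.fderiv]
  simp [timeFlux]
  ring

variable [MeasurableSpace E] [BorelSpace E] (μ : Measure (ℝ × E)) [μ.IsAddHaarMeasure]

/-- Up to the time flux with weight `deriv ρ` the integrand is a sum of derivatives of compactly
supported fluxes. Only `F` has to vanish off `K`, as every term of a flux contains `F` or its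
derivative. -/
theorem setIntegral_wronskian (hB : IsMetricOn B V) (hρ : ContDiffOn ℝ ∞ ρ (Ioi 0))
    (hτ : ContDiffOn ℝ ∞ τ (Ioi 0)) (hF : ContDiffOn ℝ ∞ F (Ioi 0 ×ˢ V))
    (hG : ContDiffOn ℝ ∞ G (Ioi 0 ×ˢ V)) {K : Set (ℝ × E)} (hK : IsCompact K)
    (hKT : K ⊆ Ioi 0 ×ˢ V) (h0 : ∀ z ∈ Ioi (0 : ℝ) ×ˢ V, z ∉ K → F z = 0) (c : ℝ) :
    ∫ z in Ioi 0 ×ˢ V, (c * (fderiv ℝ (fderiv ℝ F) z (1, 0) (1, 0) * G z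
        - F z * fderiv ℝ (fderiv ℝ G) z (1, 0) (1, 0))
      - τ z.1 * (flatLaplacian B (fun y ↦ F (z.1, y)) z.2 * G z
        - F z * flatLaplacian B (fun y ↦ G (z.1, y)) z.2)) * (ρ z.1 * flatVolume B z.2) ∂μ =
      -(c * ∫ z in Ioi 0 ×ˢ V, timeFlux B (deriv ρ) F G z ∂μ) := by
  have hT : IsOpen (Ioi (0 : ℝ) ×ˢ V) := isOpen_Ioi.prod hB.isOpen
  have hd0 := fun z (hz : z ∈ Ioi (0 : ℝ) ×ˢ V) (hzK : z ∉ K) ↦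
    fderiv_eq_zero_off_compact hT hK h0 hz hzK
  have hρ' : ContDiffOn ℝ ∞ (deriv ρ) (Ioi 0) := by
    exact hρ.deriv_of_isOpen isOpen_Ioi (by simp)
  have h1 := setIntegral_fderiv_eq_zero μ hT (contDiffOn_timeFlux hB hρ hF hG) hK hKT
    (fun z hz hzK ↦ by rw [timeFlux, hd0 z hz hzK, h0 z hz hzK]; simp) (1, 0)
  have h2 := fun i ↦ setIntegral_fderiv_eq_zero μ hT
    (contDiffOn_spatialFlux hB (hτ.mul hρ) hF hG i) hK hKT
    (fun z hz hzK ↦ by rw [spatialFlux, hd0 z hz hzK, h0 z hz hzK]; simp)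
    (0, Module.finBasis ℝ E i)
  have h3 : IntegrableOn (timeFlux B (deriv ρ) F G) (Ioi 0 ×ˢ V) μ :=
    integrableOn_of_eq_zero_off_compact μ hT (contDiffOn_timeFlux hB hρ' hF hG).continuousOn hK hKT
      fun z hz hzK ↦ by rw [timeFlux, hd0 z hz hzK, h0 z hz hzK]; simp
  have h4 : ∀ z ∈ Ioi (0 : ℝ) ×ˢ V, (c * (fderiv ℝ (fderiv ℝ F) z (1, 0) (1, 0) * G z
        - F z * fderiv ℝ (fderiv ℝ G) z (1, 0) (1, 0))
      - τ z.1 * (flatLaplacian B (fun y ↦ F (z.1, y)) z.2 * G z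
        - F z * flatLaplacian B (fun y ↦ G (z.1, y)) z.2)) * (ρ z.1 * flatVolume B z.2) =
      (c * fderiv ℝ (timeFlux B ρ F G) z (1, 0) - c * timeFlux B (deriv ρ) F G z)
        - ∑ i, fderiv ℝ (spatialFlux B (fun t ↦ τ t * ρ t) F G i) z (0, Module.finBasis ℝ E i) :=
    fun z hz ↦ by
      rw [sum_fderiv_spatialFlux hB (hτ.mul hρ) hF hG hz, fderiv_timeFlux hB hρ hF hG hz]
      ring
  have h5 : Integrable (fun z ↦ c * fderiv ℝ (timeFlux B ρ F G) z (1, 0)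
      - c * timeFlux B (deriv ρ) F G z) (μ.restrict (Ioi 0 ×ˢ V)) :=
    (h1.1.const_mul c).sub (h3.const_mul c)
  rw [setIntegral_congr_fun hT.measurableSet h4, integral_sub h5 (integrable_finsetSum _ fun i _ ↦ (h2 i).1),
    integral_sub (h1.1.const_mul c) (h3.const_mul c), integral_finsetSum _ fun i _ ↦ (h2 i).1,
    integral_const_mul, integral_const_mul, h1.2, Finset.sum_eq_zero fun i _ ↦ (h2 i).2]
  ring

end Green

end

end QuantizedGravity

namespace QuantizedGravity

noncomputable section

set_option linter.unusedSectionVars false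
set_option maxSynthPendingDepth 3

/-! ### Normally hyperbolic operators -/

section NormallyHyperbolic

variable {E : Type*} [NormedAddCommGroup E] [NormedSpace ℝ E] [FiniteDimensional ℝ E]
  {H : Type*} [TopologicalSpace H] {I : ModelWithCorners ℝ E H} [I.Boundaryless]
  {M : Type*} [TopologicalSpace M] [ChartedSpace H M] [IsManifold I ∞ M]
  {g : TwoTensor I M} {P : (M → ℝ) → (M → ℝ)} {u v : M → ℝ}

theorem eq_of_chart_eq {w w' : M → ℝ} (h : ∀ x : M, ∀ y ∈ (extChartAt I x).target,
    w ((extChartAt I x).symm y) = w' ((extChartAt I x).symm y)) : w = w' := funext fun x ↦ by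
  have := h x _ (mem_extChartAt_target x)
  rwa [extChartAt_to_inv] at this

/-- `P` is an arbitrary map on functions; its additivity on smooth ones is read off from the chart
expression. -/
theorem IsNormallyHyperbolic.map_add (hP : IsNormallyHyperbolic g P)
    (hu : ContMDiff I 𝓘(ℝ, ℝ) ∞ u) (hv : ContMDiff I 𝓘(ℝ, ℝ) ∞ v) : P (u + v) = P u + P v := by
  refine eq_of_chart_eq (I := I) fun x y hy ↦ ?_
  obtain ⟨a, b, -, -, h⟩ := hP x
  have hT := isOpen_extChartAt_target (I := I) x
  rw [Pi.add_apply, h u hu y hy, h v hv y hy, h (u + v) (hu.add hv) y hy]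
  have hd : ∀ {u : M → ℝ}, ContMDiff I 𝓘(ℝ, ℝ) ∞ u → ∀ z ∈ (extChartAt I x).target,
      DifferentiableAt ℝ (fun z ↦ u ((extChartAt I x).symm z)) z := fun hu z hz ↦
    ((contDiffOn_comp_chart_symm hu).contDiffAt (hT.mem_nhds hz)).differentiableAt (by simp)
  have hd2 : ∀ {u : M → ℝ}, ContMDiff I 𝓘(ℝ, ℝ) ∞ u →
      DifferentiableAt ℝ (fderiv ℝ fun z ↦ u ((extChartAt I x).symm z)) y := fun hu ↦
    (((contDiffOn_comp_chart_symm hu).fderiv_of_isOpen hT (m := ∞) (by simp)).contDiffAt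
      (hT.mem_nhds hy)).differentiableAt (by simp)
  have h1 : fderiv ℝ (fun z ↦ (u + v) ((extChartAt I x).symm z)) =ᶠ[𝓝 y]
      fun z ↦ fderiv ℝ (fun z ↦ u ((extChartAt I x).symm z)) z +
        fderiv ℝ (fun z ↦ v ((extChartAt I x).symm z)) z := by
    filter_upwards [hT.mem_nhds hy] with z hz using fderiv_add (hd hu z hz) (hd hv z hz)
  rw [h1.eq_of_nhds, h1.fderiv_eq, fderiv_fun_add (hd2 hu) (hd2 hv)]
  simp only [metricTrace, add_apply, Finset.sum_add_distrib, Pi.add_apply]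
  ring

theorem IsNormallyHyperbolic.continuous (hP : IsNormallyHyperbolic g P)
    (hg : IsPseudoRiemannian g) (hu : ContMDiff I 𝓘(ℝ, ℝ) ∞ u) : Continuous (P u) := by
  rw [continuous_iff_continuousAt]
  intro x
  obtain ⟨a, b, ha, hb, h⟩ := hP x
  have hT := isOpen_extChartAt_target (I := I) x
  have hF := contDiffOn_comp_chart_symm (x := x) hu
  have hF1 := hF.fderiv_of_isOpen hT (m := ∞) (by simp)
  have hF2 := hF1.fderiv_of_isOpen hT (m := ∞) (by simp)
  have h1 := (((hg x).contDiffOn_metricTrace hF2).neg.add (hF1.clm_apply ha)).add (hb.mul hF)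
  have h2 : ContinuousOn (fun y ↦ P u ((extChartAt I x).symm y)) (extChartAt I x).target :=
    (h1.congr fun y hy ↦ h u hu y hy).continuousOn
  have h3 := ContinuousAt.comp (f := extChartAt I x) (x := x)
    (h2.continuousAt (hT.mem_nhds (mem_extChartAt_target x))) (continuousAt_extChartAt x)
  refine h3.congr ?_
  filter_upwards [(isOpen_extChartAt_source (I := I) x).mem_nhds (mem_extChartAt_source x)]
    with z hz
  simp only [Function.comp_apply]
  rw [(extChartAt I x).left_inv hz]

theorem IsNormallyHyperbolic.eq_zero_of_notMem_tsupport (hP : IsNormallyHyperbolic g P)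
    (hu : ContMDiff I 𝓘(ℝ, ℝ) ∞ u) {x : M} (hx : x ∉ tsupport u) : P u x = 0 := by
  obtain ⟨a, b, ha, hb, h⟩ := hP x
  have h1 := h u hu _ (mem_extChartAt_target x)
  rw [extChartAt_to_inv] at h1
  have h2 : (fun z ↦ u ((extChartAt I x).symm z)) =ᶠ[𝓝 (extChartAt I x x)] fun _ ↦ 0 := by
    have h3 : ContinuousAt (extChartAt I x).symm (extChartAt I x x) :=
      continuousAt_extChartAt_symm x
    have h4 : (tsupport u)ᶜ ∈ 𝓝 ((extChartAt I x).symm (extChartAt I x x)) := by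
      rw [extChartAt_to_inv]
      exact (isClosed_tsupport u).isOpen_compl.mem_nhds hx
    filter_upwards [h3 h4] with z hz using image_eq_zero_of_notMem_tsupport hz
  have h3 : fderiv ℝ (fun _ : E ↦ (0 : ℝ)) = fun _ ↦ 0 := funext fun z ↦ by simp
  dsimp only at h1
  rw [h1, h2.fderiv.fderiv_eq, h2.fderiv_eq, extChartAt_to_inv,
    image_eq_zero_of_notMem_tsupport hx, h3]
  simp [metricTrace]

variable [MeasurableSpace M] [BorelSpace M] (μ : Measure M) [IsLocallyFiniteMeasure μ]

theorem IsNormallyHyperbolic.integrable_mul (hP : IsNormallyHyperbolic g P)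
    (hg : IsPseudoRiemannian g) (hu : ContMDiff I 𝓘(ℝ, ℝ) ∞ u) (hv : ContMDiff I 𝓘(ℝ, ℝ) ∞ v)
    (hc : HasCompactSupport v) : Integrable (fun p ↦ P u p * v p) μ :=
  ((hP.continuous hg hu).mul hv.continuous).integrable_of_hasCompactSupport hc.mul_left

/-- By linearity, symmetry follows from symmetry for functions supported in a chart. -/
theorem IsNormallyHyperbolic.isSymmetricOperator [T2Space M] [SigmaCompactSpace M]
    (hP : IsNormallyHyperbolic g P) (hg : IsPseudoRiemannian g)
    (hloc : ∀ (x : M) (u v : M → ℝ), ContMDiff I 𝓘(ℝ, ℝ) ∞ u → ContMDiff I 𝓘(ℝ, ℝ) ∞ v →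
      HasCompactSupport u → tsupport u ⊆ (extChartAt I x).source →
      ∫ p, (P u p * v p - u p * P v p) ∂μ = 0) : IsSymmetricOperator I μ P := by
  intro u v hu hv hcu hcv
  -- Only the first argument is decomposed by the partition of unity; `v` stays fixed and need not
  -- be supported in a chart.
  let S := fun w : M → ℝ ↦ ContMDiff I 𝓘(ℝ, ℝ) ∞ w ∧
    ∫ p, P w p * v p ∂μ = ∫ p, w p * P v p ∂μ ∧ HasCompactSupport w
  have hint : ∀ w : M → ℝ, ContMDiff I 𝓘(ℝ, ℝ) ∞ w → HasCompactSupport w →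
      Integrable (fun p ↦ P w p * v p) μ ∧ Integrable (fun p ↦ w p * P v p) μ := fun w hw hcw ↦
    ⟨hP.integrable_mul μ hg hw hv hcv, by
      simpa only [mul_comm] using hP.integrable_mul μ hg hv hw hcw⟩
  have hadd : ∀ w w', S w → S w' → S (w + w') := fun w w' ⟨h1, h2, h3⟩ ⟨h1', h2', h3'⟩ ↦ by
    refine ⟨h1.add h1', ?_, h3.add h3'⟩
    simp only [hP.map_add h1 h1', Pi.add_apply, add_mul]
    rw [integral_add (hint w h1 h3).1 (hint w' h1' h3').1,
      integral_add (hint w h1 h3).2 (hint w' h1' h3').2, h2, h2']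
  have hS : ∀ (x : M) (w : M → ℝ), ContMDiff I 𝓘(ℝ, ℝ) ∞ w → HasCompactSupport w →
      tsupport w ⊆ (extChartAt I x).source → S w := fun x w hw hcw hx ↦ by
    refine ⟨hw, ?_, hcw⟩
    rw [← sub_eq_zero, ← integral_sub (hint w hw hcw).1 (hint w hw hcw).2]
    exact hloc x w v hw hv hcw hx
  obtain ⟨ρ, hρ⟩ := SmoothPartitionOfUnity.exists_isSubordinate_chartAt_source (I := I) M
  have hfin := ρ.locallyFinite.finite_nonempty_inter_compact hcu
  have hmem : ∀ i, S (fun p ↦ ρ i p * u p) := fun i ↦ by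
    refine hS i _ ((ρ i).contMDiff.mul hu) hcu.mul_left ?_
    rw [extChartAt_source]
    exact (tsupport_mul_subset_left).trans (hρ i)
  have hsum : ∀ s : Finset M, s.Nonempty → S (∑ i ∈ s, fun p ↦ ρ i p * u p) := fun s hs ↦
    Finset.sum_induction_nonempty _ S hadd hs fun i _ ↦ hmem i
  have hu_eq : u = ∑ i ∈ hfin.toFinset, fun p ↦ ρ i p * u p := by
    funext p
    rw [Finset.sum_apply, ← Finset.sum_mul]
    by_cases hp : p ∈ tsupport u
    · rw [← finsum_eq_sum_of_support_subset (fun i ↦ ρ i p), ρ.sum_eq_one (mem_univ p), one_mul]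
      intro i hi
      rw [Finite.coe_toFinset]
      exact ⟨p, hi, hp⟩
    · rw [image_eq_zero_of_notMem_tsupport hp, mul_zero]
  -- The induction over sums needs at least one summand; the empty sum means `u = 0`.
  rcases hfin.toFinset.eq_empty_or_nonempty with he | hne
  · rw [he, Finset.sum_empty] at hu_eq
    have h0 : P u = 0 := funext fun p ↦ hP.eq_zero_of_notMem_tsupport hu (by simp [hu_eq])
    simp only [h0, Pi.zero_apply, zero_mul]
    rw [hu_eq]
    simp
  · rw [hu_eq]
    exact (hsum _ hne).2.1

end NormallyHyperbolic

/-! ### Symmetry of the wave operator -/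

section Symmetry

variable {n : ℕ} {S₀ : Type*} [TopologicalSpace S₀]
  [ChartedSpace (EuclideanSpace ℝ (Fin n)) S₀] [IsManifold (IS n) ∞ S₀]
  [MeasurableSpace S₀] [BorelSpace S₀]

/-- The dependence on `t` of the volume density of the warped metric. -/
def warpDensity (n : ℕ) (f : ℝ → ℝ) (t : ℝ) : ℝ := √((f t / ((n : ℝ) - 1)) ^ n)

theorem contDiffOn_warpDensity (hn : 2 ≤ n) {f : ℝ → ℝ} (hf : ContDiffOn ℝ ∞ f (Ioi 0))
    (hf0 : ∀ t, 0 < t → 0 < f t) : ContDiffOn ℝ ∞ (warpDensity n f) (Ioi 0) := by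
  have hn1 : (0 : ℝ) < n - 1 := by
    have : (2 : ℝ) ≤ n := by exact_mod_cast hn
    linarith
  exact ((hf.div_const _).pow n).sqrt fun t ht ↦ (pow_pos (div_pos (hf0 t ht) hn1) n).ne'

/-- The density separates into a factor in `t` and the density of `σ`. The constant is the same in
all charts, so it can be taken out of Green's formula. -/
theorem exists_volumeDensity_warpedMetric (hn : 2 ≤ n) (σ : TwoTensor (IS n) S₀) {f : ℝ → ℝ}
    (hf0 : ∀ t, 0 < t → 0 < f t) : ∃ k : ℝ, 0 < k ∧ ∀ p : PosReal × S₀,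
      ∀ z ∈ (extChartAt (IQ n) p).target, volumeDensity (warpedMetric σ f) p z =
        k * (warpDensity n f z.1 * flatVolume (localMetric σ p.2) z.2) := by
  have hn1 : (0 : ℝ) < n - 1 := by
    have : (2 : ℝ) ≤ n := by exact_mod_cast hn
    linarith
  obtain ⟨C, hC, hdet⟩ := exists_det_gram_warpedForm (EuclideanSpace ℝ (Fin n))
  have hc := timeCoeff_pos hn
  refine ⟨√(C * timeCoeff n), Real.sqrt_pos.2 (mul_pos hC hc), fun p z hz ↦ ?_⟩
  rw [volumeDensity, flatVolume, localMetric_warpedMetric σ f p hz, hdet, warpDensity, flatVolume]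
  rw [extChartAt_spacetime_target] at hz
  have hh := pow_pos (div_pos (hf0 _ hz.1) hn1) n
  have hpow : (f z.1 / ((n : ℝ) - 1)) ^ Module.finrank ℝ (EuclideanSpace ℝ (Fin n)) =
      (f z.1 / ((n : ℝ) - 1)) ^ n := by rw [finrank_euclideanSpace_fin]
  rw [hpow, ← Real.sqrt_mul hh.le, ← Real.sqrt_mul (mul_pos hC hc).le]
  congr 1
  rw [abs_mul, abs_mul, abs_mul, abs_of_pos hC, abs_neg, abs_of_pos hc, abs_of_pos hh]
  ring

/-- Green's formula for the wave operator, with respect to the volume of the warped metric. -/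
theorem integral_wronskian_modelWave (hn : 2 ≤ n) {σ : TwoTensor (IS n) S₀}
    (hσ : IsPseudoRiemannian σ) {b : ℝ → S₀ → ℝ} (hb : IsSmoothPotential n b) {f : ℝ → ℝ}
    [SecondCountableTopology S₀]
    (hf : ContDiffOn ℝ ∞ f (Ioi 0)) (hf0 : ∀ t, 0 < t → 0 < f t) : ∃ k : ℝ, 0 < k ∧
    ∀ (p : PosReal × S₀) (u v : PosReal × S₀ → ℝ), ContMDiff (IQ n) 𝓘(ℝ, ℝ) ∞ u →
      ContMDiff (IQ n) 𝓘(ℝ, ℝ) ∞ v → HasCompactSupport u →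
      tsupport u ⊆ (extChartAt (IQ n) p).source →
      ∫ q, (modelWave σ b u q * v q - u q * modelWave σ b v q) ∂volumeMeasure (warpedMetric σ f) =
        -(k * ∫ z in (extChartAt (IQ n) p).target,
          timeFlux (localMetric σ p.2) (deriv (warpDensity n f))
            (fun z ↦ u ((extChartAt (IQ n) p).symm z)) (fun z ↦ v ((extChartAt (IQ n) p).symm z)) z
            ∂(Module.finBasis ℝ (ℝ × EuclideanSpace ℝ (Fin n))).addHaar) := by
  obtain ⟨k, hk, hdens⟩ := exists_volumeDensity_warpedMetric hn σ hf0
  have hc := timeCoeff_pos hn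
  refine ⟨k * (timeCoeff n)⁻¹, mul_pos hk (inv_pos.2 hc), fun p u v hu hv hcu hsu ↦ ?_⟩
  -- Continuity and locality of the operator come from normal hyperbolicity for the power metric,
  -- whatever warping function `f` the volume belongs to.
  have hP := isNormallyHyperbolic_modelWave hn hσ hb
  have hgP := isPseudoRiemannian_warpedMetric hn hσ (f := fun t ↦ t ^ (4 / (n : ℝ) - 2))
    (fun t ht ↦ (Real.contDiffAt_rpow_const_of_ne (ne_of_gt ht)).contDiffWithinAt)
    fun t ht ↦ Real.rpow_pos_of_pos ht _
  have hg := isPseudoRiemannian_warpedMetric hn hσ hf hf0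
  have hcont : Continuous fun q ↦ modelWave σ b u q * v q - u q * modelWave σ b v q :=
    ((hP.continuous hgP hu).mul hv.continuous).sub (hu.continuous.mul (hP.continuous hgP hv))
  have hsupp : Function.support (fun q ↦ modelWave σ b u q * v q - u q * modelWave σ b v q) ⊆
      (extChartAt (IQ n) p).source := fun q hq ↦ by
    by_contra hqs
    have hqu : q ∉ tsupport u := fun h ↦ hqs (hsu h)
    refine hq ?_
    dsimp only
    rw [hP.eq_zero_of_notMem_tsupport hu hqu, image_eq_zero_of_notMem_tsupport hqu]
    ring
  rw [integral_volumeMeasure hcont hsupp hg]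
  have hF := contDiffOn_comp_chart_symm (x := p) hu
  have hG := contDiffOn_comp_chart_symm (x := p) hv
  have hT := isOpen_extChartAt_target (I := IQ n) p
  have hK : IsCompact (extChartAt (IQ n) p '' tsupport u) :=
    hcu.isCompact.image_of_continuousOn ((continuousOn_extChartAt p).mono hsu)
  have hKT : extChartAt (IQ n) p '' tsupport u ⊆ (extChartAt (IQ n) p).target := by
    rintro _ ⟨q, hq, rfl⟩
    exact (extChartAt (IQ n) p).map_source (hsu hq)
  have h0 : ∀ z ∈ (extChartAt (IQ n) p).target, z ∉ extChartAt (IQ n) p '' tsupport u →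
      u ((extChartAt (IQ n) p).symm z) = 0 := fun z hz hzK ↦
    image_eq_zero_of_notMem_tsupport fun h ↦ hzK ⟨_, h, (extChartAt (IQ n) p).right_inv hz⟩
  have hW : ∀ z ∈ (extChartAt (IQ n) p).target,
      (modelWave σ b u ((extChartAt (IQ n) p).symm z) * v ((extChartAt (IQ n) p).symm z) -
        u ((extChartAt (IQ n) p).symm z) * modelWave σ b v ((extChartAt (IQ n) p).symm z)) *
        volumeDensity (warpedMetric σ f) p z = _ := fun z hz ↦ by
    rw [modelWave_chart hσ b hu p hz, modelWave_chart hσ b hv p hz, hdens p z hz]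
  rw [setIntegral_congr_fun hT.measurableSet hW]
  have key := setIntegral_wronskian (Module.finBasis ℝ (ℝ × EuclideanSpace ℝ (Fin n))).addHaar
    (hσ p.2) (contDiffOn_warpDensity hn hf hf0)
    (τ := fun t ↦ ((n : ℝ) - 1) * t ^ (2 - 4 / (n : ℝ)))
    (contDiffOn_const.mul fun t ht ↦
      (Real.contDiffAt_rpow_const_of_ne (ne_of_gt ht)).contDiffWithinAt)
    (extChartAt_spacetime_target (n := n) p ▸ hF) (extChartAt_spacetime_target (n := n) p ▸ hG) hK
    (extChartAt_spacetime_target (n := n) p ▸ hKT) (extChartAt_spacetime_target (n := n) p ▸ h0)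
    (timeCoeff n)⁻¹
  rw [← extChartAt_spacetime_target (n := n) p] at key
  rw [mul_assoc, ← mul_neg, ← key, ← integral_const_mul]
  -- The zero order terms cancel in `P u v - u P v`.
  congr 1
  funext z
  ring

variable [SecondCountableTopology S₀]

/-- For constant warping the time factor of the density is constant, and the flux left over in
Green's formula vanishes. -/
theorem isSymmetricOperator_modelWave [T2Space S₀] (hn : 2 ≤ n) {σ : TwoTensor (IS n) S₀}
    (hσ : IsPseudoRiemannian σ) {b : ℝ → S₀ → ℝ} (hb : IsSmoothPotential n b) :
    IsSymmetricOperator (IQ n) (volumeMeasure (warpedMetric σ fun _ ↦ 1)) (modelWave σ b) := by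
  have hP := isNormallyHyperbolic_modelWave hn hσ hb
  have hgP := isPseudoRiemannian_warpedMetric hn hσ (f := fun t ↦ t ^ (4 / (n : ℝ) - 2))
    (fun t ht ↦ (Real.contDiffAt_rpow_const_of_ne (ne_of_gt ht)).contDiffWithinAt)
    fun t ht ↦ Real.rpow_pos_of_pos ht _
  have hg := isPseudoRiemannian_warpedMetric hn hσ (f := fun _ ↦ 1) contDiffOn_const
    fun _ _ ↦ one_pos
  have := hg.isLocallyFiniteMeasure
  have : LocallyCompactSpace S₀ := ChartedSpace.locallyCompactSpace (EuclideanSpace ℝ (Fin n)) S₀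
  have : LocallyCompactSpace PosReal := isOpen_Ioi.locallyCompactSpace
  obtain ⟨k, -, hk⟩ := integral_wronskian_modelWave hn hσ hb (f := fun _ ↦ 1) contDiffOn_const
    fun _ _ ↦ one_pos
  refine hP.isSymmetricOperator _ hgP fun p u v hu hv hcu hsu ↦ ?_
  rw [hk p u v hu hv hcu hsu]
  have h0 : deriv (warpDensity n fun _ ↦ 1) = fun _ ↦ 0 := funext fun t ↦ by
    unfold warpDensity
    simp
  simp [h0, timeFlux]

theorem deriv_warpDensity_neg (hn : 2 ≤ n) {f : ℝ → ℝ} {f' t : ℝ} (hf : HasDerivAt f f' t)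
    (hft : 0 < f t) (hf' : f' < 0) : deriv (warpDensity n f) t < 0 := by
  have hn1 : (0 : ℝ) < n - 1 := by
    have : (2 : ℝ) ≤ n := by exact_mod_cast hn
    linarith
  have hq := div_pos hft hn1
  have h := ((hf.div_const ((n : ℝ) - 1)).fun_pow n).sqrt (pow_pos hq n).ne'
  have h2 : HasDerivAt (warpDensity n f) _ t := h
  rw [h2.deriv]
  refine div_neg_of_neg_of_pos ?_ (by have := pow_pos hq n; positivity)
  refine mul_neg_of_pos_of_neg ?_ (div_neg_of_neg_of_pos hf' hn1)
  have := pow_pos hq (n - 1)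
  have hn0 : (0 : ℝ) < n := by linarith
  positivity

/-- The time factor of the density is a multiple of `t^(2 - n)`, strictly decreasing for `n ≥ 3`. A
pair of test functions for which the flux left over has one sign then contradicts symmetry. -/
theorem not_isSymmetricOperator_modelWave [T2Space S₀] [Nonempty S₀] (hn : 3 ≤ n)
    {σ : TwoTensor (IS n) S₀} (hσ : IsPseudoRiemannian σ) {b : ℝ → S₀ → ℝ}
    (hb : IsSmoothPotential n b) :
    ¬ IsSymmetricOperator (IQ n)
      (volumeMeasure (warpedMetric σ fun t ↦ t ^ (4 / (n : ℝ) - 2))) (modelWave σ b) := by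
  intro hsymm
  have hn2 : 2 ≤ n := by omega
  have hr0 : 4 / (n : ℝ) - 2 < 0 := by
    have hn3 : (3 : ℝ) ≤ n := by exact_mod_cast hn
    rw [sub_neg, div_lt_iff₀ (by linarith)]
    linarith
  have hf : ContDiffOn ℝ ∞ (fun t : ℝ ↦ t ^ (4 / (n : ℝ) - 2)) (Ioi 0) := fun t ht ↦
    (Real.contDiffAt_rpow_const_of_ne (ne_of_gt ht)).contDiffWithinAt
  have hf0 : ∀ t : ℝ, 0 < t → 0 < t ^ (4 / (n : ℝ) - 2) := fun t ht ↦ Real.rpow_pos_of_pos ht _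
  have hP := isNormallyHyperbolic_modelWave hn2 hσ hb
  have hg := isPseudoRiemannian_warpedMetric hn2 hσ hf hf0
  have := hg.isLocallyFiniteMeasure
  obtain ⟨k, hk, hgreen⟩ := integral_wronskian_modelWave hn2 hσ hb hf hf0
  let p : PosReal × S₀ := (⟨1, mem_Ioi.2 one_pos⟩, Classical.arbitrary S₀)
  let φ : SmoothBumpFunction (IQ n) p := Classical.arbitrary _
  have hv : ContMDiff (IQ n) 𝓘(ℝ, ℝ) ∞ φ := φ.contMDiff
  have hcv : HasCompactSupport φ := φ.hasCompactSupport
  -- The factor `t` makes the Wronskian in `t` of `u` and `φ` equal to `φ²`.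
  let u : PosReal × S₀ → ℝ := fun q ↦ (q.1 : ℝ) * φ q
  have hu : ContMDiff (IQ n) 𝓘(ℝ, ℝ) ∞ u :=
    (ContMDiff.comp (contMDiff_subtype_val (U := PosReal)) contMDiff_fst).mul hv
  have hcu : HasCompactSupport u := hcv.mul_left
  have hsu : tsupport u ⊆ (extChartAt (IQ n) p).source := by
    rw [extChartAt_source]
    exact tsupport_mul_subset_right.trans φ.tsupport_subset_chartAt_source
  have hW := hgreen p u φ hu hv hcu hsu
  have h1 : Integrable (fun q ↦ u q * modelWave σ b φ q)
      (volumeMeasure (warpedMetric σ fun t ↦ t ^ (4 / (n : ℝ) - 2))) := by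
    simpa only [mul_comm] using hP.integrable_mul _ hg hv hu hcu
  rw [integral_sub (hP.integrable_mul _ hg hu hv hcv) h1, hsymm u φ hu hv hcu hcv, sub_self] at hW
  have hT := isOpen_extChartAt_target (I := IQ n) p
  set G : ℝ × EuclideanSpace ℝ (Fin n) → ℝ := fun z ↦ φ ((extChartAt (IQ n) p).symm z) with hG_def
  have hG : ContDiffOn ℝ ∞ G (extChartAt (IQ n) p).target := contDiffOn_comp_chart_symm hv
  set F : ℝ × EuclideanSpace ℝ (Fin n) → ℝ := fun z ↦ u ((extChartAt (IQ n) p).symm z) with hF_def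
  have hflux : ∀ z ∈ (extChartAt (IQ n) p).target, timeFlux (localMetric σ p.2)
      (deriv (warpDensity n fun t ↦ t ^ (4 / (n : ℝ) - 2))) F G z =
      -(-deriv (warpDensity n fun t ↦ t ^ (4 / (n : ℝ) - 2)) z.1 *
        flatVolume (localMetric σ p.2) z.2 * G z ^ 2) := fun z hz ↦ by
    have hFG : F =ᶠ[𝓝 z] fun z ↦ z.1 * G z := by
      filter_upwards [hT.mem_nhds hz] with w hw
      rw [extChartAt_spacetime_target] at hw
      simp only [hF_def, hG_def, u]
      congr 1
      rw [extChartAt_spacetime_symm p hw.1]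
    have hGd := ((hG.contDiffAt (hT.mem_nhds hz)).differentiableAt (by simp)).hasFDerivAt
    have hFd : HasFDerivAt (fun z : ℝ × EuclideanSpace ℝ (Fin n) ↦ z.1 * G z) _ z :=
      hasFDerivAt_fst.mul hGd
    rw [timeFlux, hFG.fderiv_eq, hFG.eq_of_nhds, hFd.fderiv]
    simp only [add_apply, smul_apply, smul_eq_mul, ContinuousLinearMap.coe_fst']
    ring
  have hneg : ∀ t : ℝ, 0 < t →
      0 < -deriv (warpDensity n fun t ↦ t ^ (4 / (n : ℝ) - 2)) t := fun t ht ↦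
    neg_pos.2 (deriv_warpDensity_neg hn2 (Real.hasDerivAt_rpow_const (Or.inl ht.ne')) (hf0 t ht)
      (mul_neg_of_neg_of_pos hr0 (Real.rpow_pos_of_pos ht _)))
  rw [setIntegral_congr_fun hT.measurableSet hflux, integral_neg, mul_neg, neg_neg] at hW
  have hpos : ∀ z ∈ (extChartAt (IQ n) p).target,
      0 < -deriv (warpDensity n fun t ↦ t ^ (4 / (n : ℝ) - 2)) z.1 *
        flatVolume (localMetric σ p.2) z.2 := fun z hz ↦ by
    rw [extChartAt_spacetime_target] at hz
    exact mul_pos (hneg _ hz.1) ((hσ p.2).flatVolume_pos hz.2)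
  have hK : IsCompact (extChartAt (IQ n) p '' tsupport φ) :=
    hcv.isCompact.image_of_continuousOn ((continuousOn_extChartAt p).mono
      (by rw [extChartAt_source]; exact φ.tsupport_subset_chartAt_source))
  have hKT : extChartAt (IQ n) p '' tsupport φ ⊆ (extChartAt (IQ n) p).target := by
    rintro _ ⟨q, hq, rfl⟩
    refine (extChartAt (IQ n) p).map_source ?_
    rw [extChartAt_source]
    exact φ.tsupport_subset_chartAt_source hq
  have hcont : ContinuousOn (fun z : ℝ × EuclideanSpace ℝ (Fin n) ↦
      -deriv (warpDensity n fun t ↦ t ^ (4 / (n : ℝ) - 2)) z.1 *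
        flatVolume (localMetric σ p.2) z.2 * G z ^ 2) (extChartAt (IQ n) p).target := by
    have hd : ContinuousOn (deriv (warpDensity n fun t ↦ t ^ (4 / (n : ℝ) - 2))) (Ioi 0) :=
      (contDiffOn_warpDensity hn2 hf hf0).continuousOn_deriv_of_isOpen isOpen_Ioi (by simp)
    have ht := extChartAt_spacetime_target (n := n) p
    exact (((hd.comp continuousOn_fst fun z hz ↦ (ht ▸ hz : z ∈ Ioi (0 : ℝ) ×ˢ _).1).neg.mul
      ((hσ p.2).contDiffOn_flatVolume.continuousOn.comp continuousOn_snd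
        fun z hz ↦ (ht ▸ hz : z ∈ Ioi (0 : ℝ) ×ˢ _).2))).mul (hG.continuousOn.pow 2)
  have hint := integrableOn_of_eq_zero_off_compact
    (Module.finBasis ℝ (ℝ × EuclideanSpace ℝ (Fin n))).addHaar hT hcont hK hKT fun z hz hzK ↦ by
      have : G z = 0 := image_eq_zero_of_notMem_tsupport (f := φ) fun h ↦
        hzK ⟨_, h, (extChartAt (IQ n) p).right_inv hz⟩
      rw [this]
      ring
  -- The integrand is positive wherever `G ≠ 0`, an open set which is nonempty because `φ` equals
  -- `1` at `p`.
  have hlt := (setIntegral_pos_iff_support_of_nonneg_ae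
    ((ae_restrict_iff' hT.measurableSet).2 (ae_of_all _ fun z hz ↦
      mul_nonneg (hpos z hz).le (sq_nonneg (G z)))) hint).2 (by
    refine lt_of_lt_of_le ((hG.continuousOn.isOpen_inter_preimage hT
      isOpen_compl_singleton).measure_pos _ ⟨extChartAt (IQ n) p p, mem_extChartAt_target p, ?_⟩)
      (measure_mono (t := _) fun z hz ↦ ⟨mul_ne_zero (hpos z hz.1).ne' (pow_ne_zero 2 hz.2), hz.1⟩)
    change G _ ≠ 0
    rw [hG_def]
    simp only [extChartAt_to_inv]
    rw [φ.eq_one]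
    exact one_ne_zero)
  exact (mul_pos hk hlt).ne hW

end Symmetry

end

end QuantizedGravity

/-! ### The main theorem -/

theorem mainTheorem5 {n : ℕ} (hn : 2 ≤ n)
    {S₀ : Type*} [TopologicalSpace S₀] [T2Space S₀] [SecondCountableTopology S₀]
    [ConnectedSpace S₀] [MeasurableSpace S₀] [BorelSpace S₀]
    [ChartedSpace (EuclideanSpace ℝ (Fin n)) S₀] [IsManifold (IS n) ∞ S₀]
    (σ : RiemannMetric n S₀) (hσ : IsCompleteMetric σ)
    {𝔤 : Type*} [NormedAddCommGroup 𝔤] [NormedSpace ℝ 𝔤] [FiniteDimensional ℝ 𝔤] [CompleteSpace 𝔤]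
    {G : Type*} [TopologicalSpace G] [T2Space G] [CompactSpace G] [ConnectedSpace G]
    [ChartedSpace 𝔤 G] [Group G] [LieGroup 𝓘(ℝ, 𝔤) ∞ G]
    [LieAlgebra.IsSemisimple ℝ (GroupLieAlgebra 𝓘(ℝ, 𝔤) G)]
    {E₀ : S₀ → Type*} [TopologicalSpace (TotalSpace 𝔤 E₀)]
    [∀ x, AddCommGroup (E₀ x)] [∀ x, Module ℝ (E₀ x)] [∀ x, TopologicalSpace (E₀ x)]
    [∀ x, IsTopologicalAddGroup (E₀ x)] [∀ x, ContinuousSMul ℝ (E₀ x)] [FiberBundle 𝔤 E₀]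
    [VectorBundle ℝ 𝔤 E₀] [ContMDiffVectorBundle ∞ 𝔤 E₀ (IS n)]
    (hE₀ : IsAdjointBundle 𝔤 G E₀)
    (A : GaugeConnection (IS n) 𝔤 G E₀)
    (Φ : ContMDiffSection (IS n) 𝔤 ∞ E₀)
    (V : TotalSpace 𝔤 E₀ → ℝ) (hV : ContMDiff ((IS n).prod 𝓘(ℝ, 𝔤)) 𝓘(ℝ, ℝ) ∞ V)
    (α₁ α₂ m Λ : ℝ) :
    (IsGloballyHyperbolic (warpedMetric σ.inner fun _ ↦ 1) timeField ∧
      IsSymmetricOperator (IQ n) (volumeMeasure (warpedMetric σ.inner fun _ ↦ 1))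
        (waveOperator σ.inner A Φ V α₁ α₂ m Λ)) ∧
    (IsGloballyHyperbolic (warpedMetric σ.inner fun t ↦ t ^ (4 / (n : ℝ) - 2)) timeField ∧
      IsNormallyHyperbolic (warpedMetric σ.inner fun t ↦ t ^ (4 / (n : ℝ) - 2))
        (waveOperator σ.inner A Φ V α₁ α₂ m Λ)) ∧
    (3 ≤ n →
      ¬ IsSymmetricOperator (IQ n)
          (volumeMeasure (warpedMetric σ.inner fun t ↦ t ^ (4 / (n : ℝ) - 2)))
          (waveOperator σ.inner A Φ V α₁ α₂ m Λ) ∧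
      HasBigBang (warpedMetric σ.inner fun t ↦ t ^ (4 / (n : ℝ) - 2))) := by
  have hσ' := isPseudoRiemannian_inner σ
  have hb := isSmoothPotential_wavePotential hE₀ hσ' A Φ hV α₁ α₂ m Λ
  have hf : ContDiffOn ℝ ∞ (fun t : ℝ ↦ t ^ (4 / (n : ℝ) - 2)) (Ioi 0) := fun t ht ↦
    (Real.contDiffAt_rpow_const_of_ne (ne_of_gt ht)).contDiffWithinAt
  have hf0 : ∀ t : ℝ, 0 < t → 0 < t ^ (4 / (n : ℝ) - 2) := fun t ht ↦ Real.rpow_pos_of_pos ht _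
  rw [waveOperator_eq]
  exact ⟨⟨isGloballyHyperbolic_warpedMetric hn hσ contDiffOn_const fun _ _ ↦ one_pos,
      isSymmetricOperator_modelWave hn hσ' hb⟩,
    ⟨isGloballyHyperbolic_warpedMetric hn hσ hf hf0, isNormallyHyperbolic_modelWave hn hσ' hb⟩,
    fun h3 ↦ ⟨not_isSymmetricOperator_modelWave h3 hσ' hb, hasBigBang_warpedMetric h3 hσ⟩⟩
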